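/- Let $d\ge 1$, $s>1+\frac d2$ and $1\le q\le\infty$. Fix a radial $\varphi\in C^\infty(\mathbb R^d;[0,1])$ with $\operatorname{supp}\varphi\subset\{\frac34\le|\xi|\le\frac83\}$, $\varphi=1$ on $\{\frac43\le|\xi|\le\frac32\}$ and $\sum_{j\in\mathbb Z}\varphi(2^{-j}\xi)=1$ for all $\xi\ne0$, and put $\Psi(\xi)=1-\sum_{j\ge0}\varphi(2^{-j}\xi)$. With $\widehat f(\xi)=\int_{\mathbb R^d} e^{-ix\cdot\xi}f(x)\,dx$, extended to tempered distributions, let $\Delta_jf=\mathcal F^{-1}(\varphi(2^{-j}\cdot)\widehat f)$ for $j\ge0$, $\Delta_{-1}f=\mathcal F^{-1}(\Psi\widehat f)$, $\Delta_jf=0$ for $j\le-2$, and $$\|f\|_{B^0_{\infty,q}}=\big\|(\|\Delta_jf\|_{L^\infty})_{j\in\mathbb Z}\big\|_{\ell^q}.$$ Consider the Cauchy problem for the viscous Hamilton--Jacobi equation $$\partial_tu-\Delta u=|\nabla u|^2\quad (t>0,\ x\in\mathbb R^d),\qquad u(0)=f, \qquad (1)$$ for real-valued $u\in C([0,\infty);H^s(\mathbb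 R^d))$, the equation being understood in the sense of tempered distributions on $\mathbb R^d$ at every time $t>0$. Then there exist real-valued initial data $f^N\in H^s(\mathbb R^d)$ and times $t_N>0$ $(N\ge1)$ and a constant $c_0>0$ independent of $N$ such that $$\|f^N\|_{B^0_{\infty,q}}\to0,\qquad t_N\to0\qquad(N\to\infty),$$ and such that, for every $N$, the problem (1) with $f=f^N$ has exactly one solution $u[f^N]\in C([0,\infty);H^s(\mathbb R^d))$, and $$\|u[f^N](t_N)\|_{B^0_{\infty,q}}\ge c_0 .$$ In particular, (1) is ill-posed in $B^0_{\infty,q}(\mathbb R^d)$: for every $T>0$ the solution map $f\mapsto u[f]$, from initial data in $H^s$ that have a global solution, with the norm of $B^0_{\infty,q}$, to $L^\infty(0,T;B^0_{\infty,q})$, is discontinuous at the origin. -/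

import Mathlib

open MeasureTheory Filter Topology
open scoped ENNReal SchwartzMap ContDiff LineDeriv Laplacian

noncomputable section

namespace HamiltonJacobi

/-- Real-valued functions in `L²(ℝ^d)`. -/
abbrev RealL2 (d : ℕ) : Type := Lp ℝ 2 (volume : Measure (EuclideanSpace ℝ (Fin d)))

/-- The tempered distribution defined by a real-valued `L²` function. -/
def toDist {d : ℕ} (f : RealL2 d) : 𝓢'(EuclideanSpace ℝ (Fin d), ℂ) :=
  Lp.toTemperedDistribution (Complex.ofRealCLM.compLp f)

/-- The `L^p` norm of a tempered distribution: the `L^p` norm of the (unique) `L^p` function that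
represents it, and `∞` if there is no such function. -/
def distLpENorm {d : ℕ} (p : ℝ≥0∞) [Fact (1 ≤ p)] (f : 𝓢'(EuclideanSpace ℝ (Fin d), ℂ)) : ℝ≥0∞ :=
  ⨅ (g : Lp ℂ p (volume : Measure (EuclideanSpace ℝ (Fin d))))
    (_ : Lp.toTemperedDistribution g = f), ‖g‖ₑ

/-- The norm of `H^s(ℝ^d)`, finite exactly on the distributions that are `MemSobolev s 2`. -/
def sobolevENorm {d : ℕ} (s : ℝ) (f : 𝓢'(EuclideanSpace ℝ (Fin d), ℂ)) : ℝ≥0∞ :=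
  distLpENorm 2 (TemperedDistribution.besselPotential (EuclideanSpace ℝ (Fin d)) ℂ s f)

/-- The functions `φ` that generate a dyadic partition of unity. -/
structure IsLittlewoodPaley {d : ℕ} (φ : EuclideanSpace ℝ (Fin d) → ℝ) : Prop where
  smooth : ContDiff ℝ ∞ φ
  radial : ∀ ξ η, ‖ξ‖ = ‖η‖ → φ ξ = φ η
  nonneg : ∀ ξ, 0 ≤ φ ξ
  le_one : ∀ ξ, φ ξ ≤ 1
  supp : tsupport φ ⊆ {ξ | 3 / 4 ≤ ‖ξ‖ ∧ ‖ξ‖ ≤ 8 / 3}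
  eq_one : ∀ ξ, 4 / 3 ≤ ‖ξ‖ → ‖ξ‖ ≤ 3 / 2 → φ ξ = 1
  partition : ∀ ξ, ξ ≠ 0 → HasSum (fun j : ℤ ↦ φ ((2 : ℝ) ^ (-j) • ξ)) 1

/-- The low-frequency cut-off `Ψ(ξ) = 1 - ∑_{j ≥ 0} φ(2^{-j} ξ)`. -/
def lowCutoff {d : ℕ} (φ : EuclideanSpace ℝ (Fin d) → ℝ) (ξ : EuclideanSpace ℝ (Fin d)) : ℝ :=
  1 - ∑' j : ℕ, φ ((2 : ℝ) ^ (-(j : ℤ)) • ξ)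

/-- The symbol of the Littlewood-Paley operator `Δ_j`, as a function of the angular frequency. -/
def blockSymbol {d : ℕ} (φ : EuclideanSpace ℝ (Fin d) → ℝ) (j : ℤ)
    (ξ : EuclideanSpace ℝ (Fin d)) : ℝ :=
  if 0 ≤ j then φ ((2 : ℝ) ^ (-j) • ξ) else if j = -1 then lowCutoff φ ξ else 0

/-- The (nonhomogeneous) Littlewood-Paley operator `Δ_j`. Mathlib's Fourier transform has the
kernel `exp(-2πi x·ξ)`, so that the angular frequency is `2πξ`. -/
def lpBlock {d : ℕ} (φ : EuclideanSpace ℝ (Fin d) → ℝ) (j : ℤ)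
    (f : 𝓢'(EuclideanSpace ℝ (Fin d), ℂ)) : 𝓢'(EuclideanSpace ℝ (Fin d), ℂ) :=
  TemperedDistribution.fourierMultiplierCLM ℂ
    (fun ξ ↦ (blockSymbol φ j ((2 * Real.pi) • ξ) : ℂ)) f

/-- The norm of the Besov space `B^σ_{p,r}(ℝ^d)`: the `ℓ^r(ℤ)` norm of `2^{jσ} ‖Δ_j f‖_{L^p}`. -/
def besovENorm {d : ℕ} (φ : EuclideanSpace ℝ (Fin d) → ℝ) (σ : ℝ) (p r : ℝ≥0∞) [Fact (1 ≤ p)]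
    (f : 𝓢'(EuclideanSpace ℝ (Fin d), ℂ)) : ℝ≥0∞ :=
  eLpNorm (fun j : ℤ ↦ ENNReal.ofReal ((2 : ℝ) ^ ((j : ℝ) * σ)) * distLpENorm p (lpBlock φ j f))
    r Measure.count

/-- `u ∈ C([0,∞); H^s(ℝ^d))` is real-valued and solves `∂_t u - Δu = |∇u|²`, `u(0) = f`; the
equation is understood in the sense of tempered distributions on `ℝ^d`, at every `t > 0`.
Only the values of `u` at nonnegative times matter. -/
structure IsGlobalSolution {d : ℕ} (s : ℝ) (f : RealL2 d) (u : ℝ → RealL2 d) : Prop where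
  initial : u 0 = f
  memSobolev : ∀ t, 0 ≤ t → TemperedDistribution.MemSobolev s 2 (toDist (u t))
  continuous : ∀ t, 0 ≤ t →
    Tendsto (fun τ ↦ sobolevENorm s (toDist (u τ - u t))) (𝓝[Set.Ici 0] t) (𝓝 0)
  equation : ∀ t, 0 < t → ∃ g : Fin d → RealL2 d,
    (∀ i, ∂_{EuclideanSpace.single i (1 : ℝ)} (toDist (u t)) = toDist (g i)) ∧
    ∀ ψ : 𝓢(EuclideanSpace ℝ (Fin d), ℂ),
      HasDerivAt (fun τ ↦ toDist (u τ) ψ)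
        ((Δ (toDist (u t))) ψ + ∫ x, ((∑ i, (g i x) ^ 2 : ℝ) : ℂ) * ψ x) t

/-- Continuity at the origin of the solution map, from initial data with the `B^0_{∞,q}` norm to
solutions on `[0,T]` with the norm of `L^∞(0,T; B^0_{∞,q})`. -/
def SolutionMapContinuousAtZero {d : ℕ} (φ : EuclideanSpace ℝ (Fin d) → ℝ) (s : ℝ) (q : ℝ≥0∞)
    (T : ℝ) : Prop :=
  ∀ u₀ : ℝ → RealL2 d, IsGlobalSolution s 0 u₀ → ∀ ε : ℝ≥0∞, 0 < ε → ∃ δ : ℝ≥0∞, 0 < δ ∧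
    ∀ (f : RealL2 d) (u : ℝ → RealL2 d), IsGlobalSolution s f u →
      besovENorm φ 0 ∞ q (toDist f) < δ →
        ∀ t ∈ Set.Icc 0 T, besovENorm φ 0 ∞ q (toDist (u t - u₀ t)) < ε

end HamiltonJacobi

end

/-! The Cole–Hopf substitution solves the equation explicitly: `u(t) = log (e^{tΔ} e^f)`. The data
have the form `f = B ∑_{k<K} cos (8^k μ e·x)` with a fixed slowly varying profile `B = a A` and a
very large `μ`. Every summand lies in its own dyadic block, so `f` has norm at most of order `a
K^{1/q}`.

Up to a cubic relative error in each factor, `e^f` is a Riesz product of factors `1 + z + z²/2`, `z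
= B cos θ`. Lacunary frequencies do not interact in the weak limit, and `cos²` averages to `1/2`, so
for `μ → ∞` the product tends weakly to `(1 + B²/4)^K` (`tendsto_integral_mul_riesz`). The heat flow
at a fixed small time turns weak limits into pointwise ones; letting the time tend to zero
afterwards, `u(t)` is close to `K log (1 + B²/4)`, that is, to `K a² A² / 4`. The quadratic
interaction of high frequencies has thus produced low frequencies in an arbitrarily short time.

The envelope `A` (`exists_envelope`) is a sum of `J` widely separated bumps, the one with index `j`
oscillating at half the central frequency of block `j`. Its square therefore has a component in each
of `J` blocks, while its supremum is bounded independently of `J`. Hence the norm of `u(t)` is at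
least of order `K a² J^{1/q}` (`exists_norm_inflation`). With `a → 0` this stays above a constant if
`K` is of order `a^{-2}` when `q = ∞`, and if `K = 1` with `J` large when `q < ∞`
(`exists_le_natCast_rpow`); in both cases the initial norm is of order `a`.

Uniqueness in `C([0,∞); H^s)` is an `L²` energy estimate for the difference of two solutions
(`IsGlobalSolution.unique`). Since `s > 1 + d/2`, the gradients are bounded on compact time
intervals, so the nonlinearity is absorbed by the dissipation and Grönwall's inequality applies. -/

noncomputable section

namespace HamiltonJacobi

open FourierTransform

/-- The underlying Euclidean space. -/
abbrev Space (d : ℕ) : Type := EuclideanSpace ℝ (Fin d)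

/-! ### Real `L²` functions and Schwartz functions as tempered distributions. -/

section Distributions

variable {d : ℕ}

/-- A real Schwartz function regarded as a complex one. -/
def cplx : 𝓢(Space d, ℝ) →L[ℝ] 𝓢(Space d, ℂ) := SchwartzMap.postcompCLM Complex.ofRealCLM

@[simp]
theorem cplx_apply (f : 𝓢(Space d, ℝ)) (x : Space d) : cplx f x = (f x : ℂ) := rfl

theorem toDist_apply (f : RealL2 d) (ψ : 𝓢(Space d, ℂ)) :
    toDist f ψ = ∫ x, ψ x * (f x : ℂ) := by
  rw [toDist, Lp.toTemperedDistribution_apply]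
  refine integral_congr_ae ?_
  filter_upwards [Complex.ofRealCLM.coeFn_compLp f] with x hx
  simp [hx]

theorem toDist_sub (f g : RealL2 d) : toDist (f - g) = toDist f - toDist g := by
  have h : Complex.ofRealCLM.compLp (f - g) =
      Complex.ofRealCLM.compLp f - Complex.ofRealCLM.compLp g :=
    map_sub (Complex.ofRealCLM.compLpₗ 2 (volume : Measure (Space d))) f g
  rw [toDist, h, ← Lp.toTemperedDistributionCLM_apply, map_sub]
  rfl

@[simp]
theorem toDist_zero : toDist (0 : RealL2 d) = 0 := by
  have := toDist_sub (0 : RealL2 d) 0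
  simpa using this

theorem toDist_toLp (f : 𝓢(Space d, ℝ)) :
    toDist (f.toLp 2) = (cplx f : 𝓢'(Space d, ℂ)) := by
  ext ψ
  rw [toDist_apply, SchwartzMap.coe_apply]
  refine integral_congr_ae ?_
  filter_upwards [f.coeFn_toLp 2] with x hx
  simp [hx]

theorem toTemperedDistribution_injective (p : ℝ≥0∞) [Fact (1 ≤ p)] :
    Function.Injective (fun f : Lp ℂ p (volume : Measure (Space d)) ↦
      Lp.toTemperedDistribution f) := by
  have h := LinearMap.ker_eq_bot.mp
    (Lp.ker_toTemperedDistributionCLM_eq_bot (E := Space d) (F := ℂ) (μ := volume) (p := p))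
  intro f g hfg
  exact h hfg

theorem distLpENorm_toTemperedDistribution (p : ℝ≥0∞) [Fact (1 ≤ p)]
    (g : Lp ℂ p (volume : Measure (Space d))) :
    distLpENorm p (Lp.toTemperedDistribution g) = ‖g‖ₑ := by
  refine le_antisymm (iInf₂_le_of_le g rfl le_rfl) (le_iInf₂ fun k hk ↦ ?_)
  rw [toTemperedDistribution_injective p hk]

/-- A tempered distribution tested on a Schwartz function is bounded by its `L^∞` norm. -/
theorem enorm_apply_le_distLpENorm_top (T : 𝓢'(Space d, ℂ)) (ψ : 𝓢(Space d, ℂ)) :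
    ‖T ψ‖ₑ ≤ distLpENorm ∞ T * eLpNorm ψ 1 volume := by
  have hψ := (ψ.memLp 1 (volume : Measure (Space d))).eLpNorm_ne_top
  rcases eq_or_ne (eLpNorm ψ 1 volume) 0 with h0 | h0
  · have h1 : (ψ : Space d → ℂ) =ᵐ[volume] 0 :=
      (eLpNorm_eq_zero_iff ψ.continuous.aestronglyMeasurable one_ne_zero).1 h0
    have : ψ = 0 := by
      ext x
      have := (Continuous.ae_eq_iff_eq volume ψ.continuous continuous_zero).1 h1
      rw [this]; rfl
    simp [this]
  · rw [← ENNReal.div_le_iff_le_mul (Or.inl h0) (Or.inl hψ)]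
    refine le_iInf₂ fun g hg ↦ ?_
    rw [ENNReal.div_le_iff_le_mul (Or.inl h0) (Or.inl hψ), ← hg, Lp.toTemperedDistribution_apply]
    calc ‖∫ x, ψ x • g x‖ₑ ≤ ∫⁻ x, ‖ψ x • g x‖ₑ := enorm_integral_le_lintegral_enorm _
      _ = eLpNorm (fun x ↦ ψ x • g x) 1 volume := by rw [eLpNorm_one_eq_lintegral_enorm]
      _ ≤ eLpNorm ψ 1 volume * eLpNorm g ∞ volume :=
        eLpNorm_smul_le_eLpNorm_mul_eLpNorm_top (𝕜 := ℂ) (φ := ψ) 1 (g : Space d → ℂ)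
          ψ.continuous.aestronglyMeasurable
      _ = ‖g‖ₑ * eLpNorm ψ 1 volume := by rw [mul_comm, Lp.enorm_def]

theorem distLpENorm_top_schwartz_le (f : 𝓢(Space d, ℂ)) {B : ℝ} (hf : ∀ x, ‖f x‖ ≤ B) :
    distLpENorm ∞ (f : 𝓢'(Space d, ℂ)) ≤ ENNReal.ofReal B := by
  rw [← Lp.toTemperedDistribution_toLp_eq (p := ∞), distLpENorm_toTemperedDistribution,
    Lp.enorm_def, eLpNorm_congr_ae (f.coeFn_toLp ∞ volume)]
  exact eLpNormEssSup_le_of_ae_bound (Eventually.of_forall hf)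

end Distributions

/-! ### Upper and lower bounds for the Besov norm of functions localized in frequency. -/

section Besov

variable {d : ℕ} {φ : Space d → ℝ}

/-- The Fourier support lies in the annulus where the symbol of `Δ_m` equals one. -/
def AnnulusSupported (m : ℕ) (g : 𝓢(Space d, ℂ)) : Prop :=
  ∀ ξ, 𝓕 g ξ ≠ 0 → 4 / 3 * 2 ^ m ≤ 2 * Real.pi * ‖ξ‖ ∧ 2 * Real.pi * ‖ξ‖ ≤ 3 / 2 * 2 ^ m

/-- One term of the partition of unity already equals one here and all terms are nonnegative, so the
other terms must vanish. -/
theorem blockSymbol_eq_ite (hφ : IsLittlewoodPaley φ) (m : ℕ) {ξ : Space d}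
    (h1 : 4 / 3 * 2 ^ m ≤ ‖ξ‖) (h2 : ‖ξ‖ ≤ 3 / 2 * 2 ^ m) (j : ℤ) :
    blockSymbol φ j ξ = if j = m then 1 else 0 := by
  have hm : (0 : ℝ) < 2 ^ m := by positivity
  have hξ : ξ ≠ 0 := by
    rintro rfl
    simp only [norm_zero] at h1
    linarith
  have hone : φ ((2 : ℝ) ^ (-(m : ℤ)) • ξ) = 1 := by
    apply hφ.eq_one
    · rw [norm_smul, zpow_neg, zpow_natCast, norm_inv, norm_pow, Real.norm_ofNat,
        inv_mul_eq_div, le_div_iff₀ hm]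
      exact h1
    · rw [norm_smul, zpow_neg, zpow_natCast, norm_inv, norm_pow, Real.norm_ofNat,
        inv_mul_eq_div, div_le_iff₀ hm]
      exact h2
  have hsum := hφ.partition ξ hξ
  have hzero : ∀ j : ℤ, j ≠ m → φ ((2 : ℝ) ^ (-j) • ξ) = 0 := by
    intro j hj
    have := sum_le_hasSum {j, (m : ℤ)} (fun i _ ↦ hφ.nonneg _) hsum
    rw [Finset.sum_pair hj, hone] at this
    exact le_antisymm (by linarith) (hφ.nonneg _)
  have hlow : lowCutoff φ ξ = 0 := by
    rw [lowCutoff, tsum_eq_single m, hone, sub_self]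
    intro j hj
    exact hzero j (by exact_mod_cast hj)
  unfold blockSymbol
  split_ifs with h0 h3 h3 h4 h4
  · rw [h3, hone]
  · exact hzero j h3
  · omega
  · exact hlow
  · omega
  · rfl

theorem blockSymbol_hasTemperateGrowth (hφ : IsLittlewoodPaley φ) (m : ℕ) :
    (fun ξ : Space d ↦ (blockSymbol φ m ((2 * Real.pi) • ξ) : ℂ)).HasTemperateGrowth := by
  have hc : HasCompactSupport φ := by
    refine HasCompactSupport.of_support_subset_isCompact
      (isCompact_closedBall (0 : Space d) (8 / 3)) ?_
    intro ξ hξ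
    simpa using (hφ.supp (subset_tsupport _ hξ)).2
  have h1 : φ.HasTemperateGrowth := hc.hasTemperateGrowth hφ.smooth
  have h2 : (fun ξ : Space d ↦ ((2 : ℝ) ^ (-(m : ℤ)) * (2 * Real.pi)) • ξ).HasTemperateGrowth :=
    (((2 : ℝ) ^ (-(m : ℤ)) * (2 * Real.pi)) • ContinuousLinearMap.id ℝ (Space d)).hasTemperateGrowth
  have h3 := (Complex.ofRealCLM.hasTemperateGrowth).comp (h1.comp h2)
  have h4 : (fun ξ : Space d ↦ (blockSymbol φ m ((2 * Real.pi) • ξ) : ℂ)) =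
      Complex.ofRealCLM ∘ φ ∘ fun ξ : Space d ↦ ((2 : ℝ) ^ (-(m : ℤ)) * (2 * Real.pi)) • ξ := by
    ext ξ
    simp [blockSymbol, smul_smul]
  rw [h4]
  exact h3

theorem lpBlock_of_annulusSupported (hφ : IsLittlewoodPaley φ) {m : ℕ} {g : 𝓢(Space d, ℂ)}
    (hg : AnnulusSupported m g) (j : ℤ) :
    lpBlock φ j (g : 𝓢'(Space d, ℂ)) = if j = m then (g : 𝓢'(Space d, ℂ)) else 0 := by
  -- No growth bound is available for a general `j`. Without temperate growth the multiplier takes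
  -- the default value zero, which is the right value because then `j ≠ m`.
  by_cases ht : (fun ξ : Space d ↦ (blockSymbol φ j ((2 * Real.pi) • ξ) : ℂ)).HasTemperateGrowth
  · have h1 : SchwartzMap.smulLeftCLM ℂ
        (fun ξ : Space d ↦ (blockSymbol φ j ((2 * Real.pi) • ξ) : ℂ)) (𝓕 g) =
        if j = m then 𝓕 g else 0 := by
      ext ξ
      rw [SchwartzMap.smulLeftCLM_apply_apply ht]
      by_cases hξ : 𝓕 g ξ = 0
      · split_ifs <;> simp [hξ]
      · have h2 := hg ξ hξ
        have hn : ‖(2 * Real.pi) • ξ‖ = 2 * Real.pi * ‖ξ‖ := by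
          rw [norm_smul, Real.norm_of_nonneg (by positivity)]
        rw [blockSymbol_eq_ite hφ m (by rw [hn]; exact h2.1) (by rw [hn]; exact h2.2)]
        split_ifs <;> simp
    rw [lpBlock, TemperedDistribution.fourierMultiplierCLM_toTemperedDistributionCLM_eq ht,
      SchwartzMap.fourierMultiplierCLM_apply, h1]
    split_ifs
    · rw [fourierInv_fourier_eq]
    · have : 𝓕⁻ (0 : 𝓢(Space d, ℂ)) = 0 := map_zero (fourierInvCLM ℂ 𝓢(Space d, ℂ))
      rw [this, map_zero]
  · rw [if_neg]
    · ext ψ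
      simp [lpBlock, SchwartzMap.smulLeftCLM, ht]
    · rintro rfl
      exact ht (blockSymbol_hasTemperateGrowth hφ m)

/-- By duality the multiplier acts on the test function instead. There it is the identity, since the
annulus is invariant under `ξ ↦ -ξ` and so also contains the support of `𝓕⁻ ψ`. -/
theorem lpBlock_apply_of_annulusSupported (hφ : IsLittlewoodPaley φ) {m : ℕ} {ψ : 𝓢(Space d, ℂ)}
    (hψ : AnnulusSupported m ψ) (T : 𝓢'(Space d, ℂ)) :
    lpBlock φ m T ψ = T ψ := by
  rw [lpBlock, TemperedDistribution.fourierMultiplierCLM_apply_apply]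
  congr 1
  have h1 : SchwartzMap.smulLeftCLM ℂ
      (fun ξ : Space d ↦ (blockSymbol φ m ((2 * Real.pi) • ξ) : ℂ)) (𝓕⁻ ψ) = 𝓕⁻ ψ := by
    ext ξ
    rw [SchwartzMap.smulLeftCLM_apply_apply (blockSymbol_hasTemperateGrowth hφ m)]
    by_cases hξ : 𝓕⁻ ψ ξ = 0
    · simp [hξ]
    · have h3 : 𝓕 ψ (-ξ) ≠ 0 := by
        intro h
        apply hξ
        rw [SchwartzMap.fourierInv_coe, Real.fourierInv_eq_fourier_neg]
        exact h
      have h2 := hψ (-ξ) h3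
      have hn : ‖(2 * Real.pi) • ξ‖ = 2 * Real.pi * ‖-ξ‖ := by
        rw [norm_smul, Real.norm_of_nonneg (by positivity), norm_neg]
      rw [blockSymbol_eq_ite hφ m (by rw [hn]; exact h2.1) (by rw [hn]; exact h2.2)]
      simp
  rw [h1, fourier_fourierInv_eq]

/-- Lower bound of the Besov norm by testing finitely many Littlewood-Paley blocks. -/
theorem le_besovENorm (hφ : IsLittlewoodPaley φ) {q : ℝ≥0∞} (hq : 1 ≤ q) (T : 𝓢'(Space d, ℂ))
    {S : Finset ℕ} (hS : S.Nonempty) (ψ : ℕ → 𝓢(Space d, ℂ))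
    (hψ : ∀ j ∈ S, AnnulusSupported j (ψ j)) {b : ℝ} {M : ℝ} (hM : 0 < M)
    (hb : ∀ j ∈ S, b ≤ ‖T (ψ j)‖) (hψM : ∀ j ∈ S, ∫ x, ‖ψ j x‖ ≤ M) :
    ENNReal.ofReal (b / M) * (S.card : ℝ≥0∞) ^ (1 / q.toReal) ≤ besovENorm φ 0 ∞ q T := by
  set S' : Finset ℤ := S.map Nat.castEmbedding with hS'
  have hcard : Measure.count (S' : Set ℤ) = (S.card : ℝ≥0∞) := by
    rw [Measure.count_apply_finset, hS', Finset.card_map]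
  have hq0 : q ≠ 0 := (zero_lt_one.trans_le hq).ne'
  have hne : Measure.count (S' : Set ℤ) ≠ 0 := by
    rw [hcard]
    simpa using hS.ne_empty
  -- The comparison sequence is constant on the chosen blocks and zero elsewhere. For `q = ∞` the
  -- exponent `1 / q.toReal` is `1 / 0 = 0`, which gives the supremum norm.
  have h1 := eLpNorm_indicator_const' (μ := (Measure.count : Measure ℤ)) (p := q)
    (c := ENNReal.ofReal (b / M)) S'.measurableSet hne hq0
  rw [hcard] at h1
  rw [enorm_eq_self] at h1
  rw [← h1, besovENorm]
  refine eLpNorm_mono_enorm fun j ↦ ?_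
  simp only [enorm_eq_self, mul_zero, Real.rpow_zero, ENNReal.ofReal_one, one_mul]
  by_cases hj : j ∈ (S' : Set ℤ)
  · rw [Set.indicator_of_mem hj]
    obtain ⟨m, hm, rfl⟩ : ∃ m ∈ S, (m : ℤ) = j := by simpa [hS'] using hj
    have h2 := enorm_apply_le_distLpENorm_top (lpBlock φ m T) (ψ m)
    rw [lpBlock_apply_of_annulusSupported hφ (hψ m hm)] at h2
    have h3 : eLpNorm (ψ m) 1 volume ≤ ENNReal.ofReal M := by
      rw [eLpNorm_one_eq_lintegral_enorm,
        ← ofReal_integral_norm_eq_lintegral_enorm (ψ m).integrable]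
      exact ENNReal.ofReal_le_ofReal (hψM m hm)
    rw [ENNReal.ofReal_div_of_pos hM]
    refine ENNReal.div_le_of_le_mul ?_
    calc ENNReal.ofReal b ≤ ‖T (ψ m)‖ₑ := by
          rw [← ofReal_norm]; exact ENNReal.ofReal_le_ofReal (hb m hm)
      _ ≤ _ := h2
      _ ≤ _ := by gcongr
  · rw [Set.indicator_of_notMem hj]
    exact zero_le

/-- Upper bound of the Besov norm of a sum of functions, each of which occupies one block. -/
theorem besovENorm_sum_le (hφ : IsLittlewoodPaley φ) {q : ℝ≥0∞} (hq : 1 ≤ q)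
    {S : Finset ℕ} (hS : S.Nonempty) (g : ℕ → 𝓢(Space d, ℂ))
    (hg : ∀ j ∈ S, AnnulusSupported j (g j)) {B : ℝ} (hB : ∀ j ∈ S, ∀ x, ‖g j x‖ ≤ B) :
    besovENorm φ 0 ∞ q ((∑ j ∈ S, g j : 𝓢(Space d, ℂ)) : 𝓢'(Space d, ℂ)) ≤
      ENNReal.ofReal B * (S.card : ℝ≥0∞) ^ (1 / q.toReal) := by
  set S' : Finset ℤ := S.map Nat.castEmbedding with hS'
  have hcard : Measure.count (S' : Set ℤ) = (S.card : ℝ≥0∞) := by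
    rw [Measure.count_apply_finset, hS', Finset.card_map]
  have hq0 : q ≠ 0 := (zero_lt_one.trans_le hq).ne'
  have hne : Measure.count (S' : Set ℤ) ≠ 0 := by
    rw [hcard]
    simpa using hS.ne_empty
  have h1 := eLpNorm_indicator_const' (μ := (Measure.count : Measure ℤ)) (p := q)
    (c := ENNReal.ofReal B) S'.measurableSet hne hq0
  rw [hcard] at h1
  rw [enorm_eq_self] at h1
  rw [← h1, besovENorm]
  have hblock : ∀ j : ℤ, lpBlock φ j ((∑ j ∈ S, g j : 𝓢(Space d, ℂ)) : 𝓢'(Space d, ℂ)) =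
      ∑ m ∈ S, if j = m then (g m : 𝓢'(Space d, ℂ)) else 0 := by
    intro j
    rw [map_sum, lpBlock, map_sum]
    exact Finset.sum_congr rfl fun m hm ↦ lpBlock_of_annulusSupported hφ (hg m hm) j
  refine eLpNorm_mono_enorm fun j ↦ ?_
  simp only [enorm_eq_self, mul_zero, Real.rpow_zero, ENNReal.ofReal_one, one_mul]
  rw [hblock]
  by_cases hj : j ∈ (S' : Set ℤ)
  · rw [Set.indicator_of_mem hj]
    obtain ⟨m, hm, rfl⟩ : ∃ m ∈ S, (m : ℤ) = j := by simpa [hS'] using hj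
    rw [Finset.sum_eq_single m]
    · simpa using distLpENorm_top_schwartz_le (g m) (hB m hm)
    · intro b _ hb
      rw [if_neg (by exact_mod_cast hb.symm)]
    · exact fun h ↦ absurd hm h
  · rw [Set.indicator_of_notMem hj, Finset.sum_eq_zero]
    · have := distLpENorm_toTemperedDistribution ∞ (0 : Lp ℂ ∞ (volume : Measure (Space d)))
      rw [← Lp.toTemperedDistributionCLM_apply, map_zero] at this
      simp [this]
    · intro m hm
      rw [if_neg]
      rintro rfl
      exact hj (by simpa [hS'] using hm)

end Besov

/-! ### Fourier multipliers on `L²` and their extension by density. -/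

section Multipliers

variable {d : ℕ}

/-- Complex-valued functions in `L²(ℝ^d)`. -/
abbrev CplxL2 (d : ℕ) : Type := Lp ℂ 2 (volume : Measure (Space d))

theorem norm_toLp_two_sq (g : 𝓢(Space d, ℂ)) : ‖g.toLp 2‖ ^ 2 = ∫ x, ‖g x‖ ^ 2 := by
  rw [SchwartzMap.norm_toLp' (by simp) (by simp)]
  have h0 : (0 : ℝ) ≤ ∫ x, ‖g x‖ ^ 2 := by positivity
  simp only [ENNReal.toReal_ofNat, Real.rpow_ofNat]
  rw [← Real.rpow_natCast, ← Real.rpow_mul h0]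
  norm_num

theorem integrable_norm_sq (g : 𝓢(Space d, ℂ)) : Integrable fun x ↦ ‖g x‖ ^ 2 :=
  (g.memLp 2).integrable_norm_pow (by simp)

/-- A Fourier multiplier with a bounded symbol is bounded on `L²`. -/
theorem norm_fourierMultiplier_toLp_le {m : Space d → ℂ} (hm : m.HasTemperateGrowth) {M : ℝ}
    (hM : ∀ ξ, ‖m ξ‖ ≤ M) (g : 𝓢(Space d, ℂ)) :
    ‖(SchwartzMap.fourierMultiplierCLM ℂ m g).toLp 2‖ ≤ M * ‖g.toLp 2‖ := by
  have hM0 : 0 ≤ M := (norm_nonneg _).trans (hM 0)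
  rw [← SchwartzMap.norm_fourier_toL2_eq, SchwartzMap.fourierMultiplierCLM_apply,
    fourier_fourierInv_eq, ← SchwartzMap.norm_fourier_toL2_eq g]
  refine le_of_sq_le_sq ?_ (by positivity)
  rw [mul_pow, norm_toLp_two_sq, norm_toLp_two_sq, ← integral_const_mul]
  refine integral_mono (integrable_norm_sq _) ((integrable_norm_sq _).const_mul _) fun ξ ↦ ?_
  simp only
  rw [SchwartzMap.smulLeftCLM_apply_apply hm, norm_smul, mul_pow]
  gcongr
  exact hM ξ

/-- A Fourier multiplier with a symbol in `L²` maps `L²` to `L^∞`. -/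
theorem norm_fourierMultiplier_apply_le {m : Space d → ℂ} (hm : m.HasTemperateGrowth)
    (hm2 : MemLp m 2) (g : 𝓢(Space d, ℂ)) (x : Space d) :
    ‖SchwartzMap.fourierMultiplierCLM ℂ m g x‖ ≤ (eLpNorm m 2).toReal * ‖g.toLp 2‖ := by
  -- Cauchy–Schwarz in the inverse Fourier integral; the character has modulus one.
  have key : ∀ G : 𝓢(Space d, ℂ), ‖∫ v, Real.fourierChar (inner ℝ v x) • (m v • G v)‖ₑ ≤
      eLpNorm m 2 * eLpNorm G 2 := by
    intro G
    have h := eLpNorm_smul_le_mul_eLpNorm (p := 2) (q := 2) (r := 1) (φ := m)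
      (f := (G : Space d → ℂ)) G.continuous.aestronglyMeasurable hm2.1
    rw [eLpNorm_one_eq_lintegral_enorm] at h
    refine (enorm_integral_le_lintegral_enorm _).trans (le_trans (le_of_eq ?_) h)
    refine lintegral_congr fun v ↦ ?_
    rw [Circle.smul_def, enorm_smul, ← ofReal_norm, Circle.norm_coe]
    simp
  have h2 := ENNReal.toReal_mono
    (ENNReal.mul_ne_top hm2.eLpNorm_ne_top ((𝓕 g).memLp 2 volume).eLpNorm_ne_top) (key (𝓕 g))
  rw [toReal_enorm, ENNReal.toReal_mul, ← SchwartzMap.norm_toLp,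
    SchwartzMap.norm_fourier_toL2_eq] at h2
  rw [SchwartzMap.fourierMultiplierCLM_apply, SchwartzMap.fourierInv_coe, Real.fourierInv_eq,
    SchwartzMap.smulLeftCLM_apply hm]
  exact h2

theorem schwartz_toLp_sub (a b : 𝓢(Space d, ℂ)) :
    (a - b).toLp 2 (volume : Measure (Space d)) = a.toLp 2 volume - b.toLp 2 volume :=
  map_sub (SchwartzMap.toLpCLM ℂ ℂ 2 (volume : Measure (Space d))) a b

/-- Extension by density: an operator on distributions that is `L²` bounded on Schwartz
functions. -/
theorem tendsto_toLp_of_bounded {T : 𝓢(Space d, ℂ) →L[ℂ] 𝓢(Space d, ℂ)}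
    {T' : 𝓢'(Space d, ℂ) →L[ℂ] 𝓢'(Space d, ℂ)}
    (hT : ∀ g : 𝓢(Space d, ℂ), T' (g : 𝓢'(Space d, ℂ)) = (T g : 𝓢'(Space d, ℂ))) {M : ℝ}
    (hM : ∀ g : 𝓢(Space d, ℂ), ‖(T g).toLp 2‖ ≤ M * ‖g.toLp 2‖) {k F : CplxL2 d}
    (hF : T' (Lp.toTemperedDistribution k) = Lp.toTemperedDistribution F)
    {κ : ℕ → 𝓢(Space d, ℂ)} (hκ : Tendsto (fun n ↦ (κ n).toLp 2) atTop (𝓝 k)) :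
    Tendsto (fun n ↦ (T (κ n)).toLp 2) atTop (𝓝 F) := by
  have hc : CauchySeq fun n ↦ (T (κ n)).toLp 2 (volume : Measure (Space d)) := by
    have h1 := hκ.cauchySeq
    rw [Metric.cauchySeq_iff] at h1 ⊢
    intro ε hε
    obtain ⟨N, hN⟩ := h1 (ε / (|M| + 1)) (by positivity)
    refine ⟨N, fun a ha b hb ↦ ?_⟩
    have h2 := hN a ha b hb
    rw [dist_eq_norm, ← schwartz_toLp_sub] at h2 ⊢
    rw [← map_sub]
    rw [lt_div_iff₀ (by positivity)] at h2
    have h3 := hM (κ a - κ b)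
    have h4 := norm_nonneg ((κ a - κ b).toLp 2 (volume : Measure (Space d)))
    nlinarith [le_abs_self M]
  obtain ⟨F', hF'⟩ := cauchySeq_tendsto_of_complete hc
  -- The `L²` limit exists by completeness. It is identified among distributions, where `T'` is
  -- continuous and into which `L²` embeds injectively.
  suffices h : F' = F by rwa [← h]
  apply toTemperedDistribution_injective 2
  have h1 := ((Lp.toTemperedDistributionCLM ℂ volume 2).continuous.tendsto F').comp hF'
  have h2 := (T'.continuous.tendsto _).comp
    (((Lp.toTemperedDistributionCLM ℂ volume 2).continuous.tendsto k).comp hκ)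
  simp only [Lp.toTemperedDistributionCLM_apply] at h1 h2
  rw [hF] at h2
  refine tendsto_nhds_unique h1 (h2.congr fun n ↦ ?_)
  simp only [Function.comp_apply]
  rw [Lp.toTemperedDistributionCLM_apply, Lp.toTemperedDistributionCLM_apply,
    Lp.toTemperedDistribution_toLp_eq, Lp.toTemperedDistribution_toLp_eq, hT]

theorem exists_schwartz_tendsto (k : CplxL2 d) :
    ∃ κ : ℕ → 𝓢(Space d, ℂ), Tendsto (fun n ↦ (κ n).toLp 2) atTop (𝓝 k) := by
  have h := SchwartzMap.denseRange_toLpCLM (E := Space d) (F := ℂ) (p := 2) (μ := volume)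
    ENNReal.ofNat_ne_top
  have hk : k ∈ closure (Set.range (SchwartzMap.toLpCLM ℝ ℂ 2 (volume : Measure (Space d)))) := h k
  obtain ⟨x, hx, hx'⟩ := mem_closure_iff_seq_limit.1 hk
  choose κ hκ using hx
  exact ⟨κ, hx'.congr fun n ↦ (hκ n).symm⟩

theorem norm_le_of_bounded {T : 𝓢(Space d, ℂ) →L[ℂ] 𝓢(Space d, ℂ)}
    {T' : 𝓢'(Space d, ℂ) →L[ℂ] 𝓢'(Space d, ℂ)}
    (hT : ∀ g : 𝓢(Space d, ℂ), T' (g : 𝓢'(Space d, ℂ)) = (T g : 𝓢'(Space d, ℂ))) {M : ℝ}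
    (hM : ∀ g : 𝓢(Space d, ℂ), ‖(T g).toLp 2‖ ≤ M * ‖g.toLp 2‖) {k F : CplxL2 d}
    (hF : T' (Lp.toTemperedDistribution k) = Lp.toTemperedDistribution F) : ‖F‖ ≤ M * ‖k‖ := by
  obtain ⟨κ, hκ⟩ := exists_schwartz_tendsto k
  exact le_of_tendsto_of_tendsto' (tendsto_toLp_of_bounded hT hM hF hκ).norm
    (hκ.norm.const_mul M) fun n ↦ hM _

/-- An `L²` convergent sequence converges almost everywhere along a subsequence, so the pointwise
bound survives the limit. -/
theorem ae_norm_le_of_bounded {T : 𝓢(Space d, ℂ) →L[ℂ] 𝓢(Space d, ℂ)}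
    {T' : 𝓢'(Space d, ℂ) →L[ℂ] 𝓢'(Space d, ℂ)}
    (hT : ∀ g : 𝓢(Space d, ℂ), T' (g : 𝓢'(Space d, ℂ)) = (T g : 𝓢'(Space d, ℂ))) {M : ℝ}
    (hM : ∀ g : 𝓢(Space d, ℂ), ‖(T g).toLp 2‖ ≤ M * ‖g.toLp 2‖) {C : ℝ}
    (hC : ∀ (g : 𝓢(Space d, ℂ)) (x : Space d), ‖T g x‖ ≤ C * ‖g.toLp 2‖) {k F : CplxL2 d}
    (hF : T' (Lp.toTemperedDistribution k) = Lp.toTemperedDistribution F) :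
    ∀ᵐ x, ‖F x‖ ≤ C * ‖k‖ := by
  obtain ⟨κ, hκ⟩ := exists_schwartz_tendsto k
  have h1 := tendsto_toLp_of_bounded hT hM hF hκ
  have h2 : TendstoInMeasure volume (fun n ↦ ((T (κ n)).toLp 2 : Space d → ℂ)) atTop F :=
    tendstoInMeasure_of_tendsto_Lp h1
  obtain ⟨ns, hns, hae⟩ := h2.exists_seq_tendsto_ae
  have h3 : ∀ᵐ x, ∀ n, ((T (κ n)).toLp 2 : Space d → ℂ) x = T (κ n) x :=
    ae_all_iff.2 fun n ↦ (T (κ n)).coeFn_toLp 2 volume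
  filter_upwards [hae, h3] with x hx h3x
  refine le_of_tendsto_of_tendsto' hx.norm
    ((hκ.comp hns.tendsto_atTop).norm.const_mul C) fun n ↦ ?_
  rw [h3x]
  exact hC _ _

end Multipliers

/-! ### The gradient of an `H^s` function in `L²` and in `L^∞`. -/

section Gradient

variable {d : ℕ}

/-- The Bessel potential on Schwartz functions. -/
def besselS (d : ℕ) (s : ℝ) : 𝓢(Space d, ℂ) →L[ℂ] 𝓢(Space d, ℂ) :=
  SchwartzMap.fourierMultiplierCLM ℂ (fun ξ ↦ (((1 + ‖ξ‖ ^ 2) ^ (s / 2) : ℝ) : ℂ))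

theorem besselPotential_schwartz (s : ℝ) (g : 𝓢(Space d, ℂ)) :
    TemperedDistribution.besselPotential (Space d) ℂ s (g : 𝓢'(Space d, ℂ)) =
      (besselS d s g : 𝓢'(Space d, ℂ)) :=
  TemperedDistribution.fourierMultiplierCLM_toTemperedDistributionCLM_eq (by fun_prop) g

theorem norm_besselS_toLp_le {s : ℝ} (hs : s ≤ 0) (g : 𝓢(Space d, ℂ)) :
    ‖(besselS d s g).toLp 2‖ ≤ 1 * ‖g.toLp 2‖ := by
  refine norm_fourierMultiplier_toLp_le (by fun_prop) (fun ξ ↦ ?_) g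
  rw [Complex.norm_real, Real.norm_of_nonneg (by positivity)]
  exact Real.rpow_le_one_of_one_le_of_nonpos (by simp) (by linarith)

theorem abs_inner_mul_rpow_le (s : ℝ) (ξ e : Space d) (he : ‖e‖ = 1) :
    ‖((inner ℝ ξ e * (1 + ‖ξ‖ ^ 2) ^ (-s / 2) : ℝ) : ℂ)‖ ≤ (1 + ‖ξ‖ ^ 2) ^ ((1 - s) / 2) := by
  have h0 : (0 : ℝ) < 1 + ‖ξ‖ ^ 2 := by positivity
  rw [Complex.norm_real, norm_mul, Real.norm_of_nonneg (by positivity : (0 : ℝ) ≤ _ ^ (-s / 2))]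
  have h1 : ‖inner ℝ ξ e‖ ≤ (1 + ‖ξ‖ ^ 2) ^ (1 / 2 : ℝ) := by
    rw [← Real.sqrt_eq_rpow]
    refine (norm_inner_le_norm ξ e).trans ?_
    rw [he, mul_one]
    exact Real.le_sqrt_of_sq_le (by linarith)
  calc _ ≤ (1 + ‖ξ‖ ^ 2) ^ (1 / 2 : ℝ) * (1 + ‖ξ‖ ^ 2) ^ (-s / 2) := by gcongr
    _ = _ := by rw [← Real.rpow_add h0]; ring_nf

theorem lineDeriv_besselS (s : ℝ) (e : Space d) (g : 𝓢(Space d, ℂ)) :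
    ∂_{e} (besselS d (-s) g) = (2 * Real.pi * Complex.I) • SchwartzMap.fourierMultiplierCLM ℂ
      (fun ξ ↦ ((inner ℝ ξ e * (1 + ‖ξ‖ ^ 2) ^ (-s / 2) : ℝ) : ℂ)) g := by
  rw [SchwartzMap.lineDeriv_eq_fourierMultiplierCLM, besselS,
    ← SchwartzMap.fourierMultiplierCLM_ofReal ℂ (by fun_prop),
    SchwartzMap.fourierMultiplierCLM_fourierMultiplierCLM_apply (by fun_prop) (by fun_prop)]
  congr 3
  ext ξ
  simp

theorem norm_lineDeriv_besselS_toLp_le {s : ℝ} (hs : 1 ≤ s) {e : Space d} (he : ‖e‖ = 1)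
    (g : 𝓢(Space d, ℂ)) :
    ‖(∂_{e} (besselS d (-s) g)).toLp 2‖ ≤ 2 * Real.pi * ‖g.toLp 2‖ := by
  rw [lineDeriv_besselS]
  have h1 : ∀ (c : ℂ) (a : 𝓢(Space d, ℂ)), (c • a).toLp 2 (volume : Measure (Space d)) =
      c • a.toLp 2 volume :=
    fun c a ↦ map_smul (SchwartzMap.toLpCLM ℂ ℂ 2 (volume : Measure (Space d))) c a
  rw [h1, norm_smul]
  have h2 : ‖(2 * Real.pi * Complex.I : ℂ)‖ = 2 * Real.pi := by
    simp [abs_of_pos Real.pi_pos]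
  rw [h2]
  have h3 := norm_fourierMultiplier_toLp_le (M := 1)
    (m := fun ξ : Space d ↦ ((inner ℝ ξ e * (1 + ‖ξ‖ ^ 2) ^ (-s / 2) : ℝ) : ℂ)) (by fun_prop)
    (fun ξ ↦ (abs_inner_mul_rpow_le s ξ e he).trans
      (Real.rpow_le_one_of_one_le_of_nonpos (by simp) (by linarith))) g
  have := Real.pi_pos
  nlinarith

/-- The symbol is dominated by `(1 + |ξ|²)^{(1-s)/2}`, which is square integrable because `2 (s - 1)
> d`. -/
theorem exists_norm_lineDeriv_besselS_apply_le {s : ℝ} (hs : 1 + (d : ℝ) / 2 < s) :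
    ∃ C : ℝ, 0 ≤ C ∧ ∀ e : Space d, ‖e‖ = 1 → ∀ (g : 𝓢(Space d, ℂ)) (x : Space d),
      ‖∂_{e} (besselS d (-s) g) x‖ ≤ C * ‖g.toLp 2‖ := by
  have hw : MemLp (fun ξ : Space d ↦ (1 + ‖ξ‖ ^ 2) ^ ((1 - s) / 2)) 2 := by
    have hc : Continuous fun ξ : Space d ↦ (1 + ‖ξ‖ ^ 2) ^ ((1 - s) / 2) := by
      have h : (fun ξ : Space d ↦ (1 + ‖ξ‖ ^ 2) ^ ((1 - s) / 2)).HasTemperateGrowth := by fun_prop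
      exact h.1.continuous
    rw [memLp_two_iff_integrable_sq hc.aestronglyMeasurable]
    have h := integrable_rpow_neg_one_add_norm_sq (E := Space d) (μ := volume) (r := 2 * (s - 1))
      (by simp only [finrank_euclideanSpace, Fintype.card_fin]; linarith)
    refine h.congr (Eventually.of_forall fun ξ ↦ ?_)
    simp only
    rw [← Real.rpow_mul_natCast (by positivity)]
    congr 1
    push_cast
    ring
  refine ⟨2 * Real.pi * (eLpNorm (fun ξ : Space d ↦ (1 + ‖ξ‖ ^ 2) ^ ((1 - s) / 2)) 2).toReal,
    by positivity, fun e he g x ↦ ?_⟩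
  have hle : ∀ ξ : Space d, ‖((inner ℝ ξ e * (1 + ‖ξ‖ ^ 2) ^ (-s / 2) : ℝ) : ℂ)‖ ≤
      ‖(1 + ‖ξ‖ ^ 2) ^ ((1 - s) / 2)‖ := fun ξ ↦
    (abs_inner_mul_rpow_le s ξ e he).trans (le_abs_self _)
  have ht : (fun ξ : Space d ↦
      ((inner ℝ ξ e * (1 + ‖ξ‖ ^ 2) ^ (-s / 2) : ℝ) : ℂ)).HasTemperateGrowth := by fun_prop
  have hm : MemLp (fun ξ : Space d ↦ ((inner ℝ ξ e * (1 + ‖ξ‖ ^ 2) ^ (-s / 2) : ℝ) : ℂ)) 2 :=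
    hw.mono ht.1.continuous.aestronglyMeasurable (Eventually.of_forall hle)
  have h1 := norm_fourierMultiplier_apply_le ht hm g x
  have h2 : (eLpNorm (fun ξ : Space d ↦
      ((inner ℝ ξ e * (1 + ‖ξ‖ ^ 2) ^ (-s / 2) : ℝ) : ℂ)) 2).toReal ≤
      (eLpNorm (fun ξ : Space d ↦ (1 + ‖ξ‖ ^ 2) ^ ((1 - s) / 2)) 2).toReal :=
    ENNReal.toReal_mono hw.eLpNorm_ne_top (eLpNorm_mono hle)
  have h3 : ‖(2 * Real.pi * Complex.I : ℂ)‖ = 2 * Real.pi := by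
    simp [abs_of_pos Real.pi_pos]
  rw [lineDeriv_besselS, smul_apply, norm_smul, h3, mul_assoc (2 * Real.pi)]
  refine mul_le_mul_of_nonneg_left (h1.trans ?_) (by positivity)
  gcongr

/-- A real `L²` function regarded as a complex one. -/
def cplxL2 (f : RealL2 d) : CplxL2 d := Complex.ofRealCLM.compLp f

theorem cplxL2_sub (f g : RealL2 d) : cplxL2 (f - g) = cplxL2 f - cplxL2 g :=
  map_sub (Complex.ofRealCLM.compLpₗ 2 (volume : Measure (Space d))) f g

theorem cplxL2_add (f g : RealL2 d) : cplxL2 (f + g) = cplxL2 f + cplxL2 g :=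
  map_add (Complex.ofRealCLM.compLpₗ 2 (volume : Measure (Space d))) f g

theorem coeFn_cplxL2 (f : RealL2 d) : ∀ᵐ x, cplxL2 f x = (f x : ℂ) :=
  Complex.ofRealCLM.coeFn_compLp f

@[simp]
theorem norm_cplxL2 (f : RealL2 d) : ‖cplxL2 f‖ = ‖f‖ := by
  rw [Lp.norm_def, Lp.norm_def]
  congr 1
  refine eLpNorm_congr_norm_ae ?_
  filter_upwards [coeFn_cplxL2 f] with x hx
  rw [hx, Complex.norm_real]

theorem toDist_apply_eq_inner (f : RealL2 d) (ψ : 𝓢(Space d, ℂ)) :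
    toDist f ψ = inner ℂ (cplxL2 f) (ψ.toLp 2 volume) := by
  rw [toDist_apply, MeasureTheory.L2.inner_def]
  refine integral_congr_ae ?_
  filter_upwards [coeFn_cplxL2 f, ψ.coeFn_toLp 2 volume] with x h1 h2
  rw [h1, h2]
  simp [mul_comm]

theorem sobolevENorm_eq {s : ℝ} {f : RealL2 d} {k : CplxL2 d}
    (hk : TemperedDistribution.besselPotential (Space d) ℂ s (toDist f) =
      Lp.toTemperedDistribution k) : sobolevENorm s (toDist f) = ‖k‖ₑ := by
  rw [sobolevENorm, hk, distLpENorm_toTemperedDistribution]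

/-- The gradient of an `H^s` function and its order `s` Bessel potential. -/
structure IsGradient (s : ℝ) (f : RealL2 d) (G : Fin d → RealL2 d) (k : CplxL2 d) : Prop where
  bessel : TemperedDistribution.besselPotential (Space d) ℂ s (toDist f) =
    Lp.toTemperedDistribution k
  grad : ∀ i, ∂_{EuclideanSpace.single i (1 : ℝ)} (toDist f) = toDist (G i)

theorem IsGradient.sub {s : ℝ} {f f' : RealL2 d} {G G' : Fin d → RealL2 d} {k k' : CplxL2 d}
    (h : IsGradient s f G k) (h' : IsGradient s f' G' k') :
    IsGradient s (f - f') (fun i ↦ G i - G' i) (k - k') where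
  bessel := by
    rw [toDist_sub, map_sub, h.bessel, h'.bessel]
    simp only [← Lp.toTemperedDistributionCLM_apply, map_sub]
  grad i := by
    rw [toDist_sub, toDist_sub, ← h.grad, ← h'.grad]
    exact map_sub (LineDeriv.lineDerivOpCLM ℂ 𝓢'(Space d, ℂ)
      (EuclideanSpace.single i (1 : ℝ) : Space d)) _ _

theorem IsGradient.neg_bessel {s : ℝ} {f : RealL2 d} {G : Fin d → RealL2 d} {k : CplxL2 d}
    (h : IsGradient s f G k) :
    TemperedDistribution.besselPotential (Space d) ℂ (-s) (Lp.toTemperedDistribution k) =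
      Lp.toTemperedDistribution (cplxL2 f) :=
  (TemperedDistribution.besselPotential_neg_apply_eq_iff s _ _).2 h.bessel

/-- The operator that recovers a partial derivative from the Bessel potential. -/
def gradOp (s : ℝ) (e : Space d) : 𝓢(Space d, ℂ) →L[ℂ] 𝓢(Space d, ℂ) :=
  LineDeriv.lineDerivOpCLM ℂ 𝓢(Space d, ℂ) e ∘L besselS d (-s)

/-- The distributional version of `gradOp`. -/
def gradOpDist (s : ℝ) (e : Space d) : 𝓢'(Space d, ℂ) →L[ℂ] 𝓢'(Space d, ℂ) :=
  LineDeriv.lineDerivOpCLM ℂ 𝓢'(Space d, ℂ) e ∘L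
    TemperedDistribution.besselPotential (Space d) ℂ (-s)

theorem gradOpDist_schwartz (s : ℝ) (e : Space d) (g : 𝓢(Space d, ℂ)) :
    gradOpDist s e (g : 𝓢'(Space d, ℂ)) = (gradOp s e g : 𝓢'(Space d, ℂ)) := by
  change ∂_{e} (TemperedDistribution.besselPotential (Space d) ℂ (-s) (g : 𝓢'(Space d, ℂ))) = _
  rw [besselPotential_schwartz, TemperedDistribution.lineDerivOp_toTemperedDistributionCLM_eq]
  rfl

theorem IsGradient.gradOpDist_eq {s : ℝ} {f : RealL2 d} {G : Fin d → RealL2 d} {k : CplxL2 d}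
    (h : IsGradient s f G k) (i : Fin d) :
    gradOpDist s (EuclideanSpace.single i (1 : ℝ)) (Lp.toTemperedDistribution k) =
      Lp.toTemperedDistribution (cplxL2 (G i)) := by
  change ∂_{EuclideanSpace.single i (1 : ℝ)}
    (TemperedDistribution.besselPotential (Space d) ℂ (-s) _) = _
  rw [h.neg_bessel]
  exact h.grad i

theorem norm_single_one (i : Fin d) : ‖(EuclideanSpace.single i (1 : ℝ) : Space d)‖ = 1 := by simp

theorem IsGradient.norm_le {s : ℝ} (hs : 1 ≤ s) {f : RealL2 d} {G : Fin d → RealL2 d}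
    {k : CplxL2 d} (h : IsGradient s f G k) (i : Fin d) : ‖G i‖ ≤ 2 * Real.pi * ‖k‖ := by
  rw [← norm_cplxL2]
  exact norm_le_of_bounded (gradOpDist_schwartz s _)
    (fun g ↦ norm_lineDeriv_besselS_toLp_le hs (norm_single_one i) g) (h.gradOpDist_eq i)

theorem IsGradient.norm_fun_le {s : ℝ} (hs : 1 ≤ s) {f : RealL2 d} {G : Fin d → RealL2 d}
    {k : CplxL2 d} (h : IsGradient s f G k) : ‖f‖ ≤ ‖k‖ := by
  rw [← norm_cplxL2, ← one_mul ‖k‖]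
  exact norm_le_of_bounded (besselPotential_schwartz (-s))
    (fun g ↦ norm_besselS_toLp_le (by linarith) g) h.neg_bessel

/-- The Sobolev embedding of `H^{s-1}` into `L^∞`, which needs the full strength of `s > 1 + d/2`;
the other gradient estimates use only `1 ≤ s`. -/
theorem exists_ae_abs_gradient_le {s : ℝ} (hs : 1 + (d : ℝ) / 2 < s) : ∃ C : ℝ, 0 ≤ C ∧
    ∀ {f : RealL2 d} {G : Fin d → RealL2 d} {k : CplxL2 d}, IsGradient s f G k →
      ∀ i, ∀ᵐ x, |G i x| ≤ C * ‖k‖ := by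
  obtain ⟨C, hC0, hC⟩ := exists_norm_lineDeriv_besselS_apply_le hs
  refine ⟨C, hC0, fun h i ↦ ?_⟩
  have hs1 : 1 ≤ s := by
    have : (0 : ℝ) ≤ d := Nat.cast_nonneg d
    linarith
  have h1 := ae_norm_le_of_bounded (gradOpDist_schwartz s _)
    (fun g ↦ norm_lineDeriv_besselS_toLp_le hs1 (norm_single_one i) g)
    (fun g x ↦ hC _ (norm_single_one i) g x) (h.gradOpDist_eq i)
  filter_upwards [h1, coeFn_cplxL2 _] with x hx hx'
  rwa [hx', Complex.norm_real] at hx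

/-- Approximating `k` in `L²` and applying the Bessel potential of order `-s` gives one sequence
that works for the function and its gradient. It serves to put an `H^s` function in place of the
test function. -/
theorem IsGradient.exists_schwartz_tendsto {s : ℝ} (hs : 1 ≤ s) {f : RealL2 d}
    {G : Fin d → RealL2 d} {k : CplxL2 d} (h : IsGradient s f G k) :
    ∃ ψ : ℕ → 𝓢(Space d, ℂ), Tendsto (fun n ↦ (ψ n).toLp 2 volume) atTop (𝓝 (cplxL2 f)) ∧
      ∀ i, Tendsto (fun n ↦ (∂_{EuclideanSpace.single i (1 : ℝ)} (ψ n)).toLp 2 volume) atTop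
        (𝓝 (cplxL2 (G i))) := by
  obtain ⟨κ, hκ⟩ := HamiltonJacobi.exists_schwartz_tendsto k
  refine ⟨fun n ↦ besselS d (-s) (κ n), ?_, fun i ↦ ?_⟩
  · exact tendsto_toLp_of_bounded (besselPotential_schwartz (-s))
      (fun g ↦ norm_besselS_toLp_le (by linarith) g) h.neg_bessel hκ
  · exact tendsto_toLp_of_bounded (gradOpDist_schwartz s _)
      (fun g ↦ norm_lineDeriv_besselS_toLp_le hs (norm_single_one i) g) (h.gradOpDist_eq i) hκ

end Gradient

/-! ### Uniqueness by an energy estimate. -/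

section Uniqueness

variable {d : ℕ}

/-- Continuity in `H^s` becomes continuity of a curve in `L²`, which gives bounds on compact time
intervals. -/
theorem IsGlobalSolution.exists_bessel {s : ℝ} {f : RealL2 d} {u : ℝ → RealL2 d}
    (hu : IsGlobalSolution s f u) : ∃ k : ℝ → CplxL2 d, ContinuousOn k (Set.Ici 0) ∧
      ∀ t, 0 ≤ t → TemperedDistribution.besselPotential (Space d) ℂ s (toDist (u t)) =
        Lp.toTemperedDistribution (k t) := by
  classical
  choose! k hk using hu.memSobolev
  refine ⟨k, fun t ht ↦ ?_, hk⟩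
  have h := hu.continuous t ht
  rw [ContinuousWithinAt, tendsto_iff_edist_tendsto_0]
  refine h.congr' ?_
  filter_upwards [self_mem_nhdsWithin] with τ hτ
  rw [edist_eq_enorm_sub]
  refine sobolevENorm_eq ?_
  rw [toDist_sub, map_sub, hk τ hτ, hk t ht]
  simp only [← Lp.toTemperedDistributionCLM_apply, map_sub]

/-- Only one derivative is moved to the test function, so that the dissipation `-‖∇w‖²` appears when
`ψ` approaches `w`. -/
theorem laplacian_apply_eq_sum_inner {T : 𝓢'(Space d, ℂ)} {G : Fin d → RealL2 d}
    (hG : ∀ i, ∂_{EuclideanSpace.single i (1 : ℝ)} T = toDist (G i)) (ψ : 𝓢(Space d, ℂ)) :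
    (Δ T) ψ = -∑ i, inner ℂ (cplxL2 (G i))
      ((∂_{EuclideanSpace.single i (1 : ℝ)} ψ).toLp 2 volume) := by
  rw [TemperedDistribution.laplacian_eq_sum (EuclideanSpace.basisFun (Fin d) ℝ),
    ← Finset.sum_neg_distrib, sum_apply]
  refine Finset.sum_congr rfl fun i _ ↦ ?_
  rw [EuclideanSpace.basisFun_apply, hG i, TemperedDistribution.lineDerivOp_apply_apply, map_neg,
    toDist_apply_eq_inner]

theorem integrable_sq_mul_schwartz (g : RealL2 d) (ψ : 𝓢(Space d, ℂ)) :
    Integrable fun x ↦ (((g x) ^ 2 : ℝ) : ℂ) * ψ x := by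
  have h1 : Integrable fun x ↦ (((g x) ^ 2 : ℝ) : ℂ) := (Lp.memLp g).integrable_sq.ofReal
  obtain ⟨C, -, hC⟩ := ψ.decay 0 0
  exact h1.mul_bdd (c := C) ψ.continuous.aestronglyMeasurable
    (Eventually.of_forall fun x ↦ by simpa using hC x)

/-- Factor `g² - g'² = (g - g')(g + g')`, bound the second factor by `2B`, and apply Cauchy–Schwarz
to the rest. -/
theorem norm_integral_sq_sub_le {g g' : RealL2 d} {B : ℝ} (hB : 0 ≤ B) (hg : ∀ᵐ x, |g x| ≤ B)
    (hg' : ∀ᵐ x, |g' x| ≤ B) (ψ : 𝓢(Space d, ℂ)) :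
    ‖(∫ x, (((g x) ^ 2 : ℝ) : ℂ) * ψ x) - ∫ x, (((g' x) ^ 2 : ℝ) : ℂ) * ψ x‖ ≤
      2 * B * (‖g - g'‖ * ‖ψ.toLp 2 volume‖) := by
  rw [← integral_sub (integrable_sq_mul_schwartz g ψ) (integrable_sq_mul_schwartz g' ψ)]
  have h := eLpNorm_smul_le_mul_eLpNorm (p := 2) (q := 2) (r := 1)
    (φ := ((g - g' : RealL2 d) : Space d → ℝ)) (f := (ψ : Space d → ℂ))
    ψ.continuous.aestronglyMeasurable (Lp.memLp (g - g')).1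
  rw [eLpNorm_one_eq_lintegral_enorm] at h
  have h1 : ‖∫ x, ((((g x) ^ 2 : ℝ) : ℂ) * ψ x - (((g' x) ^ 2 : ℝ) : ℂ) * ψ x)‖ₑ ≤
      ENNReal.ofReal (2 * B) *
        (eLpNorm ((g - g' : RealL2 d) : Space d → ℝ) 2 volume * eLpNorm ψ 2 volume) := by
    refine (enorm_integral_le_lintegral_enorm _).trans ?_
    refine le_trans ?_ (mul_le_mul_right h _)
    rw [← lintegral_const_mul' _ _ ENNReal.ofReal_ne_top]
    refine lintegral_mono_ae ?_
    filter_upwards [hg, hg', Lp.coeFn_sub g g'] with x h1 h2 h3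
    rw [Pi.smul_apply', h3, Pi.sub_apply, enorm_smul, ← ofReal_norm, ← ofReal_norm, ← ofReal_norm,
      ← ENNReal.ofReal_mul (norm_nonneg _), ← ENNReal.ofReal_mul (by positivity)]
    refine ENNReal.ofReal_le_ofReal ?_
    rw [← sub_mul, norm_mul, ← mul_assoc, ← Complex.ofReal_sub, Complex.norm_real]
    gcongr
    rw [sq_sub_sq, norm_mul]
    gcongr
    exact (abs_add_le _ _).trans (by linarith)
  have h2 := ENNReal.toReal_mono (ENNReal.mul_ne_top ENNReal.ofReal_ne_top
    (ENNReal.mul_ne_top (Lp.memLp (g - g')).eLpNorm_ne_top (ψ.memLp 2 volume).eLpNorm_ne_top)) h1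
  rw [toReal_enorm, ENNReal.toReal_mul, ENNReal.toReal_mul, ENNReal.toReal_ofReal (by positivity),
    ← SchwartzMap.norm_toLp, ← Lp.norm_def] at h2
  exact h2

/-- The differential inequality satisfied by the difference of two solutions, tested on a fixed
Schwartz function. -/
theorem exists_hasDerivAt_sub {u v : ℝ → RealL2 d} {t : ℝ} {g g' : Fin d → RealL2 d}
    (hg : ∀ i, ∂_{EuclideanSpace.single i (1 : ℝ)} (toDist (u t)) = toDist (g i))
    (hg' : ∀ i, ∂_{EuclideanSpace.single i (1 : ℝ)} (toDist (v t)) = toDist (g' i))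
    {B : ℝ} (hB : 0 ≤ B) (hgB : ∀ i, ∀ᵐ x, |g i x| ≤ B) (hgB' : ∀ i, ∀ᵐ x, |g' i x| ≤ B)
    (ψ : 𝓢(Space d, ℂ))
    (hu : HasDerivAt (fun τ ↦ toDist (u τ) ψ)
        ((Δ (toDist (u t))) ψ + ∫ x, ((∑ i, (g i x) ^ 2 : ℝ) : ℂ) * ψ x) t)
    (hv : HasDerivAt (fun τ ↦ toDist (v τ) ψ)
        ((Δ (toDist (v t))) ψ + ∫ x, ((∑ i, (g' i x) ^ 2 : ℝ) : ℂ) * ψ x) t) :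
    ∃ D : ℝ, HasDerivAt (fun τ ↦ (inner ℂ (cplxL2 (u τ - v τ)) (ψ.toLp 2 volume)).re) D t ∧
      D ≤ ∑ i, (-(inner ℂ (cplxL2 (g i - g' i))
          ((∂_{EuclideanSpace.single i (1 : ℝ)} ψ).toLp 2 volume)).re +
        2 * B * (‖g i - g' i‖ * ‖ψ.toLp 2 volume‖)) := by
  have h1 := hu.sub hv
  have h2 : ∀ τ, inner ℂ (cplxL2 (u τ - v τ)) (ψ.toLp 2 volume) =
      toDist (u τ) ψ - toDist (v τ) ψ := by
    intro τ
    rw [← toDist_apply_eq_inner, toDist_sub]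
    rfl
  simp_rw [h2]
  have h3 := Complex.reCLM.hasFDerivAt.comp_hasDerivAt t h1
  refine ⟨_, h3, ?_⟩
  have hsum : ∀ g : Fin d → RealL2 d, ∫ x, ((∑ i, (g i x) ^ 2 : ℝ) : ℂ) * ψ x =
      ∑ i, ∫ x, (((g i x) ^ 2 : ℝ) : ℂ) * ψ x := by
    intro g
    rw [← integral_finsetSum _ fun i _ ↦ integrable_sq_mul_schwartz (g i) ψ]
    refine integral_congr_ae (Eventually.of_forall fun x ↦ ?_)
    simp only [Complex.ofReal_sum, Finset.sum_mul]
  rw [hsum, hsum, laplacian_apply_eq_sum_inner hg, laplacian_apply_eq_sum_inner hg']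
  have h4 : ∀ i, inner ℂ (cplxL2 (g i - g' i))
      ((∂_{EuclideanSpace.single i (1 : ℝ)} ψ).toLp 2 volume) =
      inner ℂ (cplxL2 (g i)) ((∂_{EuclideanSpace.single i (1 : ℝ)} ψ).toLp 2 volume) -
      inner ℂ (cplxL2 (g' i)) ((∂_{EuclideanSpace.single i (1 : ℝ)} ψ).toLp 2 volume) := by
    intro i
    rw [cplxL2_sub, inner_sub_left]
  simp only [Complex.reCLM_apply, Complex.sub_re, Complex.add_re, Complex.neg_re, Complex.re_sum]
  rw [Finset.sum_add_distrib, Finset.sum_neg_distrib]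
  simp_rw [h4, Complex.sub_re]
  rw [Finset.sum_sub_distrib]
  have h5 : ∑ i, (∫ x, (((g i x) ^ 2 : ℝ) : ℂ) * ψ x).re -
      ∑ i, (∫ x, (((g' i x) ^ 2 : ℝ) : ℂ) * ψ x).re ≤
      ∑ i, 2 * B * (‖g i - g' i‖ * ‖ψ.toLp 2 volume‖) := by
    rw [← Finset.sum_sub_distrib]
    refine Finset.sum_le_sum fun i _ ↦ ?_
    rw [← Complex.sub_re]
    exact (Complex.re_le_norm _).trans (norm_integral_sq_sub_le hB (hgB i) (hgB' i) ψ)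
  linarith

theorem IsGradient.add {s : ℝ} {f f' : RealL2 d} {G G' : Fin d → RealL2 d} {k k' : CplxL2 d}
    (h : IsGradient s f G k) (h' : IsGradient s f' G' k') :
    IsGradient s (f + f') (fun i ↦ G i + G' i) (k + k') := by
  have h0 : IsGradient s (0 : RealL2 d) (fun _ ↦ 0) 0 := by
    have := h.sub h
    simpa using this
  have := h.sub (h0.sub h')
  simpa using this

/-- The equation can be tested only on a fixed Schwartz function, not on the solution. The mean
value theorem on `[t, z]` is used for fixed `ψ`, with the gradient at the intermediate time replaced
by that at `t` at the price of `η`. Then `ψ` tends to `w z + w t` together with its gradient, and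
the left side becomes `Re ⟨w z - w t, w z + w t⟩ = ‖w z‖² - ‖w t‖²`. -/
theorem re_inner_sub_le_of_deriv_le {s : ℝ} (hs : 1 ≤ s) {w : ℝ → RealL2 d}
    {p : ℝ → Fin d → RealL2 d} {k : ℝ → CplxL2 d} {T B : ℝ} (hB : 0 ≤ B)
    (hgrad : ∀ τ, 0 < τ → IsGradient s (w τ) (p τ) (k τ))
    (hder : ∀ τ, 0 < τ → τ ≤ T → ∀ ψ : 𝓢(Space d, ℂ), ∃ D : ℝ,
      HasDerivAt (fun τ ↦ (inner ℂ (cplxL2 (w τ)) (ψ.toLp 2 volume)).re) D τ ∧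
      D ≤ ∑ i, (-(inner ℂ (cplxL2 (p τ i))
          ((∂_{EuclideanSpace.single i (1 : ℝ)} ψ).toLp 2 volume)).re +
        B * (‖p τ i‖ * ‖ψ.toLp 2 volume‖)))
    {t z η : ℝ} (ht : 0 < t) (htz : t < z) (hz : z ≤ T)
    (hη : ∀ τ ∈ Set.Icc t z, ∀ i, ‖p τ i - p t i‖ ≤ η) :
    ‖w z‖ ^ 2 - ‖w t‖ ^ 2 ≤ (z - t) * ∑ i, (-(inner ℂ (cplxL2 (p t i))
      (cplxL2 (p z i + p t i))).re + η * ‖cplxL2 (p z i + p t i)‖ +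
        B * ((‖p t i‖ + η) * ‖cplxL2 (w z + w t)‖)) := by
  have step : ∀ ψ : 𝓢(Space d, ℂ), (inner ℂ (cplxL2 (w z)) (ψ.toLp 2 volume)).re -
      (inner ℂ (cplxL2 (w t)) (ψ.toLp 2 volume)).re ≤ (z - t) * ∑ i, (-(inner ℂ (cplxL2 (p t i))
        ((∂_{EuclideanSpace.single i (1 : ℝ)} ψ).toLp 2 volume)).re +
        η * ‖(∂_{EuclideanSpace.single i (1 : ℝ)} ψ).toLp 2 volume‖ +
        B * ((‖p t i‖ + η) * ‖ψ.toLp 2 volume‖)) := by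
    intro ψ
    choose! D hD hD' using fun τ (h1 : 0 < τ) (h2 : τ ≤ T) ↦ hder τ h1 h2 ψ
    obtain ⟨τ, hτ, hτ'⟩ := exists_hasDerivAt_eq_slope
      (fun τ ↦ (inner ℂ (cplxL2 (w τ)) (ψ.toLp 2 volume)).re) D htz
      (fun τ hτ ↦ (hD τ (ht.trans_le hτ.1) (hτ.2.trans hz)).continuousAt.continuousWithinAt)
      (fun τ hτ ↦ hD τ (ht.trans hτ.1) (hτ.2.le.trans hz))
    have hpos : 0 < z - t := sub_pos.2 htz
    rw [eq_div_iff hpos.ne'] at hτ'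
    rw [← hτ', mul_comm]
    refine mul_le_mul_of_nonneg_left ((hD' τ (ht.trans hτ.1) (hτ.2.le.trans hz)).trans ?_) hpos.le
    refine Finset.sum_le_sum fun i _ ↦ ?_
    have h1 := hη τ ⟨hτ.1.le, hτ.2.le⟩ i
    have h2 : ‖p τ i‖ ≤ ‖p t i‖ + η := by
      have := norm_sub_norm_le (p τ i) (p t i)
      linarith
    have h3 : -(inner ℂ (cplxL2 (p τ i))
          ((∂_{EuclideanSpace.single i (1 : ℝ)} ψ).toLp 2 volume)).re ≤
        -(inner ℂ (cplxL2 (p t i))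
          ((∂_{EuclideanSpace.single i (1 : ℝ)} ψ).toLp 2 volume)).re +
        η * ‖(∂_{EuclideanSpace.single i (1 : ℝ)} ψ).toLp 2 volume‖ := by
      have h4 := norm_inner_le_norm (𝕜 := ℂ) (cplxL2 (p τ i - p t i))
        ((∂_{EuclideanSpace.single i (1 : ℝ)} ψ).toLp 2 volume)
      have h5 := (abs_le.1 ((Complex.abs_re_le_norm _).trans h4)).1
      rw [norm_cplxL2] at h5
      rw [cplxL2_sub, inner_sub_left, Complex.sub_re] at h5
      have h6 := mul_le_mul_of_nonneg_right h1
        (norm_nonneg ((∂_{EuclideanSpace.single i (1 : ℝ)} ψ).toLp 2 (volume : Measure (Space d))))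
      linarith
    have h7 : B * (‖p τ i‖ * ‖ψ.toLp 2 volume‖) ≤ B * ((‖p t i‖ + η) * ‖ψ.toLp 2 volume‖) := by
      gcongr
    linarith
  obtain ⟨ψ, h1, h2⟩ := ((hgrad z (ht.trans htz)).add (hgrad t ht)).exists_schwartz_tendsto hs
  have hre : ∀ (a : CplxL2 d) {x : ℕ → CplxL2 d} {y : CplxL2 d}, Tendsto x atTop (𝓝 y) →
      Tendsto (fun n ↦ (inner ℂ a (x n)).re) atTop (𝓝 (inner ℂ a y).re) := by
    intro a x y hx
    exact (Complex.continuous_re.tendsto _).comp (tendsto_const_nhds.inner hx)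
  have h3 := le_of_tendsto_of_tendsto' ((hre (cplxL2 (w z)) h1).sub (hre (cplxL2 (w t)) h1))
    ((tendsto_finsetSum Finset.univ fun i _ ↦ (((hre (cplxL2 (p t i)) (h2 i)).neg.add
      ((h2 i).norm.const_mul η)).add ((h1.norm.const_mul (‖p t i‖ + η)).const_mul B))).const_mul
        (z - t)) (fun n ↦ step (ψ n))
  refine le_trans (le_of_eq ?_) h3
  rw [← Complex.sub_re, ← inner_sub_left, cplxL2_add, ← norm_cplxL2 (w z), ← norm_cplxL2 (w t),
    inner_sub_left, inner_add_right, inner_add_right, Complex.sub_re, Complex.add_re,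
    Complex.add_re, ← inner_conj_symm (cplxL2 (w z)) (cplxL2 (w t)), Complex.conj_re]
  have h4 : ∀ a : CplxL2 d, (inner ℂ a a).re = ‖a‖ ^ 2 := fun a ↦
    (norm_sq_eq_re_inner (𝕜 := ℂ) a).symm
  rw [h4, h4]
  ring

/-- As `z ↓ t` and `η → 0` the bound for the slope tends to `∑ (-2 ‖p_i‖² + 2 B ‖p_i‖ ‖w‖)`, and
completing the square absorbs the gradients. A right upper derivative is enough for Grönwall's
inequality. -/
theorem eventually_slope_lt {s : ℝ} (hs : 1 ≤ s) {w : ℝ → RealL2 d}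
    {p : ℝ → Fin d → RealL2 d} {k : ℝ → CplxL2 d} {T B : ℝ} (hB : 0 ≤ B)
    (hk : ContinuousOn k (Set.Ici 0))
    (hgrad : ∀ τ, 0 < τ → IsGradient s (w τ) (p τ) (k τ))
    (hder : ∀ τ, 0 < τ → τ ≤ T → ∀ ψ : 𝓢(Space d, ℂ), ∃ D : ℝ,
      HasDerivAt (fun τ ↦ (inner ℂ (cplxL2 (w τ)) (ψ.toLp 2 volume)).re) D τ ∧
      D ≤ ∑ i, (-(inner ℂ (cplxL2 (p τ i))
          ((∂_{EuclideanSpace.single i (1 : ℝ)} ψ).toLp 2 volume)).re +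
        B * (‖p τ i‖ * ‖ψ.toLp 2 volume‖)))
    {t : ℝ} (ht : 0 < t) (htT : t < T) {r : ℝ} (hr : d * B ^ 2 * ‖w t‖ ^ 2 < r) :
    ∀ᶠ z in 𝓝[>] t, (z - t)⁻¹ * (‖w z‖ ^ 2 - ‖w t‖ ^ 2) < r := by
  have hkt : ContinuousAt k t := hk.continuousAt (Ici_mem_nhds ht)
  have hk0 : Tendsto (fun τ ↦ ‖k τ - k t‖) (𝓝 t) (𝓝 0) := by
    simpa using (hkt.tendsto.sub_const (k t)).norm
  have hw : Tendsto w (𝓝 t) (𝓝 (w t)) := by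
    rw [tendsto_iff_norm_sub_tendsto_zero]
    refine squeeze_zero' (Eventually.of_forall fun _ ↦ norm_nonneg _) ?_ hk0
    filter_upwards [Ioi_mem_nhds ht] with τ hτ
    exact ((hgrad τ hτ).sub (hgrad t ht)).norm_fun_le hs
  have hp : ∀ i, Tendsto (fun τ ↦ p τ i) (𝓝 t) (𝓝 (p t i)) := by
    intro i
    rw [tendsto_iff_norm_sub_tendsto_zero]
    refine squeeze_zero' (Eventually.of_forall fun _ ↦ norm_nonneg _) ?_
      (by simpa using hk0.const_mul (2 * Real.pi))
    filter_upwards [Ioi_mem_nhds ht] with τ hτ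
    exact ((hgrad τ hτ).sub (hgrad t ht)).norm_le hs i
  have hcplx : Continuous (cplxL2 : RealL2 d → CplxL2 d) :=
    (Complex.ofRealCLM.compLpL 2 (volume : Measure (Space d))).continuous
  set R : ℝ → ℝ → ℝ := fun η z ↦ ∑ i, (-(inner ℂ (cplxL2 (p t i))
      (cplxL2 (p z i + p t i))).re + η * ‖cplxL2 (p z i + p t i)‖ +
        B * ((‖p t i‖ + η) * ‖cplxL2 (w z + w t)‖)) with hR
  have hR0 : R 0 t < r := by
    refine lt_of_le_of_lt ?_ hr
    have : ∀ i : Fin d, (-(inner ℂ (cplxL2 (p t i))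
      (cplxL2 (p t i + p t i))).re + 0 * ‖cplxL2 (p t i + p t i)‖ +
        B * ((‖p t i‖ + 0) * ‖cplxL2 (w t + w t)‖)) ≤ B ^ 2 * ‖w t‖ ^ 2 := by
      intro i
      rw [cplxL2_add, inner_add_right, Complex.add_re, ← two_smul ℝ (w t), norm_cplxL2, norm_smul]
      have h4 : (inner ℂ (cplxL2 (p t i)) (cplxL2 (p t i))).re = ‖p t i‖ ^ 2 := by
        rw [← norm_cplxL2 (p t i)]
        exact (norm_sq_eq_re_inner (𝕜 := ℂ) _).symm
      rw [h4]
      simp only [Real.norm_ofNat]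
      nlinarith [sq_nonneg (2 * ‖p t i‖ - B * ‖w t‖), sq_nonneg (B * ‖w t‖)]
    calc R 0 t ≤ ∑ _i : Fin d, B ^ 2 * ‖w t‖ ^ 2 := Finset.sum_le_sum fun i _ ↦ this i
      _ = _ := by simp [mul_assoc]
  -- The inequality is strict at `η = 0`, so continuity in `η` leaves room for a positive value.
  obtain ⟨η, hη0, hη⟩ : ∃ η > 0, R η t < r := by
    have hc : Continuous fun η ↦ R η t := by
      simp only [hR]
      fun_prop
    have h1 := (hc.tendsto 0).eventually (gt_mem_nhds hR0)
    have h2 : ∀ᶠ η in 𝓝[>] (0 : ℝ), R η t < r := h1.filter_mono nhdsWithin_le_nhds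
    obtain ⟨η, h3, h4⟩ := (h2.and self_mem_nhdsWithin).exists
    exact ⟨η, h4, h3⟩
  have hRz : Tendsto (fun z ↦ R η z) (𝓝 t) (𝓝 (R η t)) := by
    have hpz : ∀ i, Tendsto (fun z ↦ cplxL2 (p z i + p t i)) (𝓝 t)
        (𝓝 (cplxL2 (p t i + p t i))) := fun i ↦
      (hcplx.tendsto _).comp ((hp i).add_const _)
    have hwz : Tendsto (fun z ↦ cplxL2 (w z + w t)) (𝓝 t) (𝓝 (cplxL2 (w t + w t))) :=
      (hcplx.tendsto _).comp (hw.add_const _)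
    refine tendsto_finsetSum _ fun i _ ↦ ?_
    exact (((Complex.continuous_re.tendsto _).comp
      (tendsto_const_nhds.inner (hpz i))).neg.add ((hpz i).norm.const_mul η)).add
      ((hwz.norm.const_mul _).const_mul B)
  have hev : ∀ᶠ τ in 𝓝 t, ∀ i, ‖p τ i - p t i‖ ≤ η := by
    rw [eventually_all]
    intro i
    have := (tendsto_iff_norm_sub_tendsto_zero.1 (hp i)).eventually (gt_mem_nhds hη0)
    exact this.mono fun _ h ↦ h.le
  obtain ⟨δ, hδ, hball⟩ := Metric.eventually_nhds_iff.1 hev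
  have e1 : ∀ᶠ z in 𝓝[>] t, R η z < r :=
    (hRz.eventually (gt_mem_nhds hη)).filter_mono nhdsWithin_le_nhds
  have e2 : ∀ᶠ z in 𝓝[>] t, z < t + δ :=
    (gt_mem_nhds (by linarith : t < t + δ)).filter_mono nhdsWithin_le_nhds
  have e3 : ∀ᶠ z in 𝓝[>] t, z < T := (gt_mem_nhds htT).filter_mono nhdsWithin_le_nhds
  filter_upwards [e1, e2, e3, self_mem_nhdsWithin] with z h1 h2 h3 h4
  have hzt : t < z := h4
  have h5 := re_inner_sub_le_of_deriv_le hs hB hgrad hder ht hzt h3.le (η := η)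
    fun τ hτ ↦ hball (by
      rw [Real.dist_eq, abs_of_nonneg (by linarith [hτ.1])]
      linarith [hτ.2])
  have hpos : 0 < z - t := sub_pos.2 hzt
  rw [inv_mul_lt_iff₀ hpos]
  exact h5.trans_lt (mul_lt_mul_of_pos_left h1 hpos)

/-- The equation holds only for positive times, so Grönwall's inequality is applied on `[a, T]` with
`a > 0`. Then `a → 0`, where the difference tends to zero because both curves are continuous in
`H^s` and start at the same data. -/
theorem IsGlobalSolution.unique {s : ℝ} (hs : 1 + (d : ℝ) / 2 < s) {f : RealL2 d}
    {u v : ℝ → RealL2 d} (hu : IsGlobalSolution s f u) (hv : IsGlobalSolution s f v) {T : ℝ}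
    (hT : 0 ≤ T) : u T = v T := by
  rcases hT.eq_or_lt with rfl | hT
  · rw [hu.initial, hv.initial]
  have hs1 : 1 ≤ s := by
    have : (0 : ℝ) ≤ d := Nat.cast_nonneg d
    linarith
  obtain ⟨k, hkc, hk⟩ := hu.exists_bessel
  obtain ⟨k', hkc', hk'⟩ := hv.exists_bessel
  choose! g hg heq using hu.equation
  choose! g' hg' heq' using hv.equation
  obtain ⟨C, hC0, hC⟩ := exists_ae_abs_gradient_le hs
  obtain ⟨M, hM⟩ := isCompact_Icc.exists_bound_of_continuousOn
    (hkc.mono (Set.Icc_subset_Ici_self : Set.Icc (0 : ℝ) T ⊆ _))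
  obtain ⟨M', hM'⟩ := isCompact_Icc.exists_bound_of_continuousOn
    (hkc'.mono (Set.Icc_subset_Ici_self : Set.Icc (0 : ℝ) T ⊆ _))
  have hM0 : 0 ≤ M := (norm_nonneg _).trans (hM 0 ⟨le_rfl, hT.le⟩)
  set B : ℝ := C * max M M' with hBdef
  have hB : 0 ≤ B := mul_nonneg hC0 (hM0.trans (le_max_left _ _))
  have hG : ∀ τ, 0 < τ → IsGradient s (u τ) (g τ) (k τ) := fun τ hτ ↦ ⟨hk τ hτ.le, hg τ hτ⟩
  have hG' : ∀ τ, 0 < τ → IsGradient s (v τ) (g' τ) (k' τ) := fun τ hτ ↦ ⟨hk' τ hτ.le, hg' τ hτ⟩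
  have hder : ∀ τ, 0 < τ → τ ≤ T → ∀ ψ : 𝓢(Space d, ℂ), ∃ D : ℝ,
      HasDerivAt (fun τ ↦ (inner ℂ (cplxL2 (u τ - v τ)) (ψ.toLp 2 volume)).re) D τ ∧
      D ≤ ∑ i, (-(inner ℂ (cplxL2 (g τ i - g' τ i))
          ((∂_{EuclideanSpace.single i (1 : ℝ)} ψ).toLp 2 volume)).re +
        2 * B * (‖g τ i - g' τ i‖ * ‖ψ.toLp 2 volume‖)) := by
    intro τ h0 h1 ψ
    refine exists_hasDerivAt_sub (hg τ h0) (hg' τ h0) hB (fun i ↦ ?_) (fun i ↦ ?_) ψ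
      (heq τ h0 ψ) (heq' τ h0 ψ)
    · filter_upwards [hC (hG τ h0) i] with x hx
      exact hx.trans (mul_le_mul_of_nonneg_left ((hM τ ⟨h0.le, h1⟩).trans (le_max_left _ _)) hC0)
    · filter_upwards [hC (hG' τ h0) i] with x hx
      exact hx.trans (mul_le_mul_of_nonneg_left ((hM' τ ⟨h0.le, h1⟩).trans (le_max_right _ _)) hC0)
  have hgrad : ∀ τ, 0 < τ → IsGradient s (u τ - v τ) (fun i ↦ g τ i - g' τ i) (k τ - k' τ) :=
    fun τ hτ ↦ (hG τ hτ).sub (hG' τ hτ)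
  have hkk : ContinuousOn (fun τ ↦ k τ - k' τ) (Set.Ici 0) := hkc.sub hkc'
  set K : ℝ := d * (2 * B) ^ 2 with hK
  have hwc : ContinuousOn (fun τ ↦ u τ - v τ) (Set.Ioi 0) := by
    intro t ht
    have hkt : ContinuousAt (fun τ ↦ k τ - k' τ) t := hkk.continuousAt (Ici_mem_nhds ht)
    refine ContinuousAt.continuousWithinAt ?_
    rw [ContinuousAt, tendsto_iff_norm_sub_tendsto_zero]
    have hk0 : Tendsto (fun τ ↦ ‖(k τ - k' τ) - (k t - k' t)‖) (𝓝 t) (𝓝 0) := by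
      simpa using (hkt.tendsto.sub_const (k t - k' t)).norm
    refine squeeze_zero' (Eventually.of_forall fun _ ↦ norm_nonneg _) ?_ hk0
    filter_upwards [Ioi_mem_nhds ht] with τ hτ
    exact ((hgrad τ hτ).sub (hgrad t ht)).norm_fun_le hs1
  have hmain : ∀ a, 0 < a → a < T →
      ‖u T - v T‖ ^ 2 ≤ ‖u a - v a‖ ^ 2 * Real.exp (K * (T - a)) := by
    intro a ha haT
    have h := le_gronwallBound_of_liminf_deriv_right_le (f := fun τ ↦ ‖u τ - v τ‖ ^ 2)
      (f' := fun τ ↦ K * ‖u τ - v τ‖ ^ 2) (δ := ‖u a - v a‖ ^ 2) (K := K) (ε := 0) (a := a) (b := T)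
      ((hwc.mono fun x hx ↦ ha.trans_le hx.1).norm.pow 2)
      (fun x hx r hr ↦ (eventually_slope_lt hs1 (by positivity) hkk hgrad hder
        (ha.trans_le hx.1) hx.2 hr).frequently) le_rfl (fun x _ ↦ by simp) T ⟨haT.le, le_rfl⟩
    simpa [gronwallBound_ε0] using h
  have hk00 : k 0 = k' 0 := by
    apply toTemperedDistribution_injective 2
    simp only
    rw [← hk 0 le_rfl, ← hk' 0 le_rfl, hu.initial, hv.initial]
  have hlim : Tendsto (fun a ↦ ‖k a - k' a‖ ^ 2 * Real.exp (K * (T - a))) (𝓝[>] 0) (𝓝 0) := by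
    have h1 : Tendsto (fun a ↦ ‖k a - k' a‖) (𝓝[>] 0) (𝓝 0) := by
      have := (hkk 0 Set.self_mem_Ici).norm.tendsto.mono_left
        (nhdsWithin_mono 0 Set.Ioi_subset_Ici_self)
      simpa [hk00] using this
    have h2 : Tendsto (fun a ↦ Real.exp (K * (T - a))) (𝓝[>] 0) (𝓝 (Real.exp (K * (T - 0)))) := by
      refine Tendsto.mono_left ?_ nhdsWithin_le_nhds
      exact Continuous.tendsto (by fun_prop) _
    simpa using (h1.pow 2).mul h2
  have hle : ‖u T - v T‖ ^ 2 ≤ 0 := by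
    refine ge_of_tendsto hlim ?_
    have e3 : ∀ᶠ z in 𝓝[>] (0 : ℝ), z < T := (gt_mem_nhds hT).filter_mono nhdsWithin_le_nhds
    filter_upwards [e3, self_mem_nhdsWithin] with a h1 h2
    refine (hmain a h2 h1).trans ?_
    gcongr
    exact (hgrad a h2).norm_fun_le hs1
  have h0 : ‖u T - v T‖ = 0 := by
    have := sq_nonneg ‖u T - v T‖
    exact pow_eq_zero_iff (two_ne_zero) |>.1 (le_antisymm hle this)
  exact sub_eq_zero.1 (norm_eq_zero.1 h0)

end Uniqueness

/-! ### Bounded families of Schwartz functions: composition and the heat semigroup. -/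

section BoundedFamilies

variable {d : ℕ} {ι : Type*} {V W : Type*} [NormedAddCommGroup V] [NormedSpace ℝ V]
  [NormedAddCommGroup W] [NormedSpace ℝ W]

/-- A family of Schwartz functions that is bounded in the Schwartz space. -/
def SchwartzBounded (F : ι → 𝓢(Space d, V)) : Prop :=
  ∀ k n : ℕ, ∃ C : ℝ, ∀ i x, (1 + ‖x‖) ^ k * ‖iteratedFDeriv ℝ n (F i) x‖ ≤ C

/-- Through this topological description, continuous linear maps such as derivatives and Fourier
transforms preserve bounded families. -/
theorem schwartzBounded_iff {F : ι → 𝓢(Space d, V)} :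
    SchwartzBounded F ↔ Bornology.IsVonNBounded ℝ (Set.range F) := by
  constructor
  · intro h
    rw [(schwartz_withSeminorms ℝ (Space d) V).isVonNBounded_iff_seminorm_bounded]
    rintro ⟨k, n⟩
    obtain ⟨C, hC⟩ := h k n
    refine ⟨|C| + 1, by positivity, ?_⟩
    rintro _ ⟨i, rfl⟩
    refine lt_of_le_of_lt (SchwartzMap.seminorm_le_bound ℝ k n (F i) (abs_nonneg C) fun x ↦ ?_)
      (by linarith)
    refine le_trans ?_ ((hC i x).trans (le_abs_self C))
    gcongr
    linarith
  · intro h k n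
    rw [(schwartz_withSeminorms ℝ (Space d) V).isVonNBounded_iff_finset_seminorm_bounded] at h
    obtain ⟨r, -, hr⟩ := h (Finset.Iic (k, n))
    refine ⟨2 ^ k * r, fun i x ↦ ?_⟩
    refine (SchwartzMap.one_add_le_sup_seminorm_apply (𝕜 := ℝ) (m := (k, n)) le_rfl le_rfl
      (F i) x).trans ?_
    exact mul_le_mul_of_nonneg_left (hr (F i) ⟨i, rfl⟩).le (by positivity)

theorem SchwartzBounded.map {F : ι → 𝓢(Space d, V)} (hF : SchwartzBounded F)
    (T : 𝓢(Space d, V) →L[ℝ] 𝓢(Space d, W)) : SchwartzBounded fun i ↦ T (F i) := by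
  rw [schwartzBounded_iff] at hF ⊢
  have := hF.image T
  rwa [← Set.range_comp] at this

theorem SchwartzBounded.const (f : 𝓢(Space d, V)) : SchwartzBounded fun _ : ι ↦ f := by
  rw [schwartzBounded_iff]
  exact (Bornology.isVonNBounded_singleton f).subset (by rintro _ ⟨i, rfl⟩; rfl)

theorem SchwartzBounded.comp {κ : Type*} {F : ι → 𝓢(Space d, V)} (hF : SchwartzBounded F)
    (e : κ → ι) : SchwartzBounded fun i ↦ F (e i) := fun k n ↦ by
  obtain ⟨C, hC⟩ := hF k n
  exact ⟨C, fun i x ↦ hC (e i) x⟩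

/-- Composition of a bounded family of Schwartz functions with a smooth function vanishing at the
origin. -/
theorem exists_comp_schwartz {F : ι → 𝓢(Space d, ℝ)} (hF : SchwartzBounded F) {G : ℝ → ℝ}
    {U : Set ℝ} (hU : IsOpen U) (hG : ContDiffOn ℝ ∞ G U) (hG0 : G 0 = 0) {a b : ℝ}
    (hab : Set.Icc a b ⊆ U) (h0 : (0 : ℝ) ∈ Set.Icc a b) (hFab : ∀ i x, F i x ∈ Set.Icc a b) :
    ∃ H : ι → 𝓢(Space d, ℝ), (∀ i x, H i x = G (F i x)) ∧ SchwartzBounded H := by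
  have hsmooth : ∀ i, ContDiff ℝ ∞ fun x ↦ G (F i x) := by
    intro i
    rw [← contDiffOn_univ]
    exact hG.comp (F i).smooth'.contDiffOn fun x _ ↦ hab (hFab i x)
  have hbound : ∀ k n : ℕ, ∃ C : ℝ, ∀ i x,
      (1 + ‖x‖) ^ k * ‖iteratedFDeriv ℝ n (fun x ↦ G (F i x)) x‖ ≤ C := by
    intro k n
    have hder : ∀ j : ℕ, ∃ C, ∀ z ∈ Set.Icc a b, ‖iteratedFDerivWithin ℝ j G U z‖ ≤ C := by
      intro j
      refine isCompact_Icc.exists_bound_of_continuousOn ?_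
      exact (hG.continuousOn_iteratedFDerivWithin (by exact_mod_cast le_top)
        hU.uniqueDiffOn).mono hab
    choose Cg hCg using hder
    -- For `n = 0` there is no derivative of `F i` to provide decay; it comes from `G 0 = 0` and the
    -- mean value inequality.
    rcases Nat.eq_zero_or_pos n with rfl | hn
    · obtain ⟨C, hC⟩ := hF k 0
      refine ⟨Cg 1 * C, fun i x ↦ ?_⟩
      have hdiff : ∀ z ∈ Set.Icc a b, HasDerivWithinAt G (deriv G z) (Set.Icc a b) z := fun z hz ↦
        ((hG.contDiffAt (hU.mem_nhds (hab hz))).differentiableAt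
          (by simp)).hasDerivAt.hasDerivWithinAt
      have hCd : ∀ z ∈ Set.Icc a b, ‖deriv G z‖ ≤ Cg 1 := by
        intro z hz
        have h1 := hCg 1 z hz
        rw [iteratedFDerivWithin_of_isOpen 1 hU (hab hz), norm_iteratedFDeriv_eq_norm_iteratedDeriv,
          iteratedDeriv_one] at h1
        exact h1
      have h1 := (convex_Icc a b).norm_image_sub_le_of_norm_hasDerivWithin_le hdiff hCd h0
        (hFab i x)
      rw [hG0, sub_zero, sub_zero] at h1
      have h2 := hC i x
      rw [norm_iteratedFDeriv_zero] at h2 ⊢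
      have hC1 : 0 ≤ Cg 1 := (norm_nonneg _).trans (hCg 1 0 h0)
      calc (1 + ‖x‖) ^ k * ‖G (F i x)‖ ≤ (1 + ‖x‖) ^ k * (Cg 1 * ‖F i x‖) := by gcongr
        _ = Cg 1 * ((1 + ‖x‖) ^ k * ‖F i x‖) := by ring
        _ ≤ Cg 1 * C := by gcongr
    -- For `n ≥ 1` the chain rule bound asks for `‖D^j F‖ ≤ D^j` with a single `D` and yields `D^n`.
    -- The weight `k * n` allows `D = M (1 + ‖x‖)^{-k}`, with `M ≥ 1`, so that `D^n` contains the
    -- decay `(1 + ‖x‖)^{-kn}`.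
    · choose CF hCF using fun j : ℕ ↦ hF (k * n) j
      set M : ℝ := 1 + ∑ j ∈ Finset.range (n + 1), |CF j| with hM
      have hM1 : 1 ≤ M := by
        have : 0 ≤ ∑ j ∈ Finset.range (n + 1), |CF j| := Finset.sum_nonneg fun _ _ ↦ abs_nonneg _
        linarith
      have hMF : ∀ j ≤ n, CF j ≤ M := by
        intro j hj
        have := Finset.single_le_sum (f := fun j ↦ |CF j|) (fun _ _ ↦ abs_nonneg _)
          (Finset.mem_range.2 (Nat.lt_succ_of_le hj))
        have h3 := le_abs_self (CF j)
        linarith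
      set K : ℝ := ∑ j ∈ Finset.range (n + 1), |Cg j| with hK
      have hKG : ∀ j ≤ n, Cg j ≤ K := by
        intro j hj
        have := Finset.single_le_sum (f := fun j ↦ |Cg j|) (fun _ _ ↦ abs_nonneg _)
          (Finset.mem_range.2 (Nat.lt_succ_of_le hj))
        have h3 := le_abs_self (Cg j)
        linarith
      have hK0 : 0 ≤ K := Finset.sum_nonneg fun _ _ ↦ abs_nonneg _
      refine ⟨n.factorial * K * M ^ n, fun i x ↦ ?_⟩
      have hx : (0 : ℝ) < 1 + ‖x‖ := by positivity
      have hx1 : (1 : ℝ) ≤ 1 + ‖x‖ := by linarith [norm_nonneg x]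
      have h := norm_iteratedFDerivWithin_comp_le (𝕜 := ℝ) (g := G) (f := F i) (n := n)
        (s := Set.univ) (t := U) (x := x) (N := ∞) hG (F i).smooth'.contDiffOn
        (by exact_mod_cast le_top) hU.uniqueDiffOn uniqueDiffOn_univ
        (fun y _ ↦ hab (hFab i y)) (Set.mem_univ x) (C := K) (D := M * ((1 + ‖x‖) ^ k)⁻¹)
        (fun j hj ↦ (hCg j _ (hFab i x)).trans (hKG j hj)) (by
          intro j hj1 hjn
          rw [iteratedFDerivWithin_univ]
          have h1 := (hCF j i x).trans (hMF j hjn)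
          have h2 : ‖iteratedFDeriv ℝ j (F i) x‖ ≤ M * ((1 + ‖x‖) ^ (k * n))⁻¹ := by
            rw [← div_eq_mul_inv, le_div_iff₀ (by positivity), mul_comm]
            exact h1
          refine h2.trans ?_
          rw [mul_pow, inv_pow, ← pow_mul]
          gcongr
          · exact le_self_pow₀ hM1 (by omega))
      rw [iteratedFDerivWithin_univ] at h
      have h' : ‖iteratedFDeriv ℝ n (fun x ↦ G (F i x)) x‖ ≤
          n.factorial * K * (M * ((1 + ‖x‖) ^ k)⁻¹) ^ n := h
      calc (1 + ‖x‖) ^ k * ‖iteratedFDeriv ℝ n (fun x ↦ G (F i x)) x‖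
          ≤ (1 + ‖x‖) ^ (k * n) * (n.factorial * K * (M * ((1 + ‖x‖) ^ k)⁻¹) ^ n) := by
            gcongr
            exact Nat.le_mul_of_pos_right k hn
        _ = n.factorial * K * M ^ n := by
            rw [mul_pow, inv_pow, ← pow_mul]
            field_simp
  refine ⟨fun i ↦ ⟨fun x ↦ G (F i x), hsmooth i, fun k n ↦ ?_⟩, fun i x ↦ rfl, fun k n ↦ ?_⟩
  · obtain ⟨C, hC⟩ := hbound k n
    refine ⟨C, fun x ↦ le_trans ?_ (hC i x)⟩
    gcongr
    linarith
  · exact hbound k n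

/-- The symbol of the heat semigroup. -/
def heatSymbol (d : ℕ) (t : ℝ) (ξ : Space d) : ℝ := Real.exp (-(4 * Real.pi ^ 2 * t) * ‖ξ‖ ^ 2)

theorem contDiff_heatSymbol (t : ℝ) : ContDiff ℝ ∞ (heatSymbol d t) := by
  unfold heatSymbol
  exact Real.contDiff_exp.comp (contDiff_const.mul (contDiff_norm_sq ℝ))

/-- The exponent is nonpositive for `t ≥ 0`, so every derivative of the outer exponential is at most
one; the inner function is a quadratic polynomial with coefficients bounded for `t ≤ T`. -/
theorem exists_iteratedFDeriv_heatSymbol_le (T : ℝ) (n : ℕ) : ∃ (k : ℕ) (C : ℝ), 0 ≤ C ∧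
    ∀ j ≤ n, ∀ t ∈ Set.Icc 0 T, ∀ ξ : Space d,
      ‖iteratedFDeriv ℝ j (heatSymbol d t) ξ‖ ≤ C * (1 + ‖ξ‖) ^ k := by
  obtain ⟨k, C, hC0, hC⟩ :=
    (Function.hasTemperateGrowth_norm_sq (Space d)).norm_iteratedFDeriv_le_uniform n
  set A : ℝ := 1 + 4 * Real.pi ^ 2 * |T| * C with hA
  have hA1 : 1 ≤ A := by
    have : 0 ≤ 4 * Real.pi ^ 2 * |T| * C := by positivity
    linarith
  refine ⟨k * n, n.factorial * 1 * A ^ n, by positivity, fun j hj t ht ξ ↦ ?_⟩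
  have hx1 : (1 : ℝ) ≤ 1 + ‖ξ‖ := by linarith [norm_nonneg ξ]
  have hD1 : 1 ≤ A * (1 + ‖ξ‖) ^ k := by
    have := one_le_pow₀ hx1 (n := k)
    nlinarith
  have h := norm_iteratedFDeriv_comp_le (𝕜 := ℝ) (g := Real.exp)
    (f := fun ξ : Space d ↦ -(4 * Real.pi ^ 2 * t) * ‖ξ‖ ^ 2) (n := j) (N := ∞)
    Real.contDiff_exp (contDiff_const.mul (contDiff_norm_sq ℝ)) (by exact_mod_cast le_top) ξ
    (C := 1) (D := A * (1 + ‖ξ‖) ^ k) (by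
      intro i _
      rw [norm_iteratedFDeriv_eq_norm_iteratedDeriv, iteratedDeriv_eq_iterate, Real.iter_deriv_exp,
        Real.norm_of_nonneg (Real.exp_pos _).le, Real.exp_le_one_iff]
      have : 0 ≤ 4 * Real.pi ^ 2 * t * ‖ξ‖ ^ 2 := by
        have := ht.1
        positivity
      linarith) (by
      intro i hi1 hij
      have h1 : iteratedFDeriv ℝ i (fun ξ : Space d ↦ -(4 * Real.pi ^ 2 * t) * ‖ξ‖ ^ 2) ξ =
          (-(4 * Real.pi ^ 2 * t)) • iteratedFDeriv ℝ i (fun ξ : Space d ↦ ‖ξ‖ ^ 2) ξ := by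
        rw [← iteratedFDeriv_const_smul_apply]
        · rfl
        · exact (contDiff_norm_sq ℝ).contDiffAt
      rw [h1, norm_smul, norm_neg, Real.norm_of_nonneg (by have := ht.1; positivity)]
      have h2 := hC i (hij.trans hj) ξ
      have ht' : t ≤ |T| := ht.2.trans (le_abs_self T)
      calc 4 * Real.pi ^ 2 * t * ‖iteratedFDeriv ℝ i (fun ξ : Space d ↦ ‖ξ‖ ^ 2) ξ‖
          ≤ 4 * Real.pi ^ 2 * |T| * (C * (1 + ‖ξ‖) ^ k) := by gcongr
        _ ≤ A * (1 + ‖ξ‖) ^ k := by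
          rw [← mul_assoc, hA]
          gcongr
          linarith
        _ ≤ (A * (1 + ‖ξ‖) ^ k) ^ i := le_self_pow₀ hD1 (by omega))
  refine (show ‖iteratedFDeriv ℝ j (heatSymbol d t) ξ‖ ≤ _ from h).trans ?_
  calc (j.factorial : ℝ) * 1 * (A * (1 + ‖ξ‖) ^ k) ^ j
      ≤ n.factorial * 1 * (A * (1 + ‖ξ‖) ^ k) ^ n := by
        gcongr
    _ = _ := by rw [mul_pow, ← pow_mul]; ring

theorem heatSymbol_hasTemperateGrowth {t : ℝ} (ht : 0 ≤ t) :
    (heatSymbol d t).HasTemperateGrowth := by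
  refine ⟨contDiff_heatSymbol t, fun n ↦ ?_⟩
  obtain ⟨k, C, -, hC⟩ := exists_iteratedFDeriv_heatSymbol_le (d := d) t n
  exact ⟨k, C, fun ξ ↦ hC n le_rfl t ⟨ht, le_rfl⟩ ξ⟩

/-- The heat semigroup on Schwartz functions. -/
def heatC (t : ℝ) (h : 𝓢(Space d, ℝ)) : 𝓢(Space d, ℂ) :=
  SchwartzMap.fourierMultiplierCLM ℂ (heatSymbol d t) (cplx h)

theorem schwartzBounded_heatC (T : ℝ) (h : 𝓢(Space d, ℝ)) :
    SchwartzBounded fun t : Set.Icc 0 T ↦ heatC t h := by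
  suffices hs : SchwartzBounded fun t : Set.Icc 0 T ↦
      SchwartzMap.smulLeftCLM ℂ (heatSymbol d t) (𝓕 (cplx h)) from
    hs.map (fourierInvCLM ℝ 𝓢(Space d, ℂ))
  intro k n
  obtain ⟨l, C, hC0, hC⟩ := exists_iteratedFDeriv_heatSymbol_le (d := d) T n
  choose Cg hCg using fun j : ℕ ↦ SchwartzBounded.const (ι := Unit) (𝓕 (cplx h)) (k + l) j
  refine ⟨∑ i ∈ Finset.range (n + 1), n.choose i * C * Cg (n - i), fun t ξ ↦ ?_⟩
  rw [SchwartzMap.smulLeftCLM_apply (heatSymbol_hasTemperateGrowth t.2.1)]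
  have h1 := norm_iteratedFDeriv_smul_le (𝕜 := ℝ) (f := heatSymbol d t)
    (g := (𝓕 (cplx h) : 𝓢(Space d, ℂ))) (contDiff_heatSymbol t)
    (SchwartzMap.smooth' _) ξ (n := n) (by exact_mod_cast le_top)
  refine (mul_le_mul_of_nonneg_left h1 (by positivity)).trans ?_
  rw [Finset.mul_sum]
  refine Finset.sum_le_sum fun i hi ↦ ?_
  have h2 := hC i (Nat.lt_succ_iff.1 (Finset.mem_range.1 hi)) t t.2 ξ
  have h3 := hCg (n - i) () ξ
  calc (1 + ‖ξ‖) ^ k * (n.choose i * ‖iteratedFDeriv ℝ i (heatSymbol d t) ξ‖ *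
        ‖iteratedFDeriv ℝ (n - i) (𝓕 (cplx h) : 𝓢(Space d, ℂ)) ξ‖)
      ≤ (1 + ‖ξ‖) ^ k * (n.choose i * (C * (1 + ‖ξ‖) ^ l) *
        ‖iteratedFDeriv ℝ (n - i) (𝓕 (cplx h) : 𝓢(Space d, ℂ)) ξ‖) := by gcongr
    _ = n.choose i * C * ((1 + ‖ξ‖) ^ (k + l) *
        ‖iteratedFDeriv ℝ (n - i) (𝓕 (cplx h) : 𝓢(Space d, ℂ)) ξ‖) := by rw [pow_add]; ring
    _ ≤ n.choose i * C * Cg (n - i) := by gcongr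

end BoundedFamilies

/-! ### The heat semigroup as a Fourier multiplier and as a Gaussian average. -/

section Heat

variable {d : ℕ}

/-- The heat kernel at time one. -/
def gaussian (d : ℕ) (y : Space d) : ℝ :=
  ((4 * Real.pi) ^ ((d : ℝ) / 2))⁻¹ * Real.exp (-(1 / 4) * ‖y‖ ^ 2)

theorem gaussian_pos (y : Space d) : 0 < gaussian d y := by
  unfold gaussian
  have := Real.pi_pos
  positivity

theorem continuous_gaussian : Continuous (gaussian d) := by
  unfold gaussian
  fun_prop

theorem integrable_gaussian : Integrable (gaussian d) := by
  refine Integrable.const_mul ?_ _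
  have h := (GaussianFourier.integrable_cexp_neg_mul_sq_norm_add (V := Space d) (b := (1 / 4 : ℂ))
    (by norm_num) 0 0).norm
  refine h.congr (Eventually.of_forall fun y ↦ ?_)
  simp only [Complex.norm_exp]
  have h2 : ((‖y‖ : ℂ) ^ 2).re = ‖y‖ ^ 2 := by rw [← Complex.ofReal_pow, Complex.ofReal_re]
  congr 1
  norm_cast
  simp [h2]

theorem integral_gaussian : ∫ y, gaussian d y = 1 := by
  unfold gaussian
  rw [integral_const_mul, GaussianFourier.integral_rexp_neg_mul_sq_norm (by norm_num)]
  have := Real.pi_pos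
  rw [finrank_euclideanSpace_fin, show Real.pi / (1 / 4) = 4 * Real.pi by ring]
  exact inv_mul_cancel₀ (by positivity)

theorem fourier_gaussian (w : Space d) :
    ∫ y, Real.fourierChar (-inner ℝ y w) • (gaussian d y : ℂ) =
      Real.exp (-(4 * Real.pi ^ 2) * ‖w‖ ^ 2) := by
  have h := fourier_gaussian_innerProductSpace (V := Space d) (b := (1 / 4 : ℂ)) (by norm_num) w
  rw [Real.fourier_eq] at h
  have h2 : ∀ y : Space d, Real.fourierChar (-inner ℝ y w) • (gaussian d y : ℂ) =
      ((((4 * Real.pi) ^ ((d : ℝ) / 2))⁻¹ : ℝ) : ℂ) *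
        (Real.fourierChar (-inner ℝ y w) • Complex.exp (-(1 / 4) * ‖y‖ ^ 2)) := by
    intro y
    simp only [gaussian, Circle.smul_def, smul_eq_mul]
    push_cast
    ring
  simp_rw [h2]
  rw [integral_const_mul, h, finrank_euclideanSpace_fin]
  have hp := Real.pi_pos
  have h3 : ((Real.pi : ℂ) / (1 / 4)) ^ ((d : ℂ) / 2) =
      (((4 * Real.pi) ^ ((d : ℝ) / 2) : ℝ) : ℂ) := by
    rw [Complex.ofReal_cpow (by positivity)]
    push_cast
    congr 1
    ring
  rw [h3, ← mul_assoc, ← Complex.ofReal_mul, inv_mul_cancel₀ (by positivity)]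
  push_cast
  rw [one_mul]
  congr 1
  ring

/-- The heat semigroup, as an average over a Gaussian. -/
def heatAvg (t : ℝ) (F : Space d → ℝ) (x : Space d) : ℝ :=
  ∫ y, gaussian d y * F (x - √t • y)

theorem heatC_apply {t : ℝ} (ht : 0 ≤ t) (h : 𝓢(Space d, ℝ)) (x : Space d) :
    heatC t h x = ∫ ξ, Real.fourierChar (inner ℝ ξ x) •
      (heatSymbol d t ξ • (𝓕 (cplx h) : 𝓢(Space d, ℂ)) ξ) := by
  rw [heatC, SchwartzMap.fourierMultiplierCLM_apply, SchwartzMap.fourierInv_coe,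
    Real.fourierInv_eq]
  refine integral_congr_ae (Eventually.of_forall fun ξ ↦ ?_)
  simp only
  rw [SchwartzMap.smulLeftCLM_apply_apply (heatSymbol_hasTemperateGrowth ht)]

/-- Fubini and the Fourier transform of the Gaussian. The Fourier side gives Schwartz regularity and
the time derivative, the Gaussian side gives positivity and the maximum principle. -/
theorem heatC_eq_heatAvg {t : ℝ} (ht : 0 ≤ t) (h : 𝓢(Space d, ℝ)) (x : Space d) :
    heatC t h x = (heatAvg t h x : ℂ) := by
  set H : 𝓢(Space d, ℂ) := 𝓕 (cplx h) with hH
  have hinv : ∀ z, (h z : ℂ) = ∫ ξ, Real.fourierChar (inner ℝ ξ z) • H ξ := by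
    intro z
    have h1 : (𝓕⁻ H : 𝓢(Space d, ℂ)) z = (h z : ℂ) := by
      rw [hH, fourierInv_fourier_eq]
      simp
    rw [← h1, SchwartzMap.fourierInv_coe, Real.fourierInv_eq]
  have hinteg : Integrable (Function.uncurry fun (y ξ : Space d) ↦
      Real.fourierChar (inner ℝ ξ (x - √t • y)) • ((gaussian d y : ℂ) * H ξ)) := by
    have h0 : Integrable (fun p : Space d × Space d ↦ (gaussian d p.1 : ℂ) * H p.2)
        ((volume : Measure (Space d)).prod volume) :=
      Integrable.mul_prod (f := fun y ↦ (gaussian d y : ℂ)) (integrable_gaussian.ofReal)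
        (H.integrable)
    refine Integrable.mono h0 ?_ (Eventually.of_forall fun p ↦ ?_)
    · refine Continuous.aestronglyMeasurable ?_
      have := continuous_gaussian (d := d)
      have hHc := H.continuous
      have hfc := Real.continuous_fourierChar
      simp only [Function.uncurry_def, Circle.smul_def]
      fun_prop
    · simp [Function.uncurry_def]
  rw [heatC_apply ht, heatAvg, ← integral_complex_ofReal]
  have h1 : ∀ y : Space d, ((gaussian d y * h (x - √t • y) : ℝ) : ℂ) =
      ∫ ξ, Real.fourierChar (inner ℝ ξ (x - √t • y)) • ((gaussian d y : ℂ) * H ξ) := by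
    intro y
    rw [Complex.ofReal_mul, hinv, ← integral_const_mul]
    refine integral_congr_ae (Eventually.of_forall fun ξ ↦ ?_)
    simp only [Circle.smul_def, smul_eq_mul]
    ring
  simp_rw [h1]
  rw [integral_integral_swap hinteg]
  refine integral_congr_ae (Eventually.of_forall fun ξ ↦ ?_)
  simp only
  have h2 : ∀ y : Space d,
      Real.fourierChar (inner ℝ ξ (x - √t • y)) • ((gaussian d y : ℂ) * H ξ) =
      (Real.fourierChar (-inner ℝ y (√t • ξ)) • (gaussian d y : ℂ)) *
        (Real.fourierChar (inner ℝ ξ x) • H ξ) := by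
    intro y
    rw [inner_sub_right, sub_eq_add_neg, AddChar.map_add_eq_mul, inner_smul_right,
      inner_smul_right, real_inner_comm ξ y]
    simp only [Circle.smul_def, smul_eq_mul, Circle.coe_mul]
    ring
  simp_rw [h2]
  rw [integral_mul_const, fourier_gaussian, norm_smul, mul_pow, Real.norm_of_nonneg (by positivity),
    Real.sq_sqrt ht, heatSymbol]
  simp only [Circle.smul_def, smul_eq_mul, Complex.real_smul]
  rw [show -(4 * Real.pi ^ 2) * (t * ‖ξ‖ ^ 2) = -(4 * Real.pi ^ 2 * t) * ‖ξ‖ ^ 2 by ring]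
  ring

theorem integrable_gaussian_mul {F : Space d → ℝ} (hF : Continuous F) {C : ℝ}
    (hC : ∀ x, |F x| ≤ C) (t : ℝ) (x : Space d) :
    Integrable fun y ↦ gaussian d y * F (x - √t • y) :=
  integrable_gaussian.mul_bdd (c := C)
    (by exact (hF.comp (by fun_prop)).aestronglyMeasurable)
    (Eventually.of_forall fun y ↦ hC _)

theorem heatAvg_const (t c : ℝ) (x : Space d) : heatAvg t (fun _ ↦ c) x = c := by
  simp only [heatAvg]
  rw [integral_mul_const, integral_gaussian, one_mul]

theorem heatAvg_mono {F G : Space d → ℝ} (hF : Continuous F) (hG : Continuous G) {C : ℝ}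
    (hFC : ∀ x, |F x| ≤ C) (hGC : ∀ x, |G x| ≤ C) (hFG : ∀ x, F x ≤ G x) (t : ℝ) (x : Space d) :
    heatAvg t F x ≤ heatAvg t G x :=
  integral_mono (integrable_gaussian_mul hF hFC t x) (integrable_gaussian_mul hG hGC t x)
    fun y ↦ mul_le_mul_of_nonneg_left (hFG _) (gaussian_pos y).le

theorem heatAvg_add {F G : Space d → ℝ} (hF : Continuous F) (hG : Continuous G) {C : ℝ}
    (hFC : ∀ x, |F x| ≤ C) (hGC : ∀ x, |G x| ≤ C) (t : ℝ) (x : Space d) :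
    heatAvg t (fun z ↦ F z + G z) x = heatAvg t F x + heatAvg t G x := by
  simp only [heatAvg, mul_add]
  exact integral_add (integrable_gaussian_mul hF hFC t x) (integrable_gaussian_mul hG hGC t x)

theorem heatAvg_const_mul (c : ℝ) (F : Space d → ℝ) (t : ℝ) (x : Space d) :
    heatAvg t (fun z ↦ c * F z) x = c * heatAvg t F x := by
  simp only [heatAvg]
  rw [← integral_const_mul]
  refine integral_congr_ae (Eventually.of_forall fun y ↦ ?_)
  simp only
  ring

theorem heatAvg_mem_Icc {F : Space d → ℝ} (hF : Continuous F) {a b : ℝ}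
    (hab : ∀ x, F x ∈ Set.Icc a b) (t : ℝ) (x : Space d) : heatAvg t F x ∈ Set.Icc a b := by
  have hC : ∀ x, |F x| ≤ |a| + |b| := fun x ↦ by
    obtain ⟨h1, h2⟩ := hab x
    rw [abs_le]
    constructor
    · linarith [neg_abs_le a, abs_nonneg b]
    · linarith [le_abs_self b, abs_nonneg a]
  constructor
  · have := heatAvg_mono continuous_const hF (fun _ ↦ by linarith [abs_nonneg b]) hC
      (fun x ↦ (hab x).1) t x
    rwa [heatAvg_const] at this
  · have := heatAvg_mono hF continuous_const hC (fun _ ↦ by linarith [abs_nonneg a])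
      (fun x ↦ (hab x).2) t x
    rwa [heatAvg_const] at this

theorem heatAvg_zero (F : Space d → ℝ) (x : Space d) : heatAvg 0 F x = F x := by
  simp only [heatAvg, Real.sqrt_zero, zero_smul, sub_zero]
  rw [integral_mul_const, integral_gaussian, one_mul]

/-- Time enters only through the argument `x - √t • y`, so dominated convergence applies without a
singularity at `t = 0`. -/
theorem continuous_heatAvg_time {F : Space d → ℝ} (hF : Continuous F) {C : ℝ} (hC : ∀ x, |F x| ≤ C)
    (x : Space d) : Continuous fun t ↦ heatAvg t F x := by
  refine continuous_of_dominated (bound := fun y ↦ gaussian d y * C)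
    (fun t ↦ (integrable_gaussian_mul hF hC t x).1) (fun t ↦ Eventually.of_forall fun y ↦ ?_)
    (integrable_gaussian.mul_const C) (Eventually.of_forall fun y ↦ ?_)
  · rw [norm_mul, Real.norm_of_nonneg (gaussian_pos y).le]
    exact mul_le_mul_of_nonneg_left (hC _) (gaussian_pos y).le
  · exact continuous_const.mul (hF.comp (by fun_prop))

theorem continuous_heatAvg {F : Space d → ℝ} (hF : Continuous F) {C : ℝ} (hC : ∀ x, |F x| ≤ C)
    (t : ℝ) : Continuous fun x ↦ heatAvg t F x := by
  refine continuous_of_dominated (bound := fun y ↦ gaussian d y * C)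
    (fun x ↦ (integrable_gaussian_mul hF hC t x).1) (fun x ↦ Eventually.of_forall fun y ↦ ?_)
    (integrable_gaussian.mul_const C) (Eventually.of_forall fun y ↦ ?_)
  · rw [norm_mul, Real.norm_of_nonneg (gaussian_pos y).le]
    exact mul_le_mul_of_nonneg_left (hC _) (gaussian_pos y).le
  · exact continuous_const.mul (hF.comp (by fun_prop))

theorem laplacian_heatC {t : ℝ} (ht : 0 ≤ t) (h : 𝓢(Space d, ℝ)) (x : Space d) :
    (Δ (heatC t h)) x = ∫ ξ, Real.fourierChar (inner ℝ ξ x) •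
      ((-(4 * Real.pi ^ 2 * ‖ξ‖ ^ 2) * heatSymbol d t ξ) • (𝓕 (cplx h) : 𝓢(Space d, ℂ)) ξ) := by
  have hg : (fun ξ : Space d ↦ ‖ξ‖ ^ 2).HasTemperateGrowth :=
    Function.hasTemperateGrowth_norm_sq (Space d)
  rw [SchwartzMap.laplacian_eq_fourierMultiplierCLM, heatC,
    SchwartzMap.fourierMultiplierCLM_fourierMultiplierCLM_apply (by exact hg)
      (heatSymbol_hasTemperateGrowth ht), smul_apply,
    SchwartzMap.fourierMultiplierCLM_apply, SchwartzMap.fourierInv_coe,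
    Real.fourierInv_eq, ← integral_smul]
  refine integral_congr_ae (Eventually.of_forall fun ξ ↦ ?_)
  simp only
  rw [SchwartzMap.smulLeftCLM_apply_apply (by exact hg.mul (heatSymbol_hasTemperateGrowth ht))]
  simp only [Pi.mul_apply, Circle.smul_def, smul_eq_mul, Complex.real_smul]
  push_cast
  ring

/-- Differentiation under the Fourier integral, dominated by a multiple of `‖ξ‖² ‖H ξ‖` since the
heat symbol is at most one. -/
theorem hasDerivAt_heatC {t : ℝ} (ht : 0 < t) (h : 𝓢(Space d, ℝ)) (x : Space d) :
    HasDerivAt (fun τ ↦ heatC τ h x) ((Δ (heatC t h)) x) t := by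
  set H : 𝓢(Space d, ℂ) := 𝓕 (cplx h) with hH
  rw [laplacian_heatC ht.le]
  have heq : (fun τ ↦ heatC τ h x) =ᶠ[𝓝 t]
      fun τ ↦ ∫ ξ, Real.fourierChar (inner ℝ ξ x) • (heatSymbol d τ ξ • H ξ) := by
    filter_upwards [lt_mem_nhds ht] with τ hτ
    exact heatC_apply hτ.le h x
  refine HasDerivAt.congr_of_eventuallyEq ?_ heq
  have hle : ∀ τ, 0 < τ → ∀ ξ : Space d, heatSymbol d τ ξ ≤ 1 := by
    intro τ hτ ξ
    rw [heatSymbol, Real.exp_le_one_iff]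
    have : 0 ≤ 4 * Real.pi ^ 2 * τ * ‖ξ‖ ^ 2 := by positivity
    linarith
  have hcont : ∀ τ, Continuous (heatSymbol d τ) := fun τ ↦ (contDiff_heatSymbol τ).continuous
  have hHc := H.continuous
  have hfc := Real.continuous_fourierChar
  have hnn : ∀ τ (ξ : Space d), 0 ≤ heatSymbol d τ ξ := fun τ ξ ↦ (Real.exp_pos _).le
  refine (hasDerivAt_integral_of_dominated_loc_of_deriv_le (Ioi_mem_nhds ht)
    (F := fun τ ξ ↦ Real.fourierChar (inner ℝ ξ x) • (heatSymbol d τ ξ • H ξ))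
    (F' := fun τ ξ ↦ Real.fourierChar (inner ℝ ξ x) •
      ((-(4 * Real.pi ^ 2 * ‖ξ‖ ^ 2) * heatSymbol d τ ξ) • H ξ))
    (bound := fun ξ ↦ 4 * Real.pi ^ 2 * (‖ξ‖ ^ 2 * ‖H ξ‖)) ?_ ?_ ?_ ?_ ?_ ?_).2
  · refine Eventually.of_forall fun τ ↦ Continuous.aestronglyMeasurable ?_
    have := hcont τ
    simp only [Circle.smul_def]
    fun_prop
  · refine Integrable.mono H.integrable ?_ (Eventually.of_forall fun ξ ↦ ?_)
    · have := hcont t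
      refine Continuous.aestronglyMeasurable ?_
      simp only [Circle.smul_def]
      fun_prop
    · rw [Circle.norm_smul, norm_smul, Real.norm_of_nonneg (hnn _ _)]
      exact mul_le_of_le_one_left (norm_nonneg _) (hle t ht ξ)
  · have := hcont t
    refine Continuous.aestronglyMeasurable ?_
    simp only [Circle.smul_def]
    fun_prop
  · refine Eventually.of_forall fun ξ τ hτ ↦ ?_
    rw [Circle.norm_smul, norm_smul, norm_mul, norm_neg, Real.norm_of_nonneg (hnn _ _),
      Real.norm_of_nonneg (by positivity)]
    have := hle τ hτ ξ
    calc 4 * Real.pi ^ 2 * ‖ξ‖ ^ 2 * heatSymbol d τ ξ * ‖H ξ‖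
        ≤ 4 * Real.pi ^ 2 * ‖ξ‖ ^ 2 * 1 * ‖H ξ‖ := by gcongr
      _ = _ := by ring
  · exact (H.integrable_pow_mul volume 2).const_mul _
  · refine Eventually.of_forall fun ξ τ hτ ↦ ?_
    have h1 : HasDerivAt (fun τ ↦ heatSymbol d τ ξ)
        (-(4 * Real.pi ^ 2 * ‖ξ‖ ^ 2) * heatSymbol d τ ξ) τ := by
      have h2 : HasDerivAt (fun τ : ℝ ↦ -(4 * Real.pi ^ 2 * τ) * ‖ξ‖ ^ 2)
          (-(4 * Real.pi ^ 2 * 1) * ‖ξ‖ ^ 2) τ :=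
        (((hasDerivAt_id τ).const_mul _).neg).mul_const _
      convert h2.exp using 1
      · rfl
      · rw [show heatSymbol d τ ξ = Real.exp (-(4 * Real.pi ^ 2 * τ) * ‖ξ‖ ^ 2) from rfl]
        ring
    simp only [Circle.smul_def]
    exact (h1.smul_const (H ξ)).fun_const_smul _

end Heat

/-! ### Global Schwartz solutions by the Cole–Hopf transformation. -/

section Existence

variable {d : ℕ}

/-- The partial derivatives of a real Schwartz function. -/
abbrev partialDeriv (i : Fin d) (g : 𝓢(Space d, ℝ)) : 𝓢(Space d, ℝ) :=
  ∂_{EuclideanSpace.single i (1 : ℝ)} g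

theorem lineDerivOp_cplx (e : Space d) (g : 𝓢(Space d, ℝ)) : ∂_{e} (cplx g) = cplx (∂_{e} g) := by
  ext x
  rw [cplx_apply, SchwartzMap.lineDerivOp_apply_eq_fderiv, SchwartzMap.lineDerivOp_apply_eq_fderiv]
  have h : HasFDerivAt (cplx g) (Complex.ofRealCLM ∘L fderiv ℝ g x) x :=
    Complex.ofRealCLM.hasFDerivAt.comp x (g.differentiableAt.hasFDerivAt)
  rw [h.fderiv]
  rfl

theorem laplacian_cplx (g : 𝓢(Space d, ℝ)) : Δ (cplx g) = cplx (Δ g) := by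
  rw [SchwartzMap.laplacian_eq_sum (EuclideanSpace.basisFun (Fin d) ℝ),
    SchwartzMap.laplacian_eq_sum (EuclideanSpace.basisFun (Fin d) ℝ), map_sum]
  simp only [lineDerivOp_cplx]

/-- The Cole-Hopf transformation turns the heat operator into the Hamilton-Jacobi operator. -/
theorem laplacian_log_one_add {u v : 𝓢(Space d, ℝ)} (hv : ∀ x, 0 < 1 + v x)
    (hu : ∀ x, u x = Real.log (1 + v x)) (x : Space d) :
    (Δ u) x + ∑ i, (partialDeriv i u x) ^ 2 = (Δ v) x / (1 + v x) := by
  have hne : ∀ x, 1 + v x ≠ 0 := fun x ↦ (hv x).ne'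
  have hv1 : ∀ x, HasFDerivAt (fun z ↦ 1 + v z) (fderiv ℝ v x) x := fun x ↦
    v.differentiableAt.hasFDerivAt.const_add 1
  have h1 : ∀ (e : Space d) (x : Space d), ∂_{e} u x = ∂_{e} v x / (1 + v x) := by
    intro e x
    have : (u : Space d → ℝ) = fun x ↦ Real.log (1 + v x) := funext hu
    rw [SchwartzMap.lineDerivOp_apply_eq_fderiv, SchwartzMap.lineDerivOp_apply_eq_fderiv, this,
      ((hv1 x).log (hne x)).fderiv]
    simp [div_eq_inv_mul]
  -- The quotient rule gives `∂²u = ∂²v / (1 + v) - (∂v / (1 + v))²`, and the last square is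
  -- `(∂u)²`.
  have h2 : ∀ e : Space d, ∂_{e} (∂_{e} u) x + (∂_{e} u x) ^ 2 = ∂_{e} (∂_{e} v) x / (1 + v x) := by
    intro e
    have : ((∂_{e} u : 𝓢(Space d, ℝ)) : Space d → ℝ) =
        fun x ↦ (∂_{e} v : 𝓢(Space d, ℝ)) x * (1 + v x)⁻¹ :=
      funext fun x ↦ by rw [h1, div_eq_mul_inv]
    have hd1 : HasFDerivAt (∂_{e} v : 𝓢(Space d, ℝ)) (fderiv ℝ (∂_{e} v : 𝓢(Space d, ℝ)) x) x :=
      (∂_{e} v : 𝓢(Space d, ℝ)).differentiableAt.hasFDerivAt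
    have hd2 := (hasDerivAt_inv (hne x)).comp_hasFDerivAt x (hv1 x)
    have hd := hd1.mul hd2
    rw [SchwartzMap.lineDerivOp_apply_eq_fderiv e (∂_{e} u), h1, this]
    rw [show fderiv ℝ (fun x ↦ (∂_{e} v : 𝓢(Space d, ℝ)) x * (1 + v x)⁻¹) x = _ from hd.fderiv,
      SchwartzMap.lineDerivOp_apply_eq_fderiv e (∂_{e} v)]
    simp only [add_apply, smul_apply, smul_eq_mul, Function.comp_apply,
      SchwartzMap.lineDerivOp_apply_eq_fderiv]
    have := hne x
    field_simp
    ring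
  rw [SchwartzMap.laplacian_eq_sum (EuclideanSpace.basisFun (Fin d) ℝ),
    SchwartzMap.laplacian_eq_sum (EuclideanSpace.basisFun (Fin d) ℝ), sum_apply,
    sum_apply, ← Finset.sum_add_distrib, Finset.sum_div]
  refine Finset.sum_congr rfl fun i _ ↦ ?_
  simpa using h2 (EuclideanSpace.single i 1)

theorem exists_abs_le (f : 𝓢(Space d, ℝ)) : ∃ C : ℝ, 0 ≤ C ∧ ∀ x, |f x| ≤ C := by
  obtain ⟨C, hC0, hC⟩ := f.decay 0 0
  exact ⟨C, hC0.le, fun x ↦ by simpa using hC x⟩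

/-- A family of Schwartz functions that solves the viscous Hamilton-Jacobi equation. -/
structure IsSchwartzSolution (f : 𝓢(Space d, ℝ)) (u : ℝ → 𝓢(Space d, ℝ)) : Prop where
  initial : u 0 = f
  bounded : ∀ T, SchwartzBounded fun τ : Set.Icc (0 : ℝ) T ↦ u τ
  continuous : ∀ x, ContinuousOn (fun τ ↦ u τ x) (Set.Ici 0)
  equation : ∀ t, 0 < t → ∀ x, HasDerivAt (fun τ ↦ u τ x)
    ((Δ (u t)) x + ∑ i, (partialDeriv i (u t) x) ^ 2) t

/-- Here `u = log (1 + v)`, where `v` is the heat flow of the Schwartz function `e^f - 1`. The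
maximum principle keeps `1 + v` above `e^{-C} > 0`, so the logarithm is smooth on the range of `1 +
v` and `u` stays bounded in the Schwartz space on compact time intervals. -/
theorem exists_isSchwartzSolution (f : 𝓢(Space d, ℝ)) : ∃ u : ℝ → 𝓢(Space d, ℝ),
    IsSchwartzSolution f u ∧
      ∀ t, 0 ≤ t → ∀ x, u t x = Real.log (heatAvg t (fun z ↦ Real.exp (f z)) x) := by
  obtain ⟨C, hC0, hC⟩ := exists_abs_le f
  obtain ⟨h', hh', -⟩ := exists_comp_schwartz (SchwartzBounded.const (ι := Unit) f)
    (G := fun z ↦ Real.exp z - 1) isOpen_univ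
    (Real.contDiff_exp.sub contDiff_const).contDiffOn (by simp) (Set.subset_univ (Set.Icc (-C) C))
    ⟨by linarith, hC0⟩ (fun _ x ↦ abs_le.1 (hC x))
  set h := h' () with hh
  have hhx : ∀ x, h x = Real.exp (f x) - 1 := hh' ()
  set a := Real.exp (-C) - 1 with ha
  set b := Real.exp C - 1 with hb
  have hhab : ∀ x, h x ∈ Set.Icc a b := fun x ↦ by
    obtain ⟨h1, h2⟩ := abs_le.1 (hC x)
    rw [hhx]
    exact ⟨sub_le_sub_right (Real.exp_le_exp.2 h1) 1, sub_le_sub_right (Real.exp_le_exp.2 h2) 1⟩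
  have ha1 : -1 < a := by
    have := Real.exp_pos (-C)
    linarith
  set v : ℝ → 𝓢(Space d, ℝ) := fun τ ↦ SchwartzMap.postcompCLM Complex.reCLM (heatC τ h) with hv
  have hvx : ∀ τ, 0 ≤ τ → ∀ x, v τ x = heatAvg τ h x := by
    intro τ hτ x
    change (heatC τ h x).re = _
    rw [heatC_eq_heatAvg hτ, Complex.ofReal_re]
  have hvab : ∀ τ, 0 ≤ τ → ∀ x, v τ x ∈ Set.Icc a b := fun τ hτ x ↦ by
    rw [hvx τ hτ]
    exact heatAvg_mem_Icc h.continuous hhab τ x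
  have hvb : ∀ T, SchwartzBounded fun τ : Set.Icc (0 : ℝ) T ↦ v τ := fun T ↦
    (schwartzBounded_heatC T h).map (SchwartzMap.postcompCLM Complex.reCLM)
  have hlog : ContDiffOn ℝ ∞ (fun z ↦ Real.log (1 + z)) (Set.Ioi (-1)) :=
    (contDiff_const.add contDiff_id).contDiffOn.log fun z hz ↦ by
      have : -1 < z := hz
      simp only [id]
      linarith
  have hab : Set.Icc a b ⊆ Set.Ioi (-1) := fun z hz ↦ ha1.trans_le hz.1
  have h0 : (0 : ℝ) ∈ Set.Icc a b := by
    rw [Set.mem_Icc, ha, hb, sub_nonneg, sub_nonpos, Real.exp_le_one_iff, Real.one_le_exp_iff]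
    exact ⟨by linarith, hC0⟩
  choose H hH hHb using fun T : ℝ ↦ exists_comp_schwartz (hvb T) isOpen_Ioi hlog (by simp) hab h0
    (fun τ x ↦ hvab τ τ.2.1 x)
  classical
  -- The families `H T` agree where they overlap, so `u τ` is taken at the end of the horizon `τ`;
  -- negative times get the value zero.
  set u : ℝ → 𝓢(Space d, ℝ) := fun τ ↦ if hτ : 0 ≤ τ then H τ ⟨τ, hτ, le_rfl⟩ else 0 with hu
  have hux : ∀ τ, 0 ≤ τ → ∀ x, u τ x = Real.log (1 + v τ x) := fun τ hτ x ↦ by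
    simp only [hu, dif_pos hτ, hH]
  have h1v : ∀ τ, 0 ≤ τ → ∀ x, 0 < 1 + v τ x := fun τ hτ x ↦ by
    have := (hvab τ hτ x).1
    linarith
  have hcv : ∀ τ, 0 ≤ τ → heatC τ h = cplx (v τ) := fun τ hτ ↦ by
    ext x
    rw [heatC_eq_heatAvg hτ, cplx_apply, hvx τ hτ]
  have havg : ∀ t x, heatAvg t (fun z ↦ Real.exp (f z)) x = 1 + heatAvg t h x := fun t x ↦ by
    have h1 : (fun z ↦ Real.exp (f z)) = fun z ↦ 1 + h z := funext fun z ↦ by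
      rw [hhx]
      ring
    rw [h1, heatAvg_add continuous_const h.continuous (C := 1 + |a| + |b|) _ _ t x, heatAvg_const]
    · intro _
      rw [abs_one]
      linarith [abs_nonneg a, abs_nonneg b]
    · intro x
      have := hhab x
      rw [abs_le]
      constructor
      · linarith [neg_abs_le a, abs_nonneg b, this.1]
      · linarith [le_abs_self b, abs_nonneg a, this.2]
  refine ⟨u, ⟨?_, fun T ↦ ?_, fun x ↦ ?_, fun t ht x ↦ ?_⟩, fun t ht x ↦ ?_⟩
  · ext x
    rw [hux 0 le_rfl, hvx 0 le_rfl, heatAvg_zero, hhx]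
    simp
  · have : (fun τ : Set.Icc (0 : ℝ) T ↦ u τ) = H T := by
      ext τ x
      rw [hux τ τ.2.1, hH]
    rw [this]
    exact hHb T
  · have hc : Continuous fun τ ↦ heatAvg τ h x := by
      obtain ⟨C', -, hC'⟩ := exists_abs_le h
      exact continuous_heatAvg_time h.continuous hC' x
    have h3 : ContinuousOn (fun τ ↦ Real.log (1 + heatAvg τ h x)) (Set.Ici 0) := by
      refine ContinuousOn.log (continuous_const.add hc).continuousOn fun τ hτ ↦ ?_
      rw [← hvx τ hτ]
      exact (h1v τ hτ x).ne'
    exact h3.congr fun τ hτ ↦ by rw [hux τ hτ, hvx τ hτ]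
  · rw [laplacian_log_one_add (h1v t ht.le) (hux t ht.le)]
    have h3 := Complex.reCLM.hasFDerivAt.comp_hasDerivAt t (hasDerivAt_heatC ht h x)
    have h4 : HasDerivAt (fun τ ↦ v τ x) ((Δ (v t)) x) t := by
      rw [hcv t ht.le, laplacian_cplx] at h3
      exact h3
    have h5 := (h4.const_add 1).log (h1v t ht.le x).ne'
    refine h5.congr_of_eventuallyEq ?_
    filter_upwards [lt_mem_nhds ht] with τ hτ
    exact hux τ hτ.le x
  · rw [hux t ht, hvx t ht, havg]

/-- A common majorant, a multiple of `(1 + ‖x‖)^{-(d+1)}`, for dominated convergence in `L¹` and in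
`L²`. -/
theorem SchwartzBounded.exists_norm_le {ι V : Type*} [NormedAddCommGroup V] [NormedSpace ℝ V]
    {F : ι → 𝓢(Space d, V)} (hF : SchwartzBounded F) : ∃ b : Space d → ℝ, Integrable b ∧
      Integrable (fun x ↦ b x ^ 2) ∧ ∀ i x, ‖F i x‖ ≤ b x := by
  obtain ⟨C, hC⟩ := hF (d + 1) 0
  have hinteg : Integrable fun x : Space d ↦ (1 + ‖x‖) ^ (-((d + 1 : ℕ) : ℝ)) :=
    integrable_one_add_norm (by rw [finrank_euclideanSpace_fin]; push_cast; linarith)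
  have h1 : ∀ x : Space d, (1 + ‖x‖) ^ (-((d + 1 : ℕ) : ℝ)) = ((1 + ‖x‖) ^ (d + 1))⁻¹ := fun x ↦ by
    rw [Real.rpow_neg (by positivity), Real.rpow_natCast]
  simp_rw [h1] at hinteg
  refine ⟨fun x ↦ |C| * ((1 + ‖x‖) ^ (d + 1))⁻¹, hinteg.const_mul _, ?_, fun i x ↦ ?_⟩
  · have h2 : Integrable fun x : Space d ↦ |C| ^ 2 * ((1 + ‖x‖) ^ (d + 1))⁻¹ := hinteg.const_mul _
    refine h2.mono ?_ (Eventually.of_forall fun x ↦ ?_)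
    · refine Continuous.aestronglyMeasurable ?_
      have : ∀ x : Space d, (1 + ‖x‖) ^ (d + 1) ≠ 0 := fun x ↦ by positivity
      fun_prop (disch := assumption)
    · rw [Real.norm_of_nonneg (by positivity), Real.norm_of_nonneg (by positivity), mul_pow]
      gcongr
      refine pow_le_of_le_one (by positivity) ?_ two_ne_zero
      refine inv_le_one_of_one_le₀ (one_le_pow₀ ?_)
      linarith [norm_nonneg x]
  · have := (hC i x).trans (le_abs_self C)
    rw [norm_iteratedFDeriv_zero] at this
    simp only
    rw [← div_eq_mul_inv, le_div_iff₀ (by positivity), mul_comm]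
    exact this

theorem tendsto_fourier_apply {F : ℝ → 𝓢(Space d, ℂ)}
    (hF : ∀ T, SchwartzBounded fun τ : Set.Icc (0 : ℝ) T ↦ F τ) {t : ℝ}
    (hFt : ∀ x, Tendsto (fun τ ↦ F τ x) (𝓝[Set.Ici 0] t) (𝓝 (F t x))) (ξ : Space d) :
    Tendsto (fun τ ↦ (𝓕 (F τ) : 𝓢(Space d, ℂ)) ξ) (𝓝[Set.Ici 0] t)
      (𝓝 ((𝓕 (F t) : 𝓢(Space d, ℂ)) ξ)) := by
  obtain ⟨b, hb, -, hbF⟩ := (hF (t + 1)).exists_norm_le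
  simp only [SchwartzMap.fourier_coe, Real.fourier_eq]
  have hfc := Real.continuous_fourierChar
  refine tendsto_integral_filter_of_dominated_convergence b ?_ ?_ hb ?_
  · refine Eventually.of_forall fun τ ↦ Continuous.aestronglyMeasurable ?_
    have := (F τ).continuous
    simp only [Circle.smul_def]
    fun_prop
  · filter_upwards [self_mem_nhdsWithin, mem_nhdsWithin_of_mem_nhds
      (Iic_mem_nhds (lt_add_one t))] with τ h1 h2
    refine Eventually.of_forall fun x ↦ ?_
    rw [Circle.norm_smul]
    exact hbF ⟨τ, h1, h2⟩ x
  · exact Eventually.of_forall fun x ↦ (hFt x).const_smul _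

theorem tendsto_integral_norm_sub_sq {F : ℝ → 𝓢(Space d, ℂ)}
    (hF : ∀ T, SchwartzBounded fun τ : Set.Icc (0 : ℝ) T ↦ F τ) {t : ℝ} (ht : 0 ≤ t)
    (hFt : ∀ x, Tendsto (fun τ ↦ F τ x) (𝓝[Set.Ici 0] t) (𝓝 (F t x))) :
    Tendsto (fun τ ↦ ∫ x, ‖F τ x - F t x‖ ^ 2) (𝓝[Set.Ici (0 : ℝ)] t) (𝓝 (0 : ℝ)) := by
  obtain ⟨b, -, hb, hbF⟩ := (hF (t + 1)).exists_norm_le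
  suffices h : Tendsto (fun τ ↦ ∫ x, ‖F τ x - F t x‖ ^ 2) (𝓝[Set.Ici 0] t)
      (𝓝 (∫ _ : Space d, (0 : ℝ))) by rwa [integral_zero] at h
  refine tendsto_integral_filter_of_dominated_convergence (fun x ↦ 4 * b x ^ 2) ?_ ?_
    (hb.const_mul 4) ?_
  · refine Eventually.of_forall fun τ ↦ Continuous.aestronglyMeasurable ?_
    have := (F τ).continuous
    have := (F t).continuous
    fun_prop
  · filter_upwards [self_mem_nhdsWithin, mem_nhdsWithin_of_mem_nhds
      (Iic_mem_nhds (lt_add_one t))] with τ h1 h2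
    refine Eventually.of_forall fun x ↦ ?_
    have h3 := hbF ⟨τ, h1, h2⟩ x
    have h4 := hbF ⟨t, ht, by linarith⟩ x
    have h5 := norm_sub_le (F τ x) (F t x)
    rw [Real.norm_of_nonneg (by positivity)]
    have h6 : ‖F τ x - F t x‖ ≤ 2 * b x := by
      simp only at h3 h4
      linarith
    calc ‖F τ x - F t x‖ ^ 2 ≤ (2 * b x) ^ 2 := by gcongr
      _ = 4 * b x ^ 2 := by ring
  · refine Eventually.of_forall fun x ↦ ?_
    have h1 : Tendsto (fun τ ↦ ‖F τ x - F t x‖ ^ 2) (𝓝[Set.Ici 0] t)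
        (𝓝 (‖F t x - F t x‖ ^ 2)) := (((hFt x).sub_const (F t x)).norm).pow 2
    simpa using h1

theorem fourier_besselS_apply (s : ℝ) (g : 𝓢(Space d, ℂ)) (ξ : Space d) :
    (𝓕 (besselS d s g) : 𝓢(Space d, ℂ)) ξ =
      (((1 + ‖ξ‖ ^ 2) ^ (s / 2) : ℝ) : ℂ) • (𝓕 g : 𝓢(Space d, ℂ)) ξ := by
  rw [besselS, SchwartzMap.fourierMultiplierCLM_apply, fourier_fourierInv_eq,
    SchwartzMap.smulLeftCLM_apply_apply (by fun_prop)]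

theorem sobolevENorm_toLp_sub (s : ℝ) (f g : 𝓢(Space d, ℝ)) :
    sobolevENorm s (toDist (f.toLp 2 volume - g.toLp 2 volume)) =
      ENNReal.ofReal (√(∫ x, ‖(𝓕 (besselS d s (cplx f)) : 𝓢(Space d, ℂ)) x -
        (𝓕 (besselS d s (cplx g)) : 𝓢(Space d, ℂ)) x‖ ^ 2)) := by
  have h1 : TemperedDistribution.besselPotential (Space d) ℂ s
      (toDist (f.toLp 2 volume - g.toLp 2 volume)) =
      Lp.toTemperedDistribution ((besselS d s (cplx (f - g))).toLp 2 volume) := by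
    rw [toDist_sub, toDist_toLp, toDist_toLp, Lp.toTemperedDistribution_toLp_eq,
      ← besselPotential_schwartz, map_sub, map_sub]
    simp only [map_sub]
  rw [sobolevENorm_eq h1, ← ofReal_norm, ← SchwartzMap.norm_fourier_toL2_eq]
  congr 1
  rw [← Real.sqrt_sq (norm_nonneg _), norm_toLp_two_sq, map_sub, map_sub,
    show 𝓕 (besselS d s (cplx f) - besselS d s (cplx g)) =
      𝓕 (besselS d s (cplx f)) - 𝓕 (besselS d s (cplx g)) from
      map_sub (fourierCLM ℂ 𝓢(Space d, ℂ)) _ _]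
  simp only [sub_apply]

/-- Pointwise continuity in time and a common majorant give pointwise continuity of the Fourier
transforms. The weighted transforms again form a bounded family, so dominated convergence applies
once more, followed by Plancherel. -/
theorem IsSchwartzSolution.tendsto_sobolevENorm {f : 𝓢(Space d, ℝ)} {u : ℝ → 𝓢(Space d, ℝ)}
    (hu : IsSchwartzSolution f u) (s : ℝ) {t : ℝ} (ht : 0 ≤ t) :
    Tendsto (fun τ ↦ sobolevENorm s (toDist ((u τ).toLp 2 volume - (u t).toLp 2 volume)))
      (𝓝[Set.Ici 0] t) (𝓝 0) := by
  have hx : ∀ x, Tendsto (fun τ ↦ cplx (u τ) x) (𝓝[Set.Ici 0] t) (𝓝 (cplx (u t) x)) := fun x ↦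
    (Complex.continuous_ofReal.tendsto _).comp (hu.continuous x t ht)
  have hb : ∀ T, SchwartzBounded fun τ : Set.Icc (0 : ℝ) T ↦ cplx (u τ) := fun T ↦
    (hu.bounded T).map cplx
  have hξ := tendsto_fourier_apply (F := fun τ ↦ cplx (u τ)) hb hx
  have hFb : ∀ T, SchwartzBounded fun τ : Set.Icc (0 : ℝ) T ↦
      (𝓕 (besselS d s (cplx (u τ))) : 𝓢(Space d, ℂ)) := fun T ↦
    ((hb T).map ((besselS d s).restrictScalars ℝ)).map (fourierCLM ℝ 𝓢(Space d, ℂ))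
  have hlim := tendsto_integral_norm_sub_sq
    (F := fun τ ↦ (𝓕 (besselS d s (cplx (u τ))) : 𝓢(Space d, ℂ))) hFb ht fun ξ ↦ by
      simp only [fourier_besselS_apply]
      exact (hξ ξ).const_smul _
  simp only [sobolevENorm_toLp_sub]
  have h2 : Tendsto (fun r : ℝ ↦ ENNReal.ofReal √r) (𝓝 0) (𝓝 0) := by
    have := (ENNReal.continuous_ofReal.comp Real.continuous_sqrt).tendsto 0
    simpa [Function.comp_def] using this
  exact h2.comp hlim

theorem IsSchwartzSolution.hasDerivAt_toDist {f : 𝓢(Space d, ℝ)} {u : ℝ → 𝓢(Space d, ℝ)}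
    (hu : IsSchwartzSolution f u) {t : ℝ} (ht : 0 < t) (ψ : 𝓢(Space d, ℂ)) :
    HasDerivAt (fun τ ↦ toDist ((u τ).toLp 2 volume) ψ)
      ((Δ (toDist ((u t).toLp 2 volume))) ψ + ∫ x, ((∑ i,
        ((partialDeriv i (u t)).toLp 2 volume x) ^ 2 : ℝ) : ℂ) * ψ x) t := by
  set D : ℝ → Space d → ℝ := fun τ x ↦
    (Δ (u τ)) x + ∑ i, (partialDeriv i (u τ) x) ^ 2 with hD
  have hDc : ∀ τ, Continuous (D τ) := fun τ ↦ by
    have h1 := (Δ (u τ)).continuous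
    have h2 := fun i ↦ (partialDeriv i (u τ)).continuous
    fun_prop
  obtain ⟨B, hB⟩ : ∃ B, ∀ τ ∈ Set.Ioo 0 (t + 1), ∀ x, |D τ x| ≤ B := by
    obtain ⟨C, hC⟩ := (hu.bounded (t + 1)).map (LineDeriv.laplacianCLM ℝ (Space d) _) 0 0
    choose C' hC' using fun i : Fin d ↦ (hu.bounded (t + 1)).map (LineDeriv.lineDerivOpCLM ℝ
      𝓢(Space d, ℝ) (EuclideanSpace.single i (1 : ℝ))) 0 0
    refine ⟨C + ∑ i, C' i ^ 2, fun τ hτ x ↦ ?_⟩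
    have h1 := hC ⟨τ, hτ.1.le, hτ.2.le⟩ x
    have h2 := fun i ↦ hC' i ⟨τ, hτ.1.le, hτ.2.le⟩ x
    simp only [pow_zero, one_mul, norm_iteratedFDeriv_zero] at h1 h2
    refine (abs_add_le _ _).trans (add_le_add h1 ?_)
    refine (Finset.abs_sum_le_sum_abs _ _).trans (Finset.sum_le_sum fun i _ ↦ ?_)
    rw [abs_pow]
    exact pow_le_pow_left₀ (abs_nonneg _) (h2 i) 2
  have hfun : (fun τ ↦ toDist ((u τ).toLp 2 volume) ψ) = fun τ ↦ ∫ x, ψ x * (u τ x : ℂ) := by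
    ext τ
    rw [toDist_toLp, SchwartzMap.coe_apply]
    rfl
  have hval : (Δ (toDist ((u t).toLp 2 volume))) ψ + ∫ x, ((∑ i,
      ((partialDeriv i (u t)).toLp 2 volume x) ^ 2 : ℝ) : ℂ) * ψ x =
      ∫ x, ψ x * (D t x : ℂ) := by
    have hae : ∀ᵐ x, ∀ i, (partialDeriv i (u t)).toLp 2 volume x =
        partialDeriv i (u t) x := by
      rw [ae_all_iff]
      exact fun i ↦ SchwartzMap.coeFn_toLp _ 2 _
    have h1 : ∫ x, ((∑ i,
      ((partialDeriv i (u t)).toLp 2 volume x) ^ 2 : ℝ) : ℂ) * ψ x =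
        ∫ x, ψ x * ((∑ i, (partialDeriv i (u t) x) ^ 2 : ℝ) : ℂ) := by
      refine integral_congr_ae ?_
      filter_upwards [hae] with x hx
      simp only [hx]
      ring
    rw [h1, toDist_toLp, TemperedDistribution.laplacian_toTemperedDistributionCLM_eq,
      laplacian_cplx, SchwartzMap.coe_apply]
    simp only [smul_eq_mul, cplx_apply]
    obtain ⟨C, hC0, hC⟩ := exists_abs_le (Δ (u t))
    rw [← integral_add]
    · refine integral_congr_ae (Eventually.of_forall fun x ↦ ?_)
      simp only [hD]
      push_cast
      ring
    · refine ψ.integrable.mul_bdd (c := C) ?_ (Eventually.of_forall fun x ↦ ?_)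
      · exact (Complex.continuous_ofReal.comp (Δ (u t)).continuous).aestronglyMeasurable
      · rw [Complex.norm_real]
        exact hC x
    · refine ψ.integrable.mul_bdd (c := B + C) ?_ (Eventually.of_forall fun x ↦ ?_)
      · have h2 := fun i ↦ (partialDeriv i (u t)).continuous
        refine (Complex.continuous_ofReal.comp ?_).aestronglyMeasurable
        fun_prop
      · rw [Complex.norm_real, Real.norm_eq_abs]
        have h3 : ∑ i, (partialDeriv i (u t) x) ^ 2 =
            D t x - (Δ (u t)) x := by
          simp only [hD]
          ring
        rw [h3]
        exact (abs_sub _ _).trans (add_le_add (hB t ⟨ht, by linarith⟩ x) (hC x))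
  rw [hfun, hval]
  obtain ⟨C, hC0, hC⟩ := exists_abs_le (u t)
  refine (hasDerivAt_integral_of_dominated_loc_of_deriv_le (Ioo_mem_nhds ht (lt_add_one t))
    (F := fun τ x ↦ ψ x * (u τ x : ℂ)) (F' := fun τ x ↦ ψ x * (D τ x : ℂ))
    (bound := fun x ↦ ‖ψ x‖ * B) ?_ ?_ ?_ ?_ ?_ ?_).2
  · refine Eventually.of_forall fun τ ↦ Continuous.aestronglyMeasurable ?_
    exact ψ.continuous.mul (Complex.continuous_ofReal.comp (u τ).continuous)
  · refine ψ.integrable.mul_bdd (c := C) ?_ (Eventually.of_forall fun x ↦ ?_)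
    · exact (Complex.continuous_ofReal.comp (u t).continuous).aestronglyMeasurable
    · rw [Complex.norm_real]
      exact hC x
  · exact (ψ.continuous.mul (Complex.continuous_ofReal.comp (hDc t))).aestronglyMeasurable
  · refine Eventually.of_forall fun x τ hτ ↦ ?_
    rw [norm_mul, Complex.norm_real]
    exact mul_le_mul_of_nonneg_left (hB τ hτ x) (norm_nonneg _)
  · exact ψ.integrable.norm.mul_const B
  · refine Eventually.of_forall fun x τ hτ ↦ ?_
    exact ((hu.equation τ hτ.1 x).ofReal_comp).const_mul (ψ x)

theorem IsSchwartzSolution.isGlobalSolution {f : 𝓢(Space d, ℝ)} {u : ℝ → 𝓢(Space d, ℝ)}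
    (hu : IsSchwartzSolution f u) (s : ℝ) :
    IsGlobalSolution s (f.toLp 2 volume) (fun τ ↦ (u τ).toLp 2 volume) where
  initial := by rw [hu.initial]
  memSobolev t _ := by
    rw [toDist_toLp]
    exact SchwartzMap.memSobolev _
  continuous t ht := hu.tendsto_sobolevENorm s ht
  equation t ht := by
    refine ⟨fun i ↦ (partialDeriv i (u t)).toLp 2 volume, fun i ↦ ?_,
      fun ψ ↦ hu.hasDerivAt_toDist ht ψ⟩
    rw [toDist_toLp, toDist_toLp, TemperedDistribution.lineDerivOp_toTemperedDistributionCLM_eq,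
      lineDerivOp_cplx]

end Existence

/-! ### Weak limits of Riesz products and the limit of the solution. -/

section WeakLimit

variable {d : ℕ} {e : Space d}

/-- The Riemann–Lebesgue lemma along the ray spanned by `e`. -/
theorem tendsto_integral_mul_cos (he : ‖e‖ = 1) {g : Space d → ℝ} (hg : Integrable g) :
    Tendsto (fun μ : ℝ ↦ ∫ x, g x * Real.cos (μ * inner ℝ e x)) atTop (𝓝 0) := by
  have h1 : Tendsto (fun μ : ℝ ↦ (-(μ / (2 * Real.pi))) • e) atTop (cocompact (Space d)) := by
    rw [← Metric.cobounded_eq_cocompact, ← tendsto_norm_atTop_iff_cobounded]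
    have h2 : Tendsto (fun μ : ℝ ↦ μ / (2 * Real.pi)) atTop atTop :=
      tendsto_id.atTop_div_const (by positivity)
    refine (tendsto_abs_atTop_atTop.comp h2).congr fun μ ↦ ?_
    rw [norm_smul, he, mul_one, norm_neg]
    rfl
  have h3 := (tendsto_integral_exp_inner_smul_cocompact (V := Space d)
    (fun x ↦ (g x : ℂ))).comp h1
  have h4 := (Complex.continuous_re.tendsto 0).comp h3
  rw [Complex.zero_re] at h4
  refine h4.congr fun μ ↦ ?_
  simp only [Function.comp_apply]
  have h5 := (Real.fourierIntegral_convergent_iff (V := Space d) (μ := volume)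
    (f := fun x ↦ (g x : ℂ)) ((-(μ / (2 * Real.pi))) • e)).2 hg.ofReal
  rw [← RCLike.re_eq_complex_re, ← integral_re h5]
  refine integral_congr_ae (Eventually.of_forall fun x ↦ ?_)
  simp only [RCLike.re_eq_complex_re]
  rw [Circle.smul_def, smul_eq_mul, Complex.re_mul_ofReal, Real.fourierChar_apply,
    Complex.exp_ofReal_mul_I_re, mul_comm, inner_smul_right, real_inner_comm]
  congr 2
  have := Real.pi_pos
  field_simp

/-- The second order Taylor polynomial of the exponential function. -/
def expPoly (z : ℝ) : ℝ := 1 + z + z ^ 2 / 2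

theorem expPoly_mem_Icc {z : ℝ} (hz : |z| ≤ 1) : expPoly z ∈ Set.Icc (1 / 2) (5 / 2) := by
  obtain ⟨h1, h2⟩ := abs_le.1 hz
  unfold expPoly
  constructor <;> nlinarith [sq_nonneg (z + 1)]

/-- The error is put in multiplicative form so that it can be multiplied over many factors. The
Taylor remainder is at most `(2/9) |z|³` and the polynomial is at least `1/2`, so the relative error
is at most `(4/9) |z|³`. -/
theorem exp_mem_Icc_expPoly {z : ℝ} (hz : |z| ≤ 1) :
    Real.exp z ∈ Set.Icc (expPoly z * Real.exp (-|z| ^ 3)) (expPoly z * Real.exp (|z| ^ 3)) := by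
  have h := Real.exp_bound hz (n := 3) (by norm_num)
  have hp := (expPoly_mem_Icc hz).1
  have hs : ∑ m ∈ Finset.range 3, z ^ m / (m.factorial : ℝ) = expPoly z := by
    simp [Finset.sum_range_succ, expPoly, Nat.factorial]
  rw [hs] at h
  norm_num [Nat.factorial] at h
  set y := |z| ^ 3 with hy
  have hy0 : 0 ≤ y := by positivity
  have hy1 : y ≤ 1 := pow_le_one₀ (abs_nonneg z) hz
  obtain ⟨h1, h2⟩ := abs_le.1 h
  have h3 := Real.add_one_le_exp y
  have h4 : Real.exp (-y) ≤ 1 - y / 2 := by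
    rw [Real.exp_neg, inv_le_comm₀ (Real.exp_pos y) (by linarith)]
    refine le_trans ?_ h3
    rw [inv_le_iff_one_le_mul₀ (by linarith)]
    nlinarith
  constructor
  · nlinarith
  · nlinarith

/-- A Riesz product with lacunary frequencies. -/
def riesz (e : Space d) (B : Space d → ℝ) (μ : ℝ) (K : ℕ) (x : Space d) : ℝ :=
  ∏ k ∈ Finset.range K, expPoly (B x * Real.cos (8 ^ k * (μ * inner ℝ e x)))

theorem continuous_riesz {B : Space d → ℝ} (hB : Continuous B) (μ : ℝ) (K : ℕ) :
    Continuous (riesz e B μ K) := by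
  unfold riesz expPoly
  fun_prop

theorem abs_mul_cos_le_one {b : ℝ} (hb : |b| ≤ 1) (θ : ℝ) : |b * Real.cos θ| ≤ 1 := by
  rw [abs_mul]
  exact mul_le_one₀ hb (abs_nonneg _) (Real.abs_cos_le_one θ)

theorem riesz_mem_Icc {B : Space d → ℝ} (hB : ∀ x, |B x| ≤ 1) (μ : ℝ) (K : ℕ) (x : Space d) :
    riesz e B μ K x ∈ Set.Icc ((1 / 2) ^ K) ((5 / 2) ^ K) := by
  have h := fun k : ℕ ↦
    expPoly_mem_Icc (abs_mul_cos_le_one (hB x) (8 ^ k * (μ * inner ℝ e x)))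
  constructor
  · have := Finset.prod_le_prod (s := Finset.range K) (f := fun _ ↦ (1 / 2 : ℝ))
      (fun _ _ ↦ by norm_num) (fun k _ ↦ (h k).1)
    simpa [riesz] using this
  · have := Finset.prod_le_prod (s := Finset.range K) (g := fun _ ↦ (5 / 2 : ℝ))
      (fun k _ ↦ (by norm_num : (0 : ℝ) ≤ 1 / 2).trans (h k).1) (fun k _ ↦ (h k).2)
    rwa [Finset.prod_const, Finset.card_range] at this

theorem abs_riesz_le {B : Space d → ℝ} (hB : ∀ x, |B x| ≤ 1) (μ : ℝ) (K : ℕ) (x : Space d) :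
    |riesz e B μ K x| ≤ (5 / 2) ^ K := by
  obtain ⟨h1, h2⟩ := riesz_mem_Icc (e := e) hB μ K x
  rw [abs_of_nonneg (le_trans (by positivity) h1)]
  exact h2

theorem integrable_mul_riesz_mul_cos {B : Space d → ℝ} (hBc : Continuous B)
    (hB : ∀ x, |B x| ≤ 1) {g : Space d → ℝ} (hg : Integrable g) (μ ν : ℝ) (K : ℕ) :
    Integrable fun x ↦ g x * riesz e B μ K x * Real.cos (ν * (μ * inner ℝ e x)) := by
  simp_rw [mul_assoc]
  refine hg.mul_bdd (c := (5 / 2) ^ K) ?_ (Eventually.of_forall fun x ↦ ?_)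
  · have := continuous_riesz (e := e) hBc μ K
    exact Continuous.aestronglyMeasurable (by fun_prop)
  · rw [norm_mul, Real.norm_eq_abs, Real.norm_eq_abs]
    exact (mul_le_of_le_one_right (abs_nonneg _) (Real.abs_cos_le_one _)).trans
      (abs_riesz_le hB μ K x)

theorem integrable_mul_riesz {B : Space d → ℝ} (hBc : Continuous B)
    (hB : ∀ x, |B x| ≤ 1) {g : Space d → ℝ} (hg : Integrable g) (μ : ℝ) (K : ℕ) :
    Integrable fun x ↦ g x * riesz e B μ K x := by
  simpa using integrable_mul_riesz_mul_cos (e := e) hBc hB hg μ 0 K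

/-- Weak limits of Riesz products with lacunary frequencies. -/
theorem tendsto_integral_mul_riesz (he : ‖e‖ = 1) {B : Space d → ℝ} (hBc : Continuous B)
    (hB : ∀ x, |B x| ≤ 1) (K : ℕ) : ∀ {g : Space d → ℝ}, Integrable g →
    Tendsto (fun μ ↦ ∫ x, g x * riesz e B μ K x) atTop (𝓝 (∫ x, g x * (1 + B x ^ 2 / 4) ^ K)) ∧
      ∀ m : ℕ, 8 ^ K ≤ m → Tendsto
        (fun μ ↦ ∫ x, g x * riesz e B μ K x * Real.cos (m * (μ * inner ℝ e x))) atTop (𝓝 0) := by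
  induction K with
  | zero =>
    intro g hg
    refine ⟨by simp [riesz], fun m hm ↦ ?_⟩
    have hm' : (0 : ℝ) < m := by
      have : 1 ≤ m := by simpa using hm
      exact_mod_cast this
    refine ((tendsto_integral_mul_cos he hg).comp
      (tendsto_id.const_mul_atTop hm')).congr fun μ ↦ ?_
    simp [riesz, mul_assoc]
  | succ K ih =>
    intro g hg
    have hgB : Integrable fun x ↦ g x * B x :=
      hg.mul_bdd (c := 1) hBc.aestronglyMeasurable (Eventually.of_forall hB)
    have hB2 : ∀ x, |B x ^ 2 / 4| ≤ 1 := fun x ↦ by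
      have := hB x
      rw [abs_le_one_iff_mul_self_le_one, ← sq] at this
      rw [abs_of_nonneg (by positivity)]
      linarith
    have hgB2 : Integrable fun x ↦ g x * (B x ^ 2 / 4) :=
      hg.mul_bdd (c := 1) (by fun_prop) (Eventually.of_forall hB2)
    have hgE : Integrable fun x ↦ g x * (1 + B x ^ 2 / 4) := by
      simp_rw [mul_add, mul_one]
      exact hg.add hgB2
    -- The new factor is expanded by `cos² θ = (1 + cos 2θ) / 2`; its mean is `1 + B²/4`, and the
    -- frequencies `8^K` and `2 * 8^K` remain.
    have hsucc : ∀ μ x, riesz e B μ (K + 1) x = riesz e B μ K x * ((1 + B x ^ 2 / 4) +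
        B x * Real.cos ((8 ^ K : ℕ) * (μ * inner ℝ e x)) +
        B x ^ 2 / 4 * Real.cos ((2 * 8 ^ K : ℕ) * (μ * inner ℝ e x))) := by
      intro μ x
      rw [riesz, Finset.prod_range_succ, ← riesz, expPoly]
      push_cast
      rw [show 2 * 8 ^ K * (μ * inner ℝ e x) = 2 * (8 ^ K * (μ * inner ℝ e x)) by ring,
        Real.cos_two_mul]
      ring
    constructor
    · have h1 := (ih hgE).1
      have h2 := (ih hgB).2 (8 ^ K) le_rfl
      have h3 := (ih hgB2).2 (2 * 8 ^ K) (by omega)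
      have h4 := (h1.add h2).add h3
      rw [add_zero, add_zero] at h4
      have h5 : ∫ x, g x * (1 + B x ^ 2 / 4) ^ (K + 1) =
          ∫ x, g x * (1 + B x ^ 2 / 4) * (1 + B x ^ 2 / 4) ^ K := by
        refine integral_congr_ae (Eventually.of_forall fun x ↦ ?_)
        simp only
        ring
      rw [h5]
      refine h4.congr fun μ ↦ ?_
      rw [← integral_add, ← integral_add]
      · refine integral_congr_ae (Eventually.of_forall fun x ↦ ?_)
        simp only [hsucc]
        ring
      · exact (integrable_mul_riesz hBc hB hgE μ K).add
          (integrable_mul_riesz_mul_cos hBc hB hgB μ _ K)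
      · exact integrable_mul_riesz_mul_cos hBc hB hgB2 μ _ K
      · exact integrable_mul_riesz hBc hB hgE μ K
      · exact integrable_mul_riesz_mul_cos hBc hB hgB μ _ K
    · intro m hm
      rw [pow_succ] at hm
      have h1 := (ih hgE).2 m (by omega)
      -- Products of cosines produce the frequencies `m ± 8^K` and `m ± 2 * 8^K`. From `m ≥ 8^(K+1)`
      -- they are all at least `8^K`, as the induction hypothesis requires.
      have h2 := (ih (hgB.div_const 2)).2 (m - 8 ^ K) (by omega)
      have h3 := (ih (hgB.div_const 2)).2 (m + 8 ^ K) (by omega)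
      have h4 := (ih (hgB2.div_const 2)).2 (m - 2 * 8 ^ K) (by omega)
      have h5 := (ih (hgB2.div_const 2)).2 (m + 2 * 8 ^ K) (by omega)
      have h6 := (((h1.add h2).add h3).add h4).add h5
      simp only [add_zero] at h6
      refine h6.congr fun μ ↦ ?_
      have i1 := integrable_mul_riesz_mul_cos (e := e) hBc hB hgE μ m K
      have i2 := integrable_mul_riesz_mul_cos (e := e) hBc hB (hgB.div_const 2) μ
        ((m - 8 ^ K : ℕ) : ℝ) K
      have i3 := integrable_mul_riesz_mul_cos (e := e) hBc hB (hgB.div_const 2) μ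
        ((m + 8 ^ K : ℕ) : ℝ) K
      have i4 := integrable_mul_riesz_mul_cos (e := e) hBc hB (hgB2.div_const 2) μ
        ((m - 2 * 8 ^ K : ℕ) : ℝ) K
      have i5 := integrable_mul_riesz_mul_cos (e := e) hBc hB (hgB2.div_const 2) μ
        ((m + 2 * 8 ^ K : ℕ) : ℝ) K
      rw [← integral_add' i1 i2, ← integral_add' (i1.add i2) i3,
        ← integral_add' ((i1.add i2).add i3) i4, ← integral_add' (((i1.add i2).add i3).add i4) i5]
      refine integral_congr_ae (Eventually.of_forall fun x ↦ ?_)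
      simp only [hsucc, Pi.add_apply]
      have c1 : ∀ a : ℕ, a ≤ m →
          Real.cos (((m - a : ℕ) : ℝ) * (μ * inner ℝ e x)) +
            Real.cos (((m + a : ℕ) : ℝ) * (μ * inner ℝ e x)) =
          2 * Real.cos (m * (μ * inner ℝ e x)) * Real.cos (a * (μ * inner ℝ e x)) := by
        intro a ha
        push_cast [Nat.cast_sub ha]
        rw [sub_mul, add_mul, Real.cos_sub, Real.cos_add]
        ring
      have c2 := c1 (8 ^ K) (by omega)
      have c3 := c1 (2 * 8 ^ K) (by omega)
      linear_combination (g x * B x / 2 * riesz e B μ K x) * c2 +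
        (g x * (B x ^ 2 / 4) / 2 * riesz e B μ K x) * c3

/-- For positive time the average is a pairing with a fixed integrable density, so weak convergence
becomes pointwise convergence after the heat flow. -/
theorem heatAvg_eq_integral {t : ℝ} (ht : 0 < t) (x : Space d) :
    ∃ g : Space d → ℝ, Integrable g ∧ ∀ F : Space d → ℝ, heatAvg t F x = ∫ z, g z * F z := by
  have hs : 0 < √t := Real.sqrt_pos.2 ht
  have hinv : ∀ y : Space d, (√t)⁻¹ • (x - (x - √t • y)) = y := fun y ↦ by
    rw [sub_sub_cancel, smul_smul, inv_mul_cancel₀ hs.ne', one_smul]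
  refine ⟨fun z ↦ |(√t ^ d)⁻¹| * gaussian d ((√t)⁻¹ • (x - z)), ?_, fun F ↦ ?_⟩
  · refine Integrable.const_mul ?_ _
    have h1 : Integrable fun z : Space d ↦ gaussian d ((√t)⁻¹ • z) :=
      integrable_gaussian.comp_smul (inv_pos.2 hs).ne'
    exact h1.comp_sub_left x
  · have h1 := Measure.integral_comp_smul (volume : Measure (Space d))
      (fun y ↦ gaussian d ((√t)⁻¹ • (x - (x - y))) * F (x - y)) √t
    simp only [hinv] at h1
    rw [heatAvg, h1, integral_sub_left_eq_self
      (fun z ↦ gaussian d ((√t)⁻¹ • (x - z)) * F z) volume x, finrank_euclideanSpace_fin,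
      smul_eq_mul, ← integral_const_mul]
    simp only [mul_assoc]

theorem tendsto_heatAvg_riesz (he : ‖e‖ = 1) {B : Space d → ℝ} (hBc : Continuous B)
    (hB : ∀ x, |B x| ≤ 1) (K : ℕ) {t : ℝ} (ht : 0 < t) (x : Space d) :
    Tendsto (fun μ ↦ heatAvg t (riesz e B μ K) x) atTop
      (𝓝 (heatAvg t (fun z ↦ (1 + B z ^ 2 / 4) ^ K) x)) := by
  obtain ⟨g, hg, hgF⟩ := heatAvg_eq_integral ht x
  simp only [hgF]
  exact (tendsto_integral_mul_riesz he hBc hB K hg).1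

theorem abs_log_le {m M w : ℝ} (hm : 0 < m) (hw : w ∈ Set.Icc m M) :
    |Real.log w| ≤ |Real.log m| + |Real.log M| := by
  have h1 := Real.log_le_log hm hw.1
  have h2 := Real.log_le_log (hm.trans_le hw.1) hw.2
  rw [abs_le]
  constructor
  · linarith [neg_abs_le (Real.log m), abs_nonneg (Real.log M)]
  · linarith [le_abs_self (Real.log M), abs_nonneg (Real.log m)]

theorem integrable_mul_log {w ψ : Space d → ℝ} (hw : Continuous w) {m M : ℝ} (hm : 0 < m)
    (hwm : ∀ x, w x ∈ Set.Icc m M) (hψ : Integrable ψ) :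
    Integrable fun x ↦ ψ x * Real.log (w x) :=
  hψ.mul_bdd (c := |Real.log m| + |Real.log M|)
    (hw.log fun x ↦ (hm.trans_le (hwm x).1).ne').aestronglyMeasurable
    (Eventually.of_forall fun x ↦ abs_log_le hm (hwm x))

theorem tendsto_integral_mul_log {ι : Type*} {l : Filter ι} [l.IsCountablyGenerated]
    {w : ι → Space d → ℝ} {w₀ ψ : Space d → ℝ} (hw : ∀ i, Continuous (w i)) {m M : ℝ} (hm : 0 < m)
    (hwm : ∀ i x, w i x ∈ Set.Icc m M) (hw₀ : ∀ x, w₀ x ≠ 0)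
    (hlim : ∀ x, Tendsto (fun i ↦ w i x) l (𝓝 (w₀ x))) (hψ : Integrable ψ) :
    Tendsto (fun i ↦ ∫ x, ψ x * Real.log (w i x)) l (𝓝 (∫ x, ψ x * Real.log (w₀ x))) := by
  refine tendsto_integral_filter_of_dominated_convergence
    (fun x ↦ ‖ψ x‖ * (|Real.log m| + |Real.log M|))
    (Eventually.of_forall fun i ↦ (integrable_mul_log (hw i) hm (hwm i) hψ).1)
    (Eventually.of_forall fun i ↦ Eventually.of_forall fun x ↦ ?_) (hψ.norm.mul_const _)
    (Eventually.of_forall fun x ↦ ((hlim x).log (hw₀ x)).const_mul _)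
  rw [norm_mul]
  exact mul_le_mul_of_nonneg_left (abs_log_le hm (hwm i x)) (norm_nonneg _)

theorem one_add_sq_pow_mem_Icc {b : ℝ} (hb : |b| ≤ 1) (K : ℕ) :
    (1 + b ^ 2 / 4) ^ K ∈ Set.Icc ((1 / 2) ^ K) ((5 / 2) ^ K) := by
  have h1 : b ^ 2 ≤ 1 := (sq_le_one_iff_abs_le_one b).2 hb
  have h2 := sq_nonneg b
  constructor
  · gcongr
    linarith
  · gcongr
    linarith

/-- The order of the limits matters: `μ → ∞` at fixed `t` replaces the Riesz product by `(1 +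
B²/4)^K`, and `t → 0` then removes the heat flow. So `t` is chosen before `μ`. The logarithm turns
the power `K` into a factor. -/
theorem eventually_abs_integral_log_heatAvg_riesz_sub_lt (he : ‖e‖ = 1) {B : Space d → ℝ}
    (hBc : Continuous B) (hB : ∀ x, |B x| ≤ 1) (K : ℕ) {ψ : Space d → ℝ} (hψ : Integrable ψ)
    {ε : ℝ} (hε : 0 < ε) :
    ∀ᶠ t in 𝓝[>] (0 : ℝ), ∀ᶠ μ in atTop,
      |(∫ x, ψ x * Real.log (heatAvg t (riesz e B μ K) x)) -
        K * ∫ x, ψ x * Real.log (1 + B x ^ 2 / 4)| < ε := by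
  have hm : (0 : ℝ) < (1 / 2) ^ K := by positivity
  set E : Space d → ℝ := fun z ↦ (1 + B z ^ 2 / 4) ^ K with hE
  have hEc : Continuous E := by fun_prop
  have hEm : ∀ x, E x ∈ Set.Icc ((1 / 2) ^ K) ((5 / 2) ^ K) := fun x ↦
    one_add_sq_pow_mem_Icc (hB x) K
  have hEb : ∀ x, |E x| ≤ (5 / 2) ^ K := fun x ↦ by
    rw [abs_of_nonneg (hm.le.trans (hEm x).1)]
    exact (hEm x).2
  have hlim1 : Tendsto (fun t ↦ ∫ x, ψ x * Real.log (heatAvg t E x)) (𝓝[>] 0)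
      (𝓝 (∫ x, ψ x * Real.log (E x))) := by
    refine tendsto_integral_mul_log (fun t ↦ continuous_heatAvg hEc hEb t) hm
      (fun t x ↦ heatAvg_mem_Icc hEc hEm t x) (fun x ↦ (hm.trans_le (hEm x).1).ne')
      (fun x ↦ ?_) hψ
    have h1 := (continuous_heatAvg_time hEc hEb x).tendsto 0
    rw [heatAvg_zero] at h1
    exact h1.mono_left nhdsWithin_le_nhds
  have hEK : ∫ x, ψ x * Real.log (E x) = K * ∫ x, ψ x * Real.log (1 + B x ^ 2 / 4) := by
    rw [← integral_const_mul]
    refine integral_congr_ae (Eventually.of_forall fun x ↦ ?_)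
    simp only [hE, Real.log_pow]
    ring
  rw [hEK] at hlim1
  filter_upwards [(tendsto_order.1 (tendsto_iff_dist_tendsto_zero.1 hlim1)).2 ε hε,
    self_mem_nhdsWithin] with t ht1 ht
  have hlim2 : Tendsto (fun μ ↦ ∫ x, ψ x * Real.log (heatAvg t (riesz e B μ K) x)) atTop
      (𝓝 (∫ x, ψ x * Real.log (heatAvg t E x))) :=
    tendsto_integral_mul_log
      (fun μ ↦ continuous_heatAvg (continuous_riesz hBc μ K) (abs_riesz_le hB μ K) t) hm
      (fun μ x ↦ heatAvg_mem_Icc (continuous_riesz hBc μ K) (riesz_mem_Icc hB μ K) t x)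
      (fun x ↦ (hm.trans_le (heatAvg_mem_Icc hEc hEm t x).1).ne')
      (fun x ↦ tendsto_heatAvg_riesz he hBc hB K ht x) hψ
  have hlim3 := hlim2.sub_const (K * ∫ x, ψ x * Real.log (1 + B x ^ 2 / 4))
  exact (tendsto_order.1 hlim3.abs).2 ε ht1

theorem exp_sum_mem_Icc_riesz {B : Space d → ℝ} {b : ℝ} (hb : b ≤ 1) (hB : ∀ x, |B x| ≤ b)
    (μ : ℝ) (K : ℕ) (x : Space d) :
    Real.exp (∑ k ∈ Finset.range K, B x * Real.cos (8 ^ k * (μ * inner ℝ e x))) ∈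
      Set.Icc (Real.exp (-(K * b ^ 3)) * riesz e B μ K x)
        (Real.exp (K * b ^ 3) * riesz e B μ K x) := by
  have hz : ∀ k : ℕ, |B x * Real.cos (8 ^ k * (μ * inner ℝ e x))| ≤ b := fun k ↦ by
    rw [abs_mul]
    exact (mul_le_of_le_one_right (abs_nonneg _) (Real.abs_cos_le_one _)).trans (hB x)
  have hf : ∀ k : ℕ, Real.exp (B x * Real.cos (8 ^ k * (μ * inner ℝ e x))) ∈
      Set.Icc (Real.exp (-b ^ 3) * expPoly (B x * Real.cos (8 ^ k * (μ * inner ℝ e x))))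
        (Real.exp (b ^ 3) * expPoly (B x * Real.cos (8 ^ k * (μ * inner ℝ e x)))) := fun k ↦ by
    have h1 := exp_mem_Icc_expPoly ((hz k).trans hb)
    have h2 := (expPoly_mem_Icc ((hz k).trans hb)).1
    have h3 := pow_le_pow_left₀ (abs_nonneg _) (hz k) 3
    constructor
    · refine le_trans ?_ h1.1
      rw [mul_comm]
      gcongr
    · refine h1.2.trans ?_
      rw [mul_comm]
      gcongr
  have hp : ∀ k : ℕ, 0 ≤ expPoly (B x * Real.cos (8 ^ k * (μ * inner ℝ e x))) := fun k ↦
    le_trans (by norm_num) (expPoly_mem_Icc ((hz k).trans hb)).1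
  have hexp : ∀ r : ℝ, Real.exp (K * r) = ∏ _k ∈ Finset.range K, Real.exp r := fun r ↦ by
    rw [Finset.prod_const, Finset.card_range, ← Real.exp_nat_mul]
  rw [Real.exp_sum, riesz, ← mul_neg, hexp, hexp, ← Finset.prod_mul_distrib,
    ← Finset.prod_mul_distrib]
  exact ⟨Finset.prod_le_prod (fun k _ ↦ mul_nonneg (Real.exp_pos _).le (hp k)) fun k _ ↦ (hf k).1,
    Finset.prod_le_prod (fun k _ ↦ (Real.exp_pos _).le) fun k _ ↦ (hf k).2⟩

/-- The heat average is monotone and homogeneous, so the multiplicative error `e^{±K b³}` passes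
through it, and the logarithm makes it additive. The bound does not depend on `t` or `μ`. -/
theorem abs_log_heatAvg_exp_sub_le {B : Space d → ℝ} (hBc : Continuous B) {b : ℝ} (hb : b ≤ 1)
    (hB : ∀ x, |B x| ≤ b) (μ : ℝ) (K : ℕ) {f : Space d → ℝ}
    (hf : ∀ x, f x = ∑ k ∈ Finset.range K, B x * Real.cos (8 ^ k * (μ * inner ℝ e x)))
    (t : ℝ) (x : Space d) :
    |Real.log (heatAvg t (fun z ↦ Real.exp (f z)) x) - Real.log (heatAvg t (riesz e B μ K) x)| ≤
      K * b ^ 3 := by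
  have hB1 : ∀ x, |B x| ≤ 1 := fun x ↦ (hB x).trans hb
  have hfc : Continuous f := by
    rw [show f = _ from funext hf]
    fun_prop
  have hr := riesz_mem_Icc (e := e) hB1 μ K
  have hrc := continuous_riesz (e := e) hBc μ K
  have hm : (0 : ℝ) < (1 / 2) ^ K := by positivity
  have hfr := exp_sum_mem_Icc_riesz (e := e) hb hB μ K
  simp only [← hf] at hfr
  set η : ℝ := K * b ^ 3 with hη
  have hη0 : 0 ≤ η := by
    have : 0 ≤ b := (abs_nonneg _).trans (hB 0)
    positivity
  have hexp1 : Real.exp (-η) ≤ Real.exp η := Real.exp_le_exp.2 (by linarith)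
  have hpos : ∀ z, 0 ≤ riesz e B μ K z := fun z ↦ hm.le.trans (hr z).1
  have hbd : ∀ r : ℝ, r ≤ η → ∀ z, |Real.exp r * riesz e B μ K z| ≤ Real.exp η * (5 / 2) ^ K := by
    intro r hr' z
    rw [abs_of_nonneg (mul_nonneg (Real.exp_pos _).le (hpos z))]
    exact mul_le_mul (Real.exp_le_exp.2 hr') (hr z).2 (hpos z) (Real.exp_pos _).le
  have hbf : ∀ z, |Real.exp (f z)| ≤ Real.exp η * (5 / 2) ^ K := fun z ↦ by
    rw [abs_of_pos (Real.exp_pos _)]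
    exact (hfr z).2.trans ((le_abs_self _).trans (hbd η le_rfl z))
  have h1 := heatAvg_mono (F := fun z ↦ Real.exp (-η) * riesz e B μ K z)
    (G := fun z ↦ Real.exp (f z)) (continuous_const.mul hrc) (Real.continuous_exp.comp hfc)
    (hbd (-η) (by linarith)) hbf (fun z ↦ (hfr z).1) t x
  have h2 := heatAvg_mono (F := fun z ↦ Real.exp (f z))
    (G := fun z ↦ Real.exp η * riesz e B μ K z) (Real.continuous_exp.comp hfc)
    (continuous_const.mul hrc) hbf
    (hbd η le_rfl) (fun z ↦ (hfr z).2) t x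
  rw [heatAvg_const_mul] at h1 h2
  have hW := heatAvg_mem_Icc hrc hr t x
  have hW0 : 0 < heatAvg t (riesz e B μ K) x := hm.trans_le hW.1
  have h3 := Real.log_le_log (by positivity) h1
  have h4 := Real.log_le_log (lt_of_lt_of_le (by positivity) h1) h2
  rw [Real.log_mul (Real.exp_pos _).ne' hW0.ne', Real.log_exp] at h3 h4
  rw [abs_le]
  constructor <;> linarith

end WeakLimit

/-! ### Band-limited functions, modulation and translation. -/

section Envelope

variable {d : ℕ}

/-- The Fourier transform of `g` is supported in the angular frequencies of size at most `R`. -/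
def Bandlimited (R : ℝ) (g : 𝓢(Space d, ℂ)) : Prop :=
  ∀ ξ, (𝓕 g : 𝓢(Space d, ℂ)) ξ ≠ 0 → 2 * Real.pi * ‖ξ‖ ≤ R

theorem Bandlimited.mono {R R' : ℝ} (h : R ≤ R') {g : 𝓢(Space d, ℂ)} (hg : Bandlimited R g) :
    Bandlimited R' g := fun ξ hξ ↦ (hg ξ hξ).trans h

theorem Bandlimited.sum {ι : Type*} {R : ℝ} {S : Finset ι} {g : ι → 𝓢(Space d, ℂ)}
    (hg : ∀ i ∈ S, Bandlimited R (g i)) : Bandlimited R (∑ i ∈ S, g i) := by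
  intro ξ hξ
  by_contra h
  apply hξ
  have h1 : (𝓕 (∑ i ∈ S, g i) : 𝓢(Space d, ℂ)) = ∑ i ∈ S, 𝓕 (g i) :=
    map_sum (fourierCLM ℂ 𝓢(Space d, ℂ)) _ _
  rw [h1, sum_apply]
  refine Finset.sum_eq_zero fun i hi ↦ ?_
  by_contra h2
  exact h (hg i hi ξ h2)

theorem fourier_apply_eq_integral (g : 𝓢(Space d, ℂ)) (ξ : Space d) :
    (𝓕 g : 𝓢(Space d, ℂ)) ξ = ∫ x, Real.fourierChar (-inner ℝ x ξ) • g x := by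
  rw [SchwartzMap.fourier_coe, Real.fourier_eq]

theorem fourier_compSubConst (g : 𝓢(Space d, ℂ)) (a ξ : Space d) :
    (𝓕 (SchwartzMap.compSubConstCLM ℂ a g) : 𝓢(Space d, ℂ)) ξ =
      Real.fourierChar (-inner ℝ a ξ) • (𝓕 g : 𝓢(Space d, ℂ)) ξ := by
  rw [fourier_apply_eq_integral, fourier_apply_eq_integral,
    ← integral_add_right_eq_self _ a, Circle.smul_def, ← integral_smul]
  refine integral_congr_ae (Eventually.of_forall fun x ↦ ?_)
  simp only [SchwartzMap.compSubConstCLM_apply, add_sub_cancel_right]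
  rw [inner_add_left, neg_add, AddChar.map_add_eq_mul]
  simp only [Circle.smul_def, Circle.coe_mul, smul_eq_mul]
  ring

/-- The translate of a real Schwartz function. -/
def translate (a : Space d) (g : 𝓢(Space d, ℝ)) : 𝓢(Space d, ℝ) := SchwartzMap.compSubConstCLM ℝ a g

@[simp]
theorem translate_apply (a : Space d) (g : 𝓢(Space d, ℝ)) (x : Space d) :
    translate a g x = g (x - a) := rfl

theorem fourier_translate_ne_zero {a ξ : Space d} {g : 𝓢(Space d, ℝ)}
    (h : (𝓕 (cplx (translate a g)) : 𝓢(Space d, ℂ)) ξ ≠ 0) :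
    (𝓕 (cplx g) : 𝓢(Space d, ℂ)) ξ ≠ 0 := by
  have h1 : cplx (translate a g) = SchwartzMap.compSubConstCLM ℂ a (cplx g) := by
    ext x
    rfl
  rw [h1, fourier_compSubConst] at h
  intro h2
  rw [h2, smul_zero] at h
  exact h rfl

theorem hasTemperateGrowth_cos_inner (μ : ℝ) (e : Space d) :
    (fun x : Space d ↦ Real.cos (μ * inner ℝ e x)).HasTemperateGrowth := by
  have h1 : Real.cos.HasTemperateGrowth := by
    refine ⟨Real.contDiff_cos, fun n ↦ ⟨0, 1, fun x ↦ ?_⟩⟩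
    rw [norm_iteratedFDeriv_eq_norm_iteratedDeriv, pow_zero, mul_one]
    exact Real.abs_iteratedDeriv_cos_le_one n x
  exact h1.comp (f := fun x : Space d ↦ μ * inner ℝ e x) (by fun_prop)

/-- The modulation of a real Schwartz function by a plane wave. -/
def cosMod (e : Space d) (μ : ℝ) (g : 𝓢(Space d, ℝ)) : 𝓢(Space d, ℝ) :=
  SchwartzMap.smulLeftCLM ℝ (fun x : Space d ↦ Real.cos (μ * inner ℝ e x)) g

@[simp]
theorem cosMod_apply (e : Space d) (μ : ℝ) (g : 𝓢(Space d, ℝ)) (x : Space d) :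
    cosMod e μ g x = Real.cos (μ * inner ℝ e x) * g x :=
  SchwartzMap.smulLeftCLM_apply_apply (hasTemperateGrowth_cos_inner μ e) g x

theorem fourier_cosMod (e : Space d) (μ : ℝ) (g : 𝓢(Space d, ℝ)) (ξ : Space d) :
    (𝓕 (cplx (cosMod e μ g)) : 𝓢(Space d, ℂ)) ξ =
      ((𝓕 (cplx g) : 𝓢(Space d, ℂ)) (ξ - (μ / (2 * Real.pi)) • e) +
        (𝓕 (cplx g) : 𝓢(Space d, ℂ)) (ξ + (μ / (2 * Real.pi)) • e)) / 2 := by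
  have hinteg : ∀ η : Space d, Integrable fun x ↦ Real.fourierChar (-inner ℝ x η) • cplx g x :=
    fun η ↦ (Real.fourierIntegral_convergent_iff η).2 (cplx g).integrable
  rw [fourier_apply_eq_integral, fourier_apply_eq_integral, fourier_apply_eq_integral,
    ← integral_add (hinteg _) (hinteg _), ← integral_div]
  refine integral_congr_ae (Eventually.of_forall fun x ↦ ?_)
  simp only [cplx_apply, cosMod_apply]
  rw [inner_sub_right, inner_add_right, neg_sub, sub_eq_add_neg, neg_add, AddChar.map_add_eq_mul,
    AddChar.map_add_eq_mul, inner_smul_right]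
  have hcos : (Real.cos (μ * inner ℝ e x) : ℂ) =
      ((Real.fourierChar (μ / (2 * Real.pi) * inner ℝ x e) : ℂ) +
        (Real.fourierChar (-(μ / (2 * Real.pi) * inner ℝ x e)) : ℂ)) / 2 := by
    rw [Complex.ofReal_cos, Complex.cos, Real.fourierChar_apply, Real.fourierChar_apply,
      real_inner_comm]
    have hp : (2 * Real.pi * (μ / (2 * Real.pi) * inner ℝ x e)) = μ * inner ℝ x e := by
      have := Real.pi_pos
      field_simp
    rw [mul_neg, hp]
    push_cast
    ring_nf
  simp only [Circle.smul_def, Circle.coe_mul, smul_eq_mul, Complex.ofReal_mul, hcos]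
  ring

/-- Modulation moves the spectrum by two opposite vectors of angular length `μ`; the triangle
inequality does the rest. -/
theorem abs_sub_le_of_fourier_cosMod_ne_zero {e : Space d} (he : ‖e‖ = 1) {μ : ℝ} (hμ : 0 ≤ μ)
    {g : 𝓢(Space d, ℝ)} {R : ℝ} (hg : Bandlimited R (cplx g)) {ξ : Space d}
    (hξ : (𝓕 (cplx (cosMod e μ g)) : 𝓢(Space d, ℂ)) ξ ≠ 0) : |2 * Real.pi * ‖ξ‖ - μ| ≤ R := by
  have hp := Real.pi_pos
  have hn : 2 * Real.pi * ‖(μ / (2 * Real.pi)) • e‖ = μ := by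
    rw [norm_smul, he, mul_one, Real.norm_of_nonneg (by positivity)]
    field_simp
  rw [fourier_cosMod] at hξ
  have h : (𝓕 (cplx g) : 𝓢(Space d, ℂ)) (ξ - (μ / (2 * Real.pi)) • e) ≠ 0 ∨
      (𝓕 (cplx g) : 𝓢(Space d, ℂ)) (ξ + (μ / (2 * Real.pi)) • e) ≠ 0 := by
    by_contra! h
    rw [h.1, h.2] at hξ
    simp at hξ
  have h2 : |2 * Real.pi * ‖ξ‖ - μ| =
      2 * Real.pi * |‖ξ‖ - ‖(μ / (2 * Real.pi)) • e‖| := by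
    rw [← abs_of_pos (by positivity : 0 < 2 * Real.pi), ← abs_mul, mul_sub,
      abs_of_pos (by positivity : 0 < 2 * Real.pi), hn]
  rw [h2]
  rcases h with h | h
  · refine le_trans ?_ (hg _ h)
    gcongr
    exact abs_norm_sub_norm_le _ _
  · refine le_trans ?_ (hg _ h)
    gcongr
    have := abs_norm_sub_norm_le ξ (-((μ / (2 * Real.pi)) • e))
    rwa [norm_neg, sub_neg_eq_add] at this

theorem Bandlimited.cosMod {e : Space d} (he : ‖e‖ = 1) {μ : ℝ} (hμ : 0 ≤ μ)
    {g : 𝓢(Space d, ℝ)} {R : ℝ} (hg : Bandlimited R (cplx g)) :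
    Bandlimited (R + μ) (cplx (cosMod e μ g)) := fun ξ hξ ↦ by
  have := (abs_le.1 (abs_sub_le_of_fourier_cosMod_ne_zero he hμ hg hξ)).2
  linarith

/-- The number `17/12` is the midpoint of `[4/3, 3/2]`, and `1/12` is half the length of that
interval. -/
theorem Bandlimited.annulusSupported_cosMod {e : Space d} (he : ‖e‖ = 1)
    {g : 𝓢(Space d, ℝ)} {R : ℝ} (hg : Bandlimited R (cplx g)) {m : ℕ} (hR : R ≤ 2 ^ m / 12) :
    AnnulusSupported m (cplx (HamiltonJacobi.cosMod e (17 / 12 * 2 ^ m) g)) := fun ξ hξ ↦ by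
  have := abs_le.1 (abs_sub_le_of_fourier_cosMod_ne_zero he (by positivity) hg hξ)
  constructor <;> linarith

theorem AnnulusSupported.translate {m : ℕ} {g : 𝓢(Space d, ℝ)} (hg : AnnulusSupported m (cplx g))
    (a : Space d) : AnnulusSupported m (cplx (translate a g)) := fun ξ hξ ↦
  hg ξ (fourier_translate_ne_zero hξ)

theorem Bandlimited.translate {R : ℝ} {g : 𝓢(Space d, ℝ)} (hg : Bandlimited R (cplx g))
    (a : Space d) : Bandlimited R (cplx (translate a g)) := fun ξ hξ ↦
  hg ξ (fourier_translate_ne_zero hξ)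

theorem exists_schwartz_bump {r : ℝ} (hr : 0 < r) : ∃ b : 𝓢(Space d, ℝ),
    (∀ ξ, 0 ≤ b ξ) ∧ b 0 = 1 ∧ ∀ ξ, b ξ ≠ 0 → ‖ξ‖ < r := by
  let b : ContDiffBump (0 : Space d) := ⟨r / 2, r, by positivity, by linarith⟩
  refine ⟨b.hasCompactSupport.toSchwartzMap b.contDiff, fun ξ ↦ b.nonneg, ?_, fun ξ hξ ↦ ?_⟩
  · exact b.one_of_mem_closedBall (by simp; positivity)
  · have h1 : ξ ∈ Function.support b := hξ
    rw [b.support_eq] at h1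
    simpa [b] using h1

/-- The real part of the inverse Fourier transform of a real function. -/
def reFourierInv (b : 𝓢(Space d, ℝ)) : 𝓢(Space d, ℝ) :=
  SchwartzMap.postcompCLM Complex.reCLM (𝓕⁻ (cplx b) : 𝓢(Space d, ℂ))

theorem reFourierInv_apply (b : 𝓢(Space d, ℝ)) (x : Space d) :
    reFourierInv b x = ((𝓕⁻ (cplx b) : 𝓢(Space d, ℂ)) x).re := rfl

/-- Taking the real part adds the reflected conjugate spectrum, and a ball about the origin is
symmetric. -/
theorem bandlimited_reFourierInv {b : 𝓢(Space d, ℝ)} {r : ℝ} (hb : ∀ ξ, b ξ ≠ 0 → ‖ξ‖ < r) :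
    Bandlimited (2 * Real.pi * r) (cplx (reFourierInv b)) := by
  intro ξ hξ
  set g : 𝓢(Space d, ℂ) := 𝓕⁻ (cplx b) with hg
  have hFg : (𝓕 g : 𝓢(Space d, ℂ)) = cplx b := by rw [hg, fourier_fourierInv_eq]
  have hinteg : ∀ η : Space d, Integrable fun x ↦ Real.fourierChar (-inner ℝ x η) • g x :=
    fun η ↦ (Real.fourierIntegral_convergent_iff η).2 g.integrable
  have h1 : (𝓕 (cplx (reFourierInv b)) : 𝓢(Space d, ℂ)) ξ =
      ((𝓕 g : 𝓢(Space d, ℂ)) ξ + (starRingEnd ℂ) ((𝓕 g : 𝓢(Space d, ℂ)) (-ξ))) / 2 := by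
    rw [fourier_apply_eq_integral, fourier_apply_eq_integral, fourier_apply_eq_integral,
      ← integral_conj, ← integral_add (hinteg _), ← integral_div]
    · refine integral_congr_ae (Eventually.of_forall fun x ↦ ?_)
      simp only [cplx_apply, reFourierInv_apply, ← hg, Circle.smul_def, smul_eq_mul, map_mul]
      rw [Complex.re_eq_add_conj, inner_neg_right, neg_neg, ← Circle.coe_inv_eq_conj,
        ← AddChar.map_neg_eq_inv]
      ring
    · exact (RCLike.conjCLE (K := ℂ)).toContinuousLinearMap.integrable_comp (hinteg (-ξ))
  rw [h1, hFg, cplx_apply, cplx_apply] at hξ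
  have h2 : ‖ξ‖ < r := by
    by_contra h
    have h3 : b ξ = 0 := by
      by_contra h4
      exact h (hb ξ h4)
    have h5 : b (-ξ) = 0 := by
      by_contra h4
      have := hb _ h4
      rw [norm_neg] at this
      exact h this
    simp [h3, h5] at hξ
  have := Real.pi_pos
  gcongr

theorem integral_pos_of_continuous {g : Space d → ℝ} (hg : Continuous g) (hi : Integrable g)
    (h0 : ∀ x, 0 ≤ g x) (h1 : 0 < g 0) : 0 < ∫ x, g x := by
  rw [integral_pos_iff_support_of_nonneg h0 hi]
  exact hg.isOpen_support.measure_pos volume ⟨0, h1.ne'⟩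

/-- If `σ` comes from a nonnegative bump, then `σ 0 > 0`, and the inverse transform of `σ²` has
positive real part at the origin, hence near it. Taking for `ρ` the inverse transform of a bump
supported in that neighbourhood, Parseval makes the integral positive. -/
theorem exists_bandlimited_pair {R : ℝ} (hR : 0 < R) : ∃ σ ρ : 𝓢(Space d, ℝ),
    Bandlimited R (cplx σ) ∧ Bandlimited R (cplx ρ) ∧ 0 < ∫ x, σ x ^ 2 * ρ x := by
  have hp := Real.pi_pos
  have hbl : ∀ {r : ℝ}, r ≤ R / (2 * Real.pi) → ∀ {b : 𝓢(Space d, ℝ)},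
      (∀ ξ, b ξ ≠ 0 → ‖ξ‖ < r) → Bandlimited R (cplx (reFourierInv b)) := by
    intro r hr b hb
    refine (bandlimited_reFourierInv hb).mono ?_
    rw [le_div_iff₀ (by positivity)] at hr
    linarith
  obtain ⟨b, hb0, hb1, hbr⟩ := exists_schwartz_bump (d := d) (r := R / (2 * Real.pi))
    (by positivity)
  set σ := reFourierInv b with hσ
  have hσ0 : 0 < σ 0 := by
    rw [hσ, reFourierInv_apply, SchwartzMap.fourierInv_coe, Real.fourierInv_eq]
    simp only [inner_zero_right, AddChar.map_zero_eq_one, one_smul, cplx_apply]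
    rw [integral_complex_ofReal, Complex.ofReal_re]
    exact integral_pos_of_continuous b.continuous b.integrable hb0 (by rw [hb1]; norm_num)
  obtain ⟨C, hC0, hC⟩ := exists_abs_le σ
  obtain ⟨h', hh', -⟩ := exists_comp_schwartz (SchwartzBounded.const (ι := Unit) σ)
    (G := fun z ↦ z ^ 2) isOpen_univ (contDiff_id.pow 2).contDiffOn (by simp)
    (Set.subset_univ (Set.Icc (-C) C)) ⟨by linarith, hC0⟩ (fun _ x ↦ abs_le.1 (hC x))
  set h := h' () with hh
  have hhx : ∀ x, h x = σ x ^ 2 := hh' ()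
  set H : 𝓢(Space d, ℂ) := 𝓕⁻ (cplx h) with hH
  have hH0 : 0 < (H 0).re := by
    rw [hH, SchwartzMap.fourierInv_coe, Real.fourierInv_eq]
    simp only [inner_zero_right, AddChar.map_zero_eq_one, one_smul, cplx_apply]
    rw [integral_complex_ofReal, Complex.ofReal_re]
    refine integral_pos_of_continuous h.continuous h.integrable (fun x ↦ ?_) ?_
    · rw [hhx]
      positivity
    · rw [hhx]
      positivity
  have hHc : Continuous fun ξ ↦ (H ξ).re := Complex.continuous_re.comp H.continuous
  obtain ⟨r, hr, hrH⟩ := Metric.eventually_nhds_iff.1 (hHc.tendsto 0 |>.eventually_const_lt hH0)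
  obtain ⟨b', hb0', hb1', hbr'⟩ := exists_schwartz_bump (d := d) (r := min r (R / (2 * Real.pi)))
    (lt_min hr (by positivity))
  refine ⟨σ, reFourierInv b', hbl le_rfl hbr, hbl (min_le_right _ _) hbr', ?_⟩
  have hpar := SchwartzMap.integral_fourierInv_mul_eq (cplx h) (cplx b')
  have hprod : Integrable fun ξ ↦ H ξ * cplx b' ξ := by
    obtain ⟨C', -, hC'⟩ := H.decay 0 0
    exact (cplx b').integrable.bdd_mul (c := C') H.continuous.aestronglyMeasurable
      (Eventually.of_forall fun x ↦ by simpa using hC' x)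
  have hprod2 : Integrable fun x ↦ cplx h x * (𝓕⁻ (cplx b') : 𝓢(Space d, ℂ)) x := by
    obtain ⟨C', -, hC'⟩ := (𝓕⁻ (cplx b') : 𝓢(Space d, ℂ)).decay 0 0
    exact (cplx h).integrable.mul_bdd (c := C')
      (𝓕⁻ (cplx b') : 𝓢(Space d, ℂ)).continuous.aestronglyMeasurable
      (Eventually.of_forall fun x ↦ by simpa using hC' x)
  have h1 : ∫ x, σ x ^ 2 * reFourierInv b' x = ∫ ξ, (H ξ).re * b' ξ := by
    have h2 := congrArg Complex.re hpar
    rw [← RCLike.re_eq_complex_re, ← integral_re hprod, ← integral_re hprod2] at h2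
    simp only [RCLike.re_eq_complex_re, cplx_apply, Complex.re_mul_ofReal, Complex.re_ofReal_mul,
      hhx] at h2
    exact h2.symm
  rw [h1]
  refine integral_pos_of_continuous (hHc.mul b'.continuous) ?_ (fun ξ ↦ ?_) ?_
  · refine hprod.re.congr (Eventually.of_forall fun ξ ↦ ?_)
    simp
  · by_cases hξ : b' ξ = 0
    · rw [hξ, mul_zero]
    · refine mul_nonneg (le_of_lt (hrH ?_)) (hb0' ξ)
      rw [dist_zero_right]
      exact (hbr' ξ hξ).trans_le (min_le_left _ _)
  · rw [hb1', mul_one]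
    exact hH0

end Envelope

/-! ### The envelope whose square occupies many dyadic blocks. -/

section Inflation

variable {d : ℕ} {e : Space d}

theorem integrable_schwartz_mul {g : 𝓢(Space d, ℝ)} {F : Space d → ℝ} (hF : Continuous F) {C : ℝ}
    (hC : ∀ x, |F x| ≤ C) : Integrable fun x ↦ g x * F x :=
  g.integrable.mul_bdd (c := C) hF.aestronglyMeasurable (Eventually.of_forall hC)

/-- With `θ = ν e·x` one has `cos θ cos² (θ/2) = 1/4 + cos θ / 2 + cos 2θ / 4`, and the oscillating
terms vanish in the limit. -/
theorem tendsto_integral_cosMod_sq_mul_cosMod (he : ‖e‖ = 1) (σ ρ : 𝓢(Space d, ℝ)) :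
    Tendsto (fun ν : ℝ ↦ ∫ x, cosMod e ν ρ x * cosMod e (ν / 2) σ x ^ 2) atTop
      (𝓝 ((∫ x, σ x ^ 2 * ρ x) / 4)) := by
  have hg : Integrable fun x ↦ σ x ^ 2 * ρ x := by
    obtain ⟨C, hC0, hC⟩ := exists_abs_le σ
    refine (integrable_schwartz_mul (g := ρ) (F := fun x ↦ σ x ^ 2) (σ.continuous.pow 2)
      (C := C ^ 2) fun x ↦ ?_).congr (Eventually.of_forall fun x ↦ mul_comm _ _)
    rw [abs_pow]
    exact pow_le_pow_left₀ (abs_nonneg _) (hC x) 2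
  set g : Space d → ℝ := fun x ↦ σ x ^ 2 * ρ x with hgdef
  have hgc : ∀ ν : ℝ, Integrable fun x ↦ g x * Real.cos (ν * inner ℝ e x) := fun ν ↦
    hg.mul_bdd (c := 1) (by fun_prop) (Eventually.of_forall fun x ↦ Real.abs_cos_le_one _)
  have h1 := tendsto_integral_mul_cos he hg
  have h2 := h1.comp (tendsto_id.const_mul_atTop (two_pos (α := ℝ)))
  have h3 := ((h1.div_const 2).add (h2.div_const 4)).const_add ((∫ x, g x) / 4)
  simp only [zero_div, add_zero] at h3
  refine h3.congr fun ν ↦ ?_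
  simp only [Function.comp_apply, id]
  rw [← integral_div, ← integral_div, ← integral_div,
    ← integral_add' ((hgc ν).div_const 2) ((hgc (2 * ν)).div_const 4),
    ← integral_add' (hg.div_const 4) (((hgc ν).div_const 2).add ((hgc (2 * ν)).div_const 4))]
  refine integral_congr_ae (Eventually.of_forall fun x ↦ ?_)
  simp only [cosMod_apply, hgdef, Pi.add_apply]
  rw [show ν * inner ℝ e x = 2 * (ν / 2 * inner ℝ e x) by ring,
    show 2 * ν * inner ℝ e x = 2 * (2 * (ν / 2 * inner ℝ e x)) by ring, Real.cos_two_mul,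
    Real.cos_two_mul, Real.cos_two_mul]
  ring

theorem le_norm_add_norm_of_ne (he : ‖e‖ = 1) {L : ℝ} (hL : 0 ≤ L) {i j : ℕ} (hij : i ≠ j)
    (x : Space d) : L ≤ ‖x - (i * L) • e‖ + ‖x - (j * L) • e‖ := by
  have h1 : (((j : ℝ) - i) * L) • e = (x - (i * L) • e) - (x - (j * L) • e) := by
    module
  have h2 : L ≤ ‖(((j : ℝ) - i) * L) • e‖ := by
    rw [norm_smul, he, mul_one, norm_mul, Real.norm_of_nonneg hL]
    have h3 : (1 : ℝ) ≤ ‖(j : ℝ) - i‖ := by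
      have h4 : 1 ≤ |(j : ℤ) - i| := Int.one_le_abs (by omega)
      rw [Real.norm_eq_abs]
      exact_mod_cast h4
    nlinarith
  rw [h1] at h2
  exact h2.trans (norm_sub_le _ _)

/-- At every point at most one bump is large: of two centres, one lies at distance at least `L/2`,
so every term other than the largest is at most `2D/L`. This bounds the envelope independently of
the number of bumps. -/
theorem sum_abs_translate_le (he : ‖e‖ = 1) {L : ℝ} (hL : 0 < L) {D : ℝ} (hD : 0 ≤ D)
    {τ : ℕ → Space d → ℝ} (hτ : ∀ i y, |τ i y| * (1 + ‖y‖) ≤ D) (S : Finset ℕ) (x : Space d) :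
    ∑ i ∈ S, |τ i (x - (i * L) • e)| ≤ D + S.card * (2 * D / L) := by
  rcases S.eq_empty_or_nonempty with rfl | hS
  · simpa using hD
  obtain ⟨j, hj, hmax⟩ := S.exists_max_image (fun i ↦ |τ i (x - (i * L) • e)|) hS
  have hfar : ∀ i y, L / 2 ≤ ‖y‖ → |τ i y| ≤ 2 * D / L := fun i y hy ↦ by
    have h1 := hτ i y
    rw [le_div_iff₀ hL]
    nlinarith [abs_nonneg (τ i y)]
  have hD' : ∀ i y, |τ i y| ≤ D := fun i y ↦ by
    have h1 := hτ i y
    nlinarith [abs_nonneg (τ i y), norm_nonneg y]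
  rw [← Finset.add_sum_erase S _ hj]
  refine add_le_add (hD' _ _) ?_
  have h1 : ∀ i ∈ S.erase j, |τ i (x - (i * L) • e)| ≤ 2 * D / L := by
    intro i hi
    rw [Finset.mem_erase] at hi
    have h2 := le_norm_add_norm_of_ne he hL.le hi.1 x
    rcases le_total (L / 2) ‖x - (i * L) • e‖ with h3 | h3
    · exact hfar _ _ h3
    · exact (hmax i hi.2).trans (hfar _ _ (by linarith))
  refine (Finset.sum_le_card_nsmul _ _ _ h1).trans ?_
  rw [nsmul_eq_mul]
  gcongr
  exact Finset.erase_subset j S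

theorem sum_erase_abs_translate_le (he : ‖e‖ = 1) {L : ℝ} (hL : 0 < L) {D : ℝ} (hD : 0 ≤ D)
    {τ : ℕ → Space d → ℝ} (hτ : ∀ i y, |τ i y| * (1 + ‖y‖) ≤ D) (S : Finset ℕ) (j : ℕ)
    (y : Space d) :
    ∑ i ∈ S.erase j, |τ i (y + (j * L) • e - (i * L) • e)| ≤ S.card * (D * (1 + ‖y‖) / L) := by
  have h1 : ∀ i ∈ S.erase j, |τ i (y + (j * L) • e - (i * L) • e)| ≤ D * (1 + ‖y‖) / L := by
    intro i hi
    rw [Finset.mem_erase] at hi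
    have h2 := le_norm_add_norm_of_ne he hL.le hi.1 (y + (j * L) • e)
    rw [add_sub_cancel_right] at h2
    have h3 := hτ i (y + (j * L) • e - (i * L) • e)
    set z := y + ((j : ℝ) * L) • e - ((i : ℝ) * L) • e
    rw [le_div_iff₀ hL]
    -- Here `L ≤ ‖z‖ + ‖y‖ ≤ (1 + ‖z‖) (1 + ‖y‖)`, which trades the separation for a weight at the
    -- centre `j`.
    calc |τ i z| * L ≤ |τ i z| * ((1 + ‖z‖) * (1 + ‖y‖)) := by
          gcongr
          nlinarith [norm_nonneg z, norm_nonneg y, mul_nonneg (norm_nonneg z) (norm_nonneg y)]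
      _ = (|τ i z| * (1 + ‖z‖)) * (1 + ‖y‖) := by ring
      _ ≤ D * (1 + ‖y‖) := by gcongr
  refine (Finset.sum_le_card_nsmul _ _ _ h1).trans ?_
  rw [nsmul_eq_mul]
  gcongr
  exact Finset.erase_subset j S

theorem exists_decay (g : 𝓢(Space d, ℝ)) : ∃ D : ℝ, 1 ≤ D ∧ ∀ y, |g y| * (1 + ‖y‖) ≤ D := by
  obtain ⟨C, hC⟩ := SchwartzBounded.const (ι := Unit) g 1 0
  refine ⟨|C| + 1, by linarith [abs_nonneg C], fun y ↦ ?_⟩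
  have h := hC () y
  rw [norm_iteratedFDeriv_zero, pow_one, mul_comm] at h
  exact h.trans (by linarith [le_abs_self C])

/-- Around the centre `j` the sum differs from `τ j` by the tails of the other bumps, which are of
order `S.card / L`. Stating the error through a majorant `ρ` of `ψ` makes it the same for all
modulations of `ρ`. -/
theorem integral_mul_sum_translate_sq_ge (he : ‖e‖ = 1) {L : ℝ} (hL : 0 < L) {D : ℝ} (hD : 1 ≤ D)
    {τ : ℕ → 𝓢(Space d, ℝ)} (hτ : ∀ i y, |τ i y| * (1 + ‖y‖) ≤ D) {S : Finset ℕ}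
    (hSL : S.card ≤ L) {j : ℕ} (hj : j ∈ S) {ψ ρ : 𝓢(Space d, ℝ)} (hψ : ∀ y, |ψ y| ≤ |ρ y|) :
    (∫ y, ψ y * τ j y ^ 2) - S.card / L * (4 * D ^ 2 * ∫ y, (1 + ‖y‖) * |ρ y|) ≤
      ∫ x, translate ((j * L) • e) ψ x *
        (∑ i ∈ S, translate ((i * L) • e) (τ i) : 𝓢(Space d, ℝ)) x ^ 2 := by
  have hD0 : 0 ≤ D := zero_le_one.trans hD
  set A : 𝓢(Space d, ℝ) := ∑ i ∈ S, translate ((i * L) • e) (τ i) with hA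
  have hAx : ∀ x, A x = ∑ i ∈ S, τ i (x - (i * L) • e) := fun x ↦ by
    rw [hA, sum_apply]
    rfl
  have hτD : ∀ i y, |τ i y| ≤ D := fun i y ↦ by
    have h1 := hτ i y
    nlinarith [abs_nonneg (τ i y), norm_nonneg y]
  have hAb : ∀ x, |A x| ≤ 3 * D := fun x ↦ by
    rw [hAx]
    refine (Finset.abs_sum_le_sum_abs _ _).trans
      ((sum_abs_translate_le he hL hD0 hτ S x).trans ?_)
    have : S.card * (2 * D / L) ≤ 2 * D := by
      rw [← mul_div_assoc, div_le_iff₀ hL]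
      nlinarith
    linarith
  have hshift : ∫ x, translate ((j * L) • e) ψ x * A x ^ 2 =
      ∫ y, ψ y * A (y + (j * L) • e) ^ 2 := by
    rw [← integral_add_right_eq_self _ ((j * L) • e)]
    simp
  rw [hshift]
  have hi1 : Integrable fun y ↦ ψ y * τ j y ^ 2 := by
    refine integrable_schwartz_mul ((τ j).continuous.pow 2) (C := D ^ 2) fun y ↦ ?_
    rw [abs_pow]
    exact pow_le_pow_left₀ (abs_nonneg _) (hτD j y) 2
  have hi2 : Integrable fun y ↦ ψ y * A (y + (j * L) • e) ^ 2 := by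
    have hAc := A.continuous
    refine integrable_schwartz_mul (F := fun y ↦ A (y + (j * L) • e) ^ 2) (by fun_prop)
      (C := (3 * D) ^ 2) fun y ↦ ?_
    rw [abs_pow]
    exact pow_le_pow_left₀ (abs_nonneg _) (hAb _) 2
  have hi3 : Integrable fun y : Space d ↦ (1 + ‖y‖) * |ρ y| := by
    simp_rw [add_mul, one_mul]
    have := ρ.integrable_pow_mul volume 1
    simp only [pow_one] at this
    exact ρ.integrable.abs.add this
  have hpt : ∀ y, ψ y * τ j y ^ 2 - ψ y * A (y + (j * L) • e) ^ 2 ≤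
      S.card / L * (4 * D ^ 2) * ((1 + ‖y‖) * |ρ y|) := by
    intro y
    have h1 : |A (y + (j * L) • e) - τ j y| ≤ S.card * (D * (1 + ‖y‖) / L) := by
      rw [hAx, ← Finset.add_sum_erase S _ hj, add_sub_cancel_right, add_sub_cancel_left]
      exact (Finset.abs_sum_le_sum_abs _ _).trans
        (sum_erase_abs_translate_le he hL hD0 hτ S j y)
    have h2 : |A (y + (j * L) • e) + τ j y| ≤ 4 * D :=
      (abs_add_le _ _).trans (by linarith [hAb (y + (j * L) • e), hτD j y])
    calc ψ y * τ j y ^ 2 - ψ y * A (y + (j * L) • e) ^ 2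
        ≤ |ψ y * τ j y ^ 2 - ψ y * A (y + (j * L) • e) ^ 2| := le_abs_self _
      _ = |ψ y| * (|A (y + (j * L) • e) - τ j y| * |A (y + (j * L) • e) + τ j y|) := by
          rw [← abs_mul, ← abs_mul, ← abs_neg]
          congr 1
          ring
      _ ≤ |ρ y| * (S.card * (D * (1 + ‖y‖) / L) * (4 * D)) := by
          refine mul_le_mul (hψ y) (mul_le_mul h1 h2 (abs_nonneg _) ?_) (by positivity)
            (abs_nonneg _)
          positivity
      _ = _ := by ring
  have h := integral_mono (hi1.sub hi2) (hi3.const_mul (S.card / L * (4 * D ^ 2))) hpt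
  simp only [Pi.sub_apply] at h
  rw [integral_sub hi1 hi2, integral_const_mul] at h
  linarith

/-- The bump with index `i` has the carrier frequency `17/12 * 2^i / 2`, so its square oscillates at
the centre of block `i`, where `ψ i` detects it. Separation decouples the bumps, and `C`, `c`, `M`
do not depend on `J`. -/
theorem exists_envelope (he : ‖e‖ = 1) : ∃ C c M : ℝ, 1 ≤ C ∧ 0 < c ∧ 0 < M ∧ ∀ J : ℕ, 1 ≤ J →
    ∃ (S : Finset ℕ) (A : 𝓢(Space d, ℝ)) (ψ : ℕ → 𝓢(Space d, ℝ)) (R : ℝ), S.card = J ∧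
      (∀ x, |A x| ≤ C) ∧ Bandlimited R (cplx A) ∧ ∀ j ∈ S, AnnulusSupported j (cplx (ψ j)) ∧
        ∫ x, |ψ j x| ≤ M ∧ c ≤ ∫ x, ψ j x * A x ^ 2 := by
  obtain ⟨σ, ρ, hσ, hρ, hpos⟩ := exists_bandlimited_pair (d := d) (R := 1 / 12) (by norm_num)
  set I := ∫ x, σ x ^ 2 * ρ x with hI
  obtain ⟨D, hD, hσD⟩ := exists_decay σ
  set D' := ∫ y, (1 + ‖y‖) * |ρ y| with hD'
  have hD'0 : 0 ≤ D' := integral_nonneg fun y ↦ by positivity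
  clear_value I D'
  have hfreq : Tendsto (fun j : ℕ ↦ (17 / 12 * 2 ^ j : ℝ)) atTop atTop :=
    (tendsto_pow_atTop_atTop_of_one_lt one_lt_two).const_mul_atTop (by norm_num)
  have hlim := (tendsto_integral_cosMod_sq_mul_cosMod he σ ρ).comp hfreq
  rw [← hI] at hlim
  obtain ⟨j₀, hj₀⟩ := eventually_atTop.1 (hlim.eventually_const_lt (show I / 8 < I / 4 by linarith))
  refine ⟨3 * D, I / 16, (∫ x, |ρ x|) + 1, by linarith, by linarith,
    by linarith [show 0 ≤ ∫ x, |ρ x| from integral_nonneg fun x ↦ abs_nonneg (ρ x)],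
    fun J hJ ↦ ?_⟩
  have hJ0 : (0 : ℝ) < J := by exact_mod_cast hJ
  -- With spacing `L = J * N`, the interaction error is at most `I/16`, half of the correlation
  -- `I/8` that is guaranteed for indices from `j₀` on.
  set N : ℝ := 1 + 4 * D ^ 2 * D' / (I / 16) with hN
  have hN1 : 1 ≤ N := by
    have : 0 ≤ 4 * D ^ 2 * D' / (I / 16) := by positivity
    linarith
  set L : ℝ := J * N with hL
  have hL0 : 0 < L := by positivity
  set τ : ℕ → 𝓢(Space d, ℝ) := fun i ↦ cosMod e (17 / 12 * 2 ^ i / 2) σ with hτdef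
  set S : Finset ℕ := Finset.Ico j₀ (j₀ + J) with hS
  have hcard : S.card = J := by simp [hS]
  have hτ : ∀ i y, |τ i y| * (1 + ‖y‖) ≤ D := fun i y ↦ by
    refine le_trans ?_ (hσD y)
    simp only [hτdef, cosMod_apply, abs_mul]
    gcongr
    exact mul_le_of_le_one_left (abs_nonneg _) (Real.abs_cos_le_one _)
  have hSL : (S.card : ℝ) ≤ L := by
    rw [hcard, hL]
    nlinarith
  refine ⟨S, ∑ i ∈ S, translate ((i * L) • e) (τ i),
    fun j ↦ translate ((j * L) • e) (cosMod e (17 / 12 * 2 ^ j) ρ),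
    1 / 12 + 17 / 12 * 2 ^ (j₀ + J) / 2, hcard, fun x ↦ ?_, ?_, fun j hj ↦ ⟨?_, ?_, ?_⟩⟩
  · rw [sum_apply]
    refine (Finset.abs_sum_le_sum_abs _ _).trans
      ((sum_abs_translate_le he hL0 (by linarith) hτ S x).trans ?_)
    have : S.card * (2 * D / L) ≤ 2 * D := by
      rw [← mul_div_assoc, div_le_iff₀ hL0]
      nlinarith
    linarith
  · rw [map_sum]
    refine Bandlimited.sum fun i hi ↦ Bandlimited.translate ?_ _
    refine (hσ.cosMod he (by positivity)).mono ?_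
    have : i ≤ j₀ + J := (Finset.mem_Ico.1 hi).2.le
    gcongr
    norm_num
  · refine AnnulusSupported.translate (hρ.annulusSupported_cosMod he ?_) _
    have : (1 : ℝ) ≤ 2 ^ j := one_le_pow₀ one_le_two
    linarith
  · have h1 : ∫ x, |translate ((j * L) • e) (cosMod e (17 / 12 * 2 ^ j) ρ) x| =
        ∫ x, |cosMod e (17 / 12 * 2 ^ j) ρ x| :=
      integral_sub_right_eq_self (fun x ↦ |cosMod e (17 / 12 * 2 ^ j) ρ x|) ((j * L) • e)
    rw [h1]
    refine (integral_mono (SchwartzMap.integrable _).abs ρ.integrable.abs fun x ↦ ?_).trans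
      (by linarith)
    simp only [cosMod_apply, abs_mul]
    exact mul_le_of_le_one_left (abs_nonneg _) (Real.abs_cos_le_one _)
  · refine le_trans ?_ (integral_mul_sum_translate_sq_ge he hL0 hD hτ hSL hj (ρ := ρ) fun y ↦ ?_)
    · have h1 := (hj₀ j (Finset.mem_Ico.1 hj).1).le
      simp only [Function.comp_apply] at h1
      rw [← hD']
      have h2 : S.card / L * (4 * D ^ 2 * D') ≤ I / 16 := by
        rw [hcard, hL, div_mul_eq_div_div, div_self hJ0.ne', div_mul_eq_mul_div, one_mul,
          div_le_iff₀ (by linarith), hN]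
        have : I / 16 * (4 * D ^ 2 * D' / (I / 16)) = 4 * D ^ 2 * D' := by field_simp
        nlinarith
      linarith
    · simp only [cosMod_apply, abs_mul]
      exact mul_le_of_le_one_left (abs_nonneg _) (Real.abs_cos_le_one _)

end Inflation

/-! ### Choice of the parameters and the inflating sequence. -/

section Construction

variable {d : ℕ} {e : Space d}

theorem abs_log_one_add_sub_le {z : ℝ} (hz : 0 ≤ z) : |Real.log (1 + z) - z| ≤ z ^ 2 := by
  have h1 := Real.le_log_one_add_of_nonneg hz
  have h2 := Real.log_le_sub_one_of_pos (show 0 < 1 + z by linarith)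
  have h3 : z - z ^ 2 ≤ 2 * z / (z + 2) := by
    rw [le_div_iff₀ (by linarith)]
    nlinarith [mul_nonneg hz hz, mul_nonneg hz (mul_nonneg hz hz)]
  rw [abs_le]
  constructor
  · linarith
  · nlinarith [sq_nonneg z]

theorem abs_integral_mul_sub_integral_mul_le {ψ F G : Space d → ℝ} (hψ : Integrable ψ)
    (hF : Integrable fun x ↦ ψ x * F x) (hG : Integrable fun x ↦ ψ x * G x) {η M : ℝ} (hη : 0 ≤ η)
    (hFG : ∀ x, |F x - G x| ≤ η) (hM : ∫ x, |ψ x| ≤ M) :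
    |(∫ x, ψ x * F x) - ∫ x, ψ x * G x| ≤ η * M := by
  rw [← integral_sub hF hG]
  refine (abs_integral_le_integral_abs).trans ?_
  refine le_trans ?_ (mul_le_mul_of_nonneg_left hM hη)
  rw [← integral_const_mul]
  refine integral_mono (hF.sub hG).abs (hψ.abs.const_mul η) fun x ↦ ?_
  simp only
  rw [← mul_sub, abs_mul, mul_comm]
  exact mul_le_mul_of_nonneg_right (hFG x) (abs_nonneg _)

theorem Bandlimited.smul {R : ℝ} {g : 𝓢(Space d, ℝ)} (hg : Bandlimited R (cplx g)) (a : ℝ) :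
    Bandlimited R (cplx (a • g)) := fun ξ hξ ↦ by
  refine hg ξ fun h ↦ hξ ?_
  have h1 : (𝓕 (cplx (a • g)) : 𝓢(Space d, ℂ)) = a • (𝓕 (cplx g) : 𝓢(Space d, ℂ)) := by
    rw [map_smul]
    exact map_smul (fourierCLM ℝ 𝓢(Space d, ℂ)) a (cplx g)
  rw [h1, smul_apply, h, smul_zero]

/-- Lower bound for the pairing of the solution with a test function. -/
theorem integral_mul_log_heatAvg_ge {B ψ : 𝓢(Space d, ℝ)} {b : ℝ} (hb : b ≤ 1)
    (hB : ∀ x, |B x| ≤ b) {M : ℝ} (hψM : ∫ x, |ψ x| ≤ M) {K : ℕ} {t μ ε : ℝ}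
    (hlog : |(∫ x, ψ x * Real.log (heatAvg t (riesz e B μ K) x)) -
        K * ∫ x, ψ x * Real.log (1 + B x ^ 2 / 4)| < ε) {f u : 𝓢(Space d, ℝ)}
    (hf : ∀ x, f x = ∑ k ∈ Finset.range K, B x * Real.cos (8 ^ k * (μ * inner ℝ e x)))
    (hu : ∀ x, u x = Real.log (heatAvg t (fun z ↦ Real.exp (f z)) x)) :
    K * ((∫ x, ψ x * B x ^ 2) / 4 - (b ^ 2 / 4) ^ 2 * M - b ^ 3 * M) - ε ≤ ∫ x, ψ x * u x := by
  have hb0 : 0 ≤ b := (abs_nonneg _).trans (hB 0)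
  have hB1 : ∀ x, |B x| ≤ 1 := fun x ↦ (hB x).trans hb
  have hB2 : ∀ x, B x ^ 2 ≤ b ^ 2 := fun x ↦ by
    rw [← sq_abs]
    exact pow_le_pow_left₀ (abs_nonneg _) (hB x) 2
  have hm : (0 : ℝ) < (1 / 2) ^ K := by positivity
  have hBc := B.continuous
  obtain ⟨C, -, hC⟩ := exists_abs_le u
  have hW : Integrable fun x ↦ ψ x * Real.log (heatAvg t (riesz e B μ K) x) :=
    integrable_mul_log (continuous_heatAvg (continuous_riesz hBc μ K) (abs_riesz_le hB1 μ K) t) hm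
      (fun x ↦ heatAvg_mem_Icc (continuous_riesz hBc μ K) (riesz_mem_Icc hB1 μ K) t x)
      ψ.integrable
  have h1 := abs_integral_mul_sub_integral_mul_le ψ.integrable
    (integrable_schwartz_mul u.continuous hC) hW (η := K * b ^ 3) (by positivity)
    (fun x ↦ by rw [hu]; exact abs_log_heatAvg_exp_sub_le hBc hb hB μ K hf t x) hψM
  have hE : Integrable fun x ↦ ψ x * Real.log (1 + B x ^ 2 / 4) := by
    refine integrable_mul_log (w := fun x ↦ 1 + B x ^ 2 / 4) (by fun_prop) (m := (1 / 2) ^ 1)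
      (M := (5 / 2) ^ 1) (by norm_num) (fun x ↦ ?_) ψ.integrable
    simpa using one_add_sq_pow_mem_Icc (hB1 x) 1
  have hQ : Integrable fun x ↦ ψ x * (B x ^ 2 / 4) := by
    refine integrable_schwartz_mul (F := fun x ↦ B x ^ 2 / 4) (by fun_prop) (C := b ^ 2 / 4)
      fun x ↦ ?_
    rw [abs_of_nonneg (by positivity)]
    linarith [hB2 x]
  have h2 := abs_integral_mul_sub_integral_mul_le ψ.integrable hE hQ (η := (b ^ 2 / 4) ^ 2)
    (by positivity) (fun x ↦ (abs_log_one_add_sub_le (by positivity)).trans (by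
      have := hB2 x
      gcongr)) hψM
  have h3 : ∫ x, ψ x * (B x ^ 2 / 4) = (∫ x, ψ x * B x ^ 2) / 4 := by
    rw [← integral_div]
    simp only [mul_div_assoc]
  rw [h3] at h2
  have h4 := (abs_le.1 h1).1
  have h5 := (abs_le.1 h2).1
  have h6 := (abs_lt.1 hlog).1
  have hK : (0 : ℝ) ≤ K := Nat.cast_nonneg K
  nlinarith [mul_nonneg hK (sub_nonneg.2 h5)]

theorem toDist_toLp_cplx (f ψ : 𝓢(Space d, ℝ)) :
    toDist (f.toLp 2 volume) (cplx ψ) = ((∫ x, ψ x * f x : ℝ) : ℂ) := by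
  rw [toDist_toLp, SchwartzMap.coe_apply, ← integral_complex_ofReal]
  refine integral_congr_ae (Eventually.of_forall fun x ↦ ?_)
  simp

/-- With `b = a C`, the main term is at least `K a² c / 4`. The errors are cubic in `a`: since `b ≤
1` they are at most `2 K b³ M`, hence at most `K a² c / 16`, and the slack takes another `K a² c /
16`. All terms are linear in `K`, so the smallness of `a` does not depend on `K`. -/
theorem inflation_bound_le {a C M c I K : ℝ} (ha : 0 < a) (hC : 1 ≤ C) (hM : 0 < M)
    (hb1 : a * C ≤ 1) (hc : a * (32 * C ^ 4 * M) ≤ c) (hI : c ≤ I) (hK : 0 ≤ K) :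
    K * a ^ 2 * c / 8 ≤ K * (a ^ 2 * I / 4 - ((a * C) ^ 2 / 4) ^ 2 * M - (a * C) ^ 3 * M) -
      K * (a ^ 2 * c / 16) := by
  have hC0 : 0 < C := zero_lt_one.trans_le hC
  obtain ⟨b, hb⟩ : ∃ b, b = a * C := ⟨_, rfl⟩
  have hb0 : 0 ≤ b := by rw [hb]; positivity
  rw [← hb] at hb1 ⊢
  have h1 : (b ^ 2 / 4) ^ 2 + b ^ 3 ≤ 2 * b ^ 3 := by
    have h2 : b ^ 4 ≤ b ^ 3 := pow_le_pow_of_le_one hb0 hb1 (by norm_num)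
    have h3 : 0 ≤ b ^ 3 := by positivity
    linarith [show (b ^ 2 / 4) ^ 2 = b ^ 4 / 16 by ring]
  have h4 : b ^ 3 ≤ a ^ 2 * (a * C ^ 4) := by
    have : C ^ 3 ≤ C ^ 4 := pow_le_pow_right₀ hC (by norm_num)
    calc b ^ 3 = a ^ 3 * C ^ 3 := by rw [hb]; ring
      _ ≤ a ^ 3 * C ^ 4 := by gcongr
      _ = _ := by ring
  have h5 : (b ^ 2 / 4) ^ 2 * M + b ^ 3 * M ≤ a ^ 2 * c / 16 := by
    calc (b ^ 2 / 4) ^ 2 * M + b ^ 3 * M = ((b ^ 2 / 4) ^ 2 + b ^ 3) * M := by ring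
      _ ≤ 2 * (a ^ 2 * (a * C ^ 4)) * M := by
        gcongr
        linarith
      _ = a ^ 2 * (a * (32 * C ^ 4 * M)) / 16 := by ring
      _ ≤ a ^ 2 * c / 16 := by gcongr
  have h6 : a ^ 2 * c / 4 ≤ a ^ 2 * I / 4 := by gcongr
  rw [← mul_sub]
  calc K * a ^ 2 * c / 8 = K * (a ^ 2 * c / 8) := by ring
    _ ≤ _ := by
      gcongr
      linarith

/-- The number `K` of input frequencies amplifies the output, and the number `J` of bumps spreads it
over blocks. Both are free once `a` is below a threshold that does not depend on them. -/
theorem exists_norm_inflation (hd : 1 ≤ d) {φ : Space d → ℝ} (hφ : IsLittlewoodPaley φ)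
    {q : ℝ≥0∞} (hq : 1 ≤ q) : ∃ a₀ C c : ℝ, 0 < a₀ ∧ 0 < C ∧ 0 < c ∧
    ∀ a, 0 < a → a ≤ a₀ → ∀ J K : ℕ, 1 ≤ J → 1 ≤ K → ∀ δ : ℝ, 0 < δ →
      ∃ (f : 𝓢(Space d, ℝ)) (u : ℝ → 𝓢(Space d, ℝ)) (t : ℝ), IsSchwartzSolution f u ∧
        0 < t ∧ t < δ ∧
        besovENorm φ 0 ∞ q (toDist (f.toLp 2 volume)) ≤
          ENNReal.ofReal (C * a) * (K : ℝ≥0∞) ^ (1 / q.toReal) ∧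
        ENNReal.ofReal (c * (K * a ^ 2)) * (J : ℝ≥0∞) ^ (1 / q.toReal) ≤
          besovENorm φ 0 ∞ q (toDist ((u t).toLp 2 volume)) := by
  set e : Space d := EuclideanSpace.single ⟨0, hd⟩ 1 with he'
  have he : ‖e‖ = 1 := norm_single_one _
  obtain ⟨C, c, M, hC, hc, hM, henv⟩ := exists_envelope he
  have hC0 : 0 < C := zero_lt_one.trans_le hC
  -- The first entry of the minimum gives `|B| ≤ 1`, the second makes the cubic errors small. In `c
  -- / (8 * M)`, the `8` comes from `inflation_bound_le` and `M` bounds the `L¹` norms of the test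
  -- functions.
  refine ⟨min (1 / C) (c / (32 * C ^ 4 * M)), C, c / (8 * M), by positivity, hC0, by positivity,
    fun a ha ha0 J K hJ hK δ hδ ↦ ?_⟩
  obtain ⟨S, A, ψ, R, hcard, hAC, hAR, hψ⟩ := henv J hJ
  set B : 𝓢(Space d, ℝ) := a • A with hB
  set b : ℝ := a * C with hb
  have hb1 : b ≤ 1 := by
    have := ha0.trans (min_le_left _ _)
    rwa [le_div_iff₀ hC0] at this
  have hBx : ∀ x, B x = a * A x := fun x ↦ rfl
  have hBb : ∀ x, |B x| ≤ b := fun x ↦ by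
    rw [hBx, abs_mul, abs_of_pos ha]
    exact mul_le_mul_of_nonneg_left (hAC x) ha.le
  have hBR : Bandlimited R (cplx B) := hAR.smul a
  clear_value B
  have hK0 : (0 : ℝ) < K := by exact_mod_cast hK
  set ε : ℝ := K * (a ^ 2 * c / 16) with hε
  have hε0 : 0 < ε := by positivity
  have hev : ∀ᶠ t in 𝓝[>] (0 : ℝ), ∀ j ∈ S, ∀ᶠ μ in atTop,
      |(∫ x, ψ j x * Real.log (heatAvg t (riesz e B μ K) x)) -
        K * ∫ x, ψ j x * Real.log (1 + B x ^ 2 / 4)| < ε :=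
    (Finset.eventually_all S).2 fun j _ ↦ eventually_abs_integral_log_heatAvg_riesz_sub_lt he
      B.continuous (fun x ↦ (hBb x).trans hb1) K (ψ j).integrable hε0
  obtain ⟨t, hte, ht0, htδ⟩ := (hev.and (Ioo_mem_nhdsGT hδ)).exists
  have hfreq : Tendsto (fun n : ℕ ↦ (17 / 12 * 2 ^ n : ℝ)) atTop atTop :=
    (tendsto_pow_atTop_atTop_of_one_lt one_lt_two).const_mul_atTop (by norm_num)
  -- With `t` fixed, `n` is taken so large that the weak limit is nearly attained for every test
  -- function and that the band `R` of the profile fits into the annulus of block `n`.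
  obtain ⟨n, hn, hnR⟩ := ((hfreq.eventually ((Finset.eventually_all S).2 hte)).and
    ((tendsto_pow_atTop_atTop_of_one_lt (one_lt_two (α := ℝ))).eventually_ge_atTop (12 * R))).exists
  -- The ratio `8 = 2³` of consecutive frequencies shifts the block index by three.
  set S' : Finset ℕ := (Finset.range K).image fun k ↦ n + 3 * k with hS'
  have hinj : Function.Injective fun k : ℕ ↦ n + 3 * k := fun k l hkl ↦ by
    simp only at hkl
    omega
  have hcard' : S'.card = K := by
    rw [hS', Finset.card_image_of_injective _ hinj, Finset.card_range]
  have hS'ne : S'.Nonempty := by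
    rw [← Finset.card_pos, hcard']
    exact hK
  have hSne : S.Nonempty := by
    rw [← Finset.card_pos, hcard]
    exact hJ
  obtain ⟨f, hf⟩ : ∃ f : 𝓢(Space d, ℝ), f = ∑ m ∈ S', cosMod e (17 / 12 * 2 ^ m) B := ⟨_, rfl⟩
  have hfx : ∀ x, f x = ∑ k ∈ Finset.range K,
      B x * Real.cos (8 ^ k * (17 / 12 * 2 ^ n * inner ℝ e x)) := fun x ↦ by
    rw [hf, sum_apply, hS', Finset.sum_image hinj.injOn]
    refine Finset.sum_congr rfl fun k _ ↦ ?_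
    rw [cosMod_apply, mul_comm, pow_add, pow_mul]
    norm_num
    left
    congr 1
    ring
  obtain ⟨u, hu, hux⟩ := exists_isSchwartzSolution f
  refine ⟨f, u, t, hu, ht0, htδ, ?_, ?_⟩
  · rw [toDist_toLp, hf, map_sum, ← hcard']
    refine besovENorm_sum_le hφ hq hS'ne _ (fun m hm ↦ hBR.annulusSupported_cosMod he ?_)
      fun m _ x ↦ ?_
    · rw [hS', Finset.mem_image] at hm
      obtain ⟨k, -, rfl⟩ := hm
      have : (2 : ℝ) ^ n ≤ 2 ^ (n + 3 * k) := pow_le_pow_right₀ one_le_two (by omega)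
      linarith
    · rw [cplx_apply, Complex.norm_real, cosMod_apply, norm_mul, mul_comm C a]
      exact (mul_le_of_le_one_left (norm_nonneg _) (Real.abs_cos_le_one _)).trans (hBb x)
  · have hpair : ∀ j ∈ S, K * a ^ 2 * c / 8 ≤ ‖toDist ((u t).toLp 2 volume) (cplx (ψ j))‖ := by
      intro j hj
      obtain ⟨-, h2, h3⟩ := hψ j hj
      have h4 := integral_mul_log_heatAvg_ge hb1 hBb h2 (hn j hj) hfx (hux t ht0.le)
      have h5 : ∫ x, ψ j x * B x ^ 2 = a ^ 2 * ∫ x, ψ j x * A x ^ 2 := by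
        rw [← integral_const_mul]
        refine integral_congr_ae (Eventually.of_forall fun x ↦ ?_)
        simp only [hBx]
        ring
      rw [toDist_toLp_cplx, Complex.norm_real]
      refine le_trans ?_ (le_abs_self _)
      refine le_trans ?_ h4
      rw [h5]
      have h7 : a * (32 * C ^ 4 * M) ≤ c := by
        have := ha0.trans (min_le_right _ _)
        rwa [le_div_iff₀ (by positivity)] at this
      exact inflation_bound_le ha hC hM hb1 h7 h3 hK0.le
    have h := le_besovENorm hφ hq (toDist ((u t).toLp 2 volume)) hSne (fun j ↦ cplx (ψ j))
      (fun j hj ↦ (hψ j hj).1) hM hpair (fun j hj ↦ by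
        simp only [cplx_apply, Complex.norm_real]
        exact (hψ j hj).2.1)
    rw [hcard] at h
    convert h using 3
    field_simp

theorem isGlobalSolution_zero (s : ℝ) : IsGlobalSolution s (0 : RealL2 d) fun _ ↦ 0 where
  initial := rfl
  memSobolev t _ := by simp [toDist_zero]
  continuous t _ := by
    have h : sobolevENorm s (toDist (0 - 0 : RealL2 d)) = 0 := by
      have h1 : TemperedDistribution.besselPotential (Space d) ℂ s (toDist (0 - 0 : RealL2 d)) =
          Lp.toTemperedDistribution (0 : CplxL2 d) := by
        rw [sub_zero, toDist_zero, map_zero, ← Lp.toTemperedDistributionCLM_apply, map_zero]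
      rw [sobolevENorm_eq h1, enorm_zero]
    simp only [h]
    exact tendsto_const_nhds
  equation t _ := by
    refine ⟨fun _ ↦ 0, fun i ↦ ?_, fun ψ ↦ ?_⟩
    · rw [toDist_zero]
      exact map_zero (LineDeriv.lineDerivOpCLM ℂ 𝓢'(Space d, ℂ) (EuclideanSpace.single i (1 : ℝ)))
    · have h1 : ∫ x, ((∑ _i : Fin d, ((0 : RealL2 d) x) ^ 2 : ℝ) : ℂ) * ψ x = 0 := by
        refine integral_eq_zero_of_ae ?_
        filter_upwards [Lp.coeFn_zero ℝ 2 (volume : Measure (Space d))] with x hx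
        rw [hx]
        simp
      have h2 : (Δ (toDist (0 : RealL2 d))) ψ = 0 := by
        rw [toDist_zero, ← TemperedDistribution.laplacianCLM_apply, map_zero]
        rfl
      rw [h1, h2, add_zero]
      exact hasDerivAt_const t _

/-- For `q = ∞` the number of input blocks costs nothing, so `K` supplies the growth. For `q < ∞`
one input block is used, and the `ℓ^q` sum over `J` output blocks supplies it. In both cases the
input factor `K^{1/q}` is one. -/
theorem exists_le_natCast_rpow {q : ℝ≥0∞} (hq : 1 ≤ q) {y : ℝ} (hy : 0 < y) :
    ∃ J K : ℕ, 1 ≤ J ∧ 1 ≤ K ∧ (K : ℝ≥0∞) ^ (1 / q.toReal) = 1 ∧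
      1 ≤ ENNReal.ofReal (K * y) * (J : ℝ≥0∞) ^ (1 / q.toReal) := by
  obtain ⟨m, hm⟩ := exists_nat_ge (1 / y)
  have hm1 : 1 ≤ m * y := by rwa [div_le_iff₀ hy] at hm
  have hm0 : 1 ≤ m := by
    rcases Nat.eq_zero_or_pos m with rfl | h
    · norm_num at hm1
    · exact h
  by_cases hqt : q = ⊤
  · refine ⟨1, m, le_rfl, hm0, by simp [hqt], ?_⟩
    simp only [hqt, ENNReal.toReal_top, div_zero, ENNReal.rpow_zero, mul_one]
    rw [ENNReal.one_le_ofReal]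
    exact hm1
  · have hq0 : 0 < q.toReal := ENNReal.toReal_pos (zero_lt_one.trans_le hq).ne' hqt
    obtain ⟨k, hk⟩ := exists_nat_ge q.toReal
    -- Since `k ≥ q`, the root `(m ^ k)^{1/q}` is at least `m ≥ 1/y`.
    refine ⟨m ^ k, 1, Nat.one_le_pow _ _ hm0, le_rfl, by simp, ?_⟩
    have h1 : (m : ℝ≥0∞) ≤ ((m ^ k : ℕ) : ℝ≥0∞) ^ (1 / q.toReal) := by
      rw [Nat.cast_pow, ← ENNReal.rpow_natCast, ← ENNReal.rpow_mul]
      conv_lhs => rw [← ENNReal.rpow_one (m : ℝ≥0∞)]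
      refine ENNReal.rpow_le_rpow_of_exponent_le (by exact_mod_cast hm0) ?_
      rw [mul_one_div, le_div_iff₀ hq0, one_mul]
      exact hk
    refine le_trans ?_ (mul_le_mul_right h1 _)
    rw [Nat.cast_one, one_mul, ← ENNReal.ofReal_natCast, ← ENNReal.ofReal_mul hy.le,
      ENNReal.one_le_ofReal, mul_comm]
    exact hm1

theorem exists_inflating_sequence (hd : 1 ≤ d) {φ : Space d → ℝ} (hφ : IsLittlewoodPaley φ)
    {q : ℝ≥0∞} (hq : 1 ≤ q) : ∃ (f : ℕ → 𝓢(Space d, ℝ)) (t : ℕ → ℝ) (u : ℕ → ℝ → 𝓢(Space d, ℝ))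
      (c₀ : ℝ), (∀ N, IsSchwartzSolution (f N) (u N)) ∧
      Tendsto (fun N ↦ besovENorm φ 0 ∞ q (toDist ((f N).toLp 2 volume))) atTop (𝓝 0) ∧
      (∀ N, 0 < t N) ∧ Tendsto t atTop (𝓝 0) ∧ 0 < c₀ ∧
      ∀ N, ENNReal.ofReal c₀ ≤ besovENorm φ 0 ∞ q (toDist ((u N (t N)).toLp 2 volume)) := by
  obtain ⟨a₀, C, c, ha₀, hC, hc, h⟩ := exists_norm_inflation hd hφ hq
  set a : ℕ → ℝ := fun N ↦ a₀ / (N + 1) with ha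
  have ha0 : ∀ N, 0 < a N := fun N ↦ by positivity
  have ha1 : ∀ N, a N ≤ a₀ := fun N ↦ div_le_self ha₀.le (by linarith [N.cast_nonneg (α := ℝ)])
  have halim : Tendsto a atTop (𝓝 0) := by
    have := (tendsto_one_div_add_atTop_nhds_zero_nat (𝕜 := ℝ)).const_mul a₀
    simpa [ha, div_eq_mul_inv] using this
  -- Taking `y = a²` makes `K a² J^{1/q} ≥ 1`, while the data have norm at most `C a`, which tends
  -- to zero.
  choose J K hJ hK hK1 hJK using fun N ↦ exists_le_natCast_rpow hq (pow_pos (ha0 N) 2)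
  choose f u t hfu ht0 htδ hf hut using fun N ↦ h (a N) (ha0 N) (ha1 N) (J N) (K N) (hJ N) (hK N)
    (1 / ((N : ℝ) + 1)) (by positivity)
  refine ⟨f, t, u, c, hfu, ?_, ht0, ?_, hc, fun N ↦ ?_⟩
  · have h1 : Tendsto (fun N ↦ ENNReal.ofReal (C * a N)) atTop (𝓝 0) := by
      have := (ENNReal.continuous_ofReal.tendsto _).comp (halim.const_mul C)
      simpa [Function.comp_def] using this
    refine tendsto_of_tendsto_of_tendsto_of_le_of_le tendsto_const_nhds h1 (fun _ ↦ zero_le) ?_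
    intro N
    have := hf N
    rwa [hK1, mul_one] at this
  · exact tendsto_of_tendsto_of_tendsto_of_le_of_le tendsto_const_nhds
      tendsto_one_div_add_atTop_nhds_zero_nat (fun N ↦ (ht0 N).le) fun N ↦ (htδ N).le
  · refine le_trans ?_ (hut N)
    rw [ENNReal.ofReal_mul hc.le, mul_assoc]
    exact le_mul_of_one_le_right zero_le (hJK N)

end Construction

end HamiltonJacobi

end

/-! ### The main theorem. -/

open HamiltonJacobi in
theorem theorem1p1 (d : ℕ) (hd : 1 ≤ d)
    (φ : EuclideanSpace ℝ (Fin d) → ℝ) (hφ : IsLittlewoodPaley φ)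
    (s : ℝ) (hs : 1 + (d : ℝ) / 2 < s) (q : ℝ≥0∞) (hq : 1 ≤ q) :
    (∃ (f : ℕ → RealL2 d) (t : ℕ → ℝ) (u : ℕ → ℝ → RealL2 d) (c₀ : ℝ),
      (∀ N, TemperedDistribution.MemSobolev s 2 (toDist (f N))) ∧
      Tendsto (fun N ↦ besovENorm φ 0 ∞ q (toDist (f N))) atTop (𝓝 0) ∧
      (∀ N, 0 < t N) ∧ Tendsto t atTop (𝓝 0) ∧
      (∀ N, IsGlobalSolution s (f N) (u N)) ∧
      (∀ N v, IsGlobalSolution s (f N) v → ∀ τ, 0 ≤ τ → v τ = u N τ) ∧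
      0 < c₀ ∧ ∀ N, ENNReal.ofReal c₀ ≤ besovENorm φ 0 ∞ q (toDist (u N (t N)))) ∧
    ∀ T : ℝ, 0 < T → ¬ SolutionMapContinuousAtZero φ s q T := by
  obtain ⟨f, t, u, c₀, hfu, hf, ht0, htlim, hc₀, hut⟩ := exists_inflating_sequence hd hφ hq
  have hsol := fun N ↦ (hfu N).isGlobalSolution s
  refine ⟨⟨fun N ↦ (f N).toLp 2 volume, t, fun N τ ↦ (u N τ).toLp 2 volume, c₀, fun N ↦ ?_, hf, ht0,
    htlim, hsol, fun N v hv τ hτ ↦ hv.unique hs (hsol N) hτ, hc₀, hut⟩, fun T hT hcont ↦ ?_⟩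
  · rw [toDist_toLp]
    exact SchwartzMap.memSobolev _
  -- Continuity is tested at the zero solution with `ε = c₀`: for large `N` the data are `δ`-small
  -- and the inflation time lies in `[0, T]`.
  · obtain ⟨δ, hδ, h⟩ := hcont _ (isGlobalSolution_zero s) (ENNReal.ofReal c₀)
      (ENNReal.ofReal_pos.2 hc₀)
    obtain ⟨N, hN, hNT⟩ := ((hf.eventually_lt_const hδ).and (htlim.eventually_lt_const hT)).exists
    have h1 := h _ _ (hsol N) hN (t N) ⟨(ht0 N).le, hNT.le⟩
    rw [sub_zero] at h1
    exact absurd (hut N) (not_le.2 h1)
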